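/- **Setting.** Let $D_0,D_1,D_2$ be Hermitian complex $m\times m$ matrices such that $\Delta(x)=\det(x_0D_0+x_1D_1+x_2D_2)$ is irreducible in $\mathbb C[x_0,x_1,x_2]$ (its coefficients are automatically real), and let $C=\{\Delta=0\}\subset\mathbb{CP}^2$. Let $n\ge 1$ and let $p,q\in\mathbb C[x_0,x_1,x_2]$ be homogeneous of degree $n$ (possibly zero). Write $x^i=x_0^{i_0}x_1^{i_1}x_2^{i_2}$ and $|i|=i_0+i_1+i_2$. *Bezout matrix along the curve.* Let $W_n=\bigoplus_{|i|=n-1}\mathbb C^m$, with its Euclidean inner product, and $$V_n=\Big\{(w_i)_{|i|=n-1}\in W_n:\ D_0w_{j+e_0}+D_1w_{j+e_1}+D_2w_{j+e_2}=0\ \text{ for all } |j|=n-2\Big\},$$ where $e_0,e_1,e_2$ are the unit exponent vectors. Consider symmetric complex matrices $\beta^{10},\beta^{20},\beta^{12}$, indexed by the exponents of degree $n-1$, such that $$p(x)q(y)-q(x)p(y)=\sum_{|i|=|j|=n-1}x^i\big(\beta^{10}_{ij}(x_1y_0-x_0y_1)+\beta^{20}_{ij}(x_2y_0-x_0y_2)+\beta^{12}_{ij}(x_1y_2-x_2y_1)\big)y^j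 .$$ Put $B(p,q)=\beta^{12}\otimes D_0+\beta^{20}\otimes D_1-\beta^{10}\otimes D_2$ on $W_n$, and let $B'(p,q)=P_{V_n}B(p,q)|_{V_n}$, an endomorphism of $V_n$, where $P_{V_n}$ is the orthogonal projection onto $V_n$. *Multiplicities.* Let $\nu:\tilde C\to C$ be the normalization (the desingularizing Riemann surface). A point $P\in\tilde C$ counts as a common zero of $p$ and $q$ with multiplicity $\min(\operatorname{ord}_P p,\operatorname{ord}_P q)$, and $$N(p,q)=\sum_{x\in C,\ p(x)=q(x)=0}\ \ \sum_{P\in\nu^{-1}(x)}\min(\operatorname{ord}_P p,\operatorname{ord}_P q)$$ is the number of common zeros of $p$ and $q$ on $C$, counted with multiplicity. For $x\in C$ let $\mathcal O_x$ be the local ring of $C$ at $x$, let $\tilde{\mathcal O}_x$ be its integral closure in the function field of $C$, and let $\mathcal E_x=\mathcal O_x^m/(x_0D_0+x_1D_1+x_2D_2)\mathcal O_x^m$ be the stalk of the cokernel of the determinantal representation (homogeneous polynomials are dehomogenized in an affine chart around $x$). **Theorem 2.6 (with Corollary 2.3).** Matrices $\beta^{10},\beta^{20},\beta^{12}$ as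 above exist, and for every choice of them the following holds. 1. $\det B'(p,q)=0$ if and only if $p$ and $q$ have a common zero on $C$. 2. Suppose that $p$ and $q$ do not both vanish identically on $C$. Then they have only finitely many common zeros on $C$, and: (a) if $\mathcal E_x\cong\tilde{\mathcal O}_x$ as $\mathcal O_x$-modules at every singular point $x$ of $C$ that is a common zero of $p$ and $q$ (that is, the representation comes there from a line bundle on $\tilde C$; there is no condition if $C$ is smooth), then $$\dim\ker B'(p,q)=N(p,q);$$ (b) without any condition at the singular points, $\dim\ker B'(p,q)$ is the number of common zeros of $p$ and $q$ on $C$ when each common zero $x$ is counted with the multiplicity $\operatorname{length}_{\mathcal O_x}\big(\mathcal E_x/(p,q)\mathcal E_x\big)$. -/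

import Mathlib

open MvPolynomial
open scoped LinearAlgebra.Projectivization Kronecker

noncomputable section

/-- Homogeneous coordinates are indexed by `Fin 3`; this is the ring `ℂ[x₀, x₁, x₂]`. -/
abbrev Poly3 : Type := MvPolynomial (Fin 3) ℂ

/-- The linear matrix pencil `x₀ D₀ + x₁ D₁ + x₂ D₂`, with polynomial entries. -/
def pencil {m : ℕ} (D : Fin 3 → Matrix (Fin m) (Fin m) ℂ) : Matrix (Fin m) (Fin m) Poly3 :=
  ∑ l : Fin 3, (X l : Poly3) • (D l).map (C : ℂ → Poly3)

/-- The polynomial `Δ(x₀, x₁, x₂) = det (x₀ D₀ + x₁ D₁ + x₂ D₂)` defining the curve. -/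
def curvePoly {m : ℕ} (D : Fin 3 → Matrix (Fin m) (Fin m) ℂ) : Poly3 :=
  (pencil D).det

/-! ### The blown space and the principal subspace -/

/-- Exponents `i = (i₀, i₁, i₂)` with `i₀ + i₁ + i₂ = k`. -/
abbrev Expo (k : ℕ) : Type :=
  {i : Fin 3 →₀ ℕ // i ∈ Finset.finsuppAntidiag (Finset.univ : Finset (Fin 3)) k}

/-- The exponent `j + e_l`, where `e_l` is the `l`-th unit vector. -/
def Expo.succ {k : ℕ} (j : Expo k) (l : Fin 3) : Expo (k + 1) :=
  ⟨j.1 + Finsupp.single l 1, by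
    have h := j.2
    simp only [Finset.mem_finsuppAntidiag, Finset.subset_univ, and_true] at h ⊢
    simp [Finset.sum_add_distrib, h, Finsupp.single_apply]⟩

/-- The monomial `x₀^i₀ x₁^i₁ x₂^i₂` at a point. -/
def Expo.monomial {k : ℕ} (i : Expo k) (x : Fin 3 → ℂ) : ℂ :=
  ∏ l : Fin 3, x l ^ i.1 l

/-- The blown space of families `(w_i)` of vectors of `ℂ^m`, indexed by the exponents `i` with
`|i| = k`, as a complex Euclidean space of dimension `m (k + 1) (k + 2) / 2`.
For polynomials of degree `n` one takes `k = n - 1`. -/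
abbrev BlownSpace (m k : ℕ) : Type := EuclideanSpace ℂ (Expo k × Fin m)

/-- The principal subspace: the `w` with
`D₀ w_{j + e₀} + D₁ w_{j + e₁} + D₂ w_{j + e₂} = 0` for all exponents `j` with `|j| + 1 = k`
(no condition when `k = 0`). -/
def principalSubspace {m : ℕ} (D : Fin 3 → Matrix (Fin m) (Fin m) ℂ) :
    (k : ℕ) → Submodule ℂ (BlownSpace m k)
  | 0 => ⊤
  | k + 1 =>
    { carrier := {w | ∀ j : Expo k,
        ∑ l : Fin 3, (D l).mulVec (fun s => w (j.succ l, s)) = 0}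
      zero_mem' := by
        intro j
        refine Finset.sum_eq_zero fun l _ => ?_
        ext r
        simp [Matrix.mulVec, dotProduct]
      add_mem' := by
        intro a b ha hb j
        have h : ∀ l : Fin 3, (D l).mulVec (fun s => (a + b) (j.succ l, s)) =
            (D l).mulVec (fun s => a (j.succ l, s)) +
              (D l).mulVec (fun s => b (j.succ l, s)) := by
          intro l
          rw [← Matrix.mulVec_add]
          rfl
        simp only [h, Finset.sum_add_distrib, ha j, hb j, add_zero]
      smul_mem' := by
        intro c a ha j
        have h : ∀ l : Fin 3, (D l).mulVec (fun s => (c • a) (j.succ l, s)) =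
            c • (D l).mulVec (fun s => a (j.succ l, s)) := by
          intro l
          rw [← Matrix.mulVec_smul]
          rfl
        simp only [h, ← Finset.smul_sum, ha j, smul_zero] }

/-! ### The generalized Bezout matrix -/

/-- Symmetric matrices `β¹⁰, β²⁰, β¹²` of Bezout coefficients of `p` and `q`:
`p(x) q(y) - q(x) p(y) = ∑_{i,j} (β¹⁰_{ij} x^i (x₁y₀ - x₀y₁) y^j + β²⁰_{ij} x^i (x₂y₀ - x₀y₂) y^j
  + β¹²_{ij} x^i (x₁y₂ - x₂y₁) y^j)`, where `|i| = |j| = k`. -/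
structure BezoutCoeffs (k : ℕ) (p q : Poly3) where
  b10 : Matrix (Expo k) (Expo k) ℂ
  b20 : Matrix (Expo k) (Expo k) ℂ
  b12 : Matrix (Expo k) (Expo k) ℂ
  symm10 : b10.IsSymm
  symm20 : b20.IsSymm
  symm12 : b12.IsSymm
  identity : ∀ x y : Fin 3 → ℂ,
    eval x p * eval y q - eval x q * eval y p =
      ∑ i : Expo k, ∑ j : Expo k,
        (b10 i j * i.monomial x * (x 1 * y 0 - x 0 * y 1) * j.monomial y +
          b20 i j * i.monomial x * (x 2 * y 0 - x 0 * y 2) * j.monomial y +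
          b12 i j * i.monomial x * (x 1 * y 2 - x 2 * y 1) * j.monomial y)

/-- The matrix `B(p, q) = β¹² ⊗ D₀ + β²⁰ ⊗ D₁ - β¹⁰ ⊗ D₂` on the blown space. The coefficient of
`D_l` is the one of the `l`-th coordinate of the cross product of `x` and `y`, whose coordinates
are `x₁y₂ - x₂y₁`, `x₂y₀ - x₀y₂` and `-(x₁y₀ - x₀y₁)`. -/
def BezoutCoeffs.matrix {m k : ℕ} {p q : Poly3} (b : BezoutCoeffs k p q)
    (D : Fin 3 → Matrix (Fin m) (Fin m) ℂ) : Matrix (Expo k × Fin m) (Expo k × Fin m) ℂ :=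
  b.b12 ⊗ₖ D 0 + b.b20 ⊗ₖ D 1 - b.b10 ⊗ₖ D 2

/-- The generalized Bezout matrix `B'(p, q) = P B(p, q) P` along the curve, where `P` is the
orthogonal projection onto the principal subspace, as an endomorphism of that subspace. -/
def BezoutCoeffs.alongCurve {m k : ℕ} {p q : Poly3} (b : BezoutCoeffs k p q)
    (D : Fin 3 → Matrix (Fin m) (Fin m) ℂ) :
    principalSubspace D k →ₗ[ℂ] principalSubspace D k :=
  (principalSubspace D k).orthogonalProjectionOnto.toLinearMap ∘ₗ
    Matrix.toEuclideanLin (b.matrix D) ∘ₗ (principalSubspace D k).subtype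

/-! ### Common zeros and their multiplicities -/

/-- The common zeros of `p` and `q` on the curve in `ℂℙ²`. (The polynomials in question are
homogeneous, so the choice of the representative does not matter.) -/
def commonZeros {m : ℕ} (D : Fin 3 → Matrix (Fin m) (Fin m) ℂ) (p q : Poly3) :
    Set (ℙ ℂ (Fin 3 → ℂ)) :=
  {x | eval x.rep (curvePoly D) = 0 ∧ eval x.rep p = 0 ∧ eval x.rep q = 0}

/-- The ideal of the polynomials that vanish at the point `v` of `ℂ³`. -/
def pointIdeal (v : Fin 3 → ℂ) : Ideal Poly3 :=
  RingHom.ker (eval v : Poly3 →+* ℂ)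

instance pointIdeal_isPrime (v : Fin 3 → ℂ) : (pointIdeal v).IsPrime :=
  RingHom.ker_isPrime (eval v : Poly3 →+* ℂ)

/-- The local ring of `ℂ³` at the point `v`. -/
abbrev SpaceLocalRing (v : Fin 3 → ℂ) : Type :=
  Localization.AtPrime (pointIdeal v)

/-- For `v ≠ 0`, the equation of the affine plane through `v` orthogonal to `v`. This plane does
not contain the origin, so it is an affine chart of `ℂℙ²` around the point `[v]`. -/
def chartEq (v : Fin 3 → ℂ) : Poly3 :=
  ∑ l : Fin 3, C (star (v l)) * (X l - C (v l))

/-- The local ring `𝒪` at `[v]` of the projective plane curve `Δ = 0`, computed in the affine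
chart around `[v]`: the local ring of `ℂ³` at `v` modulo `Δ` and the equation of the chart. -/
def CurveLocalRing (Δ : Poly3) (v : Fin 3 → ℂ) : Type :=
  SpaceLocalRing v ⧸ Ideal.span
    {algebraMap Poly3 (SpaceLocalRing v) Δ, algebraMap Poly3 (SpaceLocalRing v) (chartEq v)}

instance CurveLocalRing.instCommRing (Δ : Poly3) (v : Fin 3 → ℂ) :
    CommRing (CurveLocalRing Δ v) :=
  inferInstanceAs (CommRing (SpaceLocalRing v ⧸ Ideal.span
    {algebraMap Poly3 (SpaceLocalRing v) Δ, algebraMap Poly3 (SpaceLocalRing v) (chartEq v)}))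

/-- The germ at `[v]` of a homogeneous polynomial, dehomogenized in the chart. -/
def germ (Δ : Poly3) (v : Fin 3 → ℂ) : Poly3 →+* CurveLocalRing Δ v :=
  (Ideal.Quotient.mk (Ideal.span
    {algebraMap Poly3 (SpaceLocalRing v) Δ, algebraMap Poly3 (SpaceLocalRing v) (chartEq v)})).comp
    (algebraMap Poly3 (SpaceLocalRing v))

/-- The integral closure of the local ring at `[v]` in the function field of the curve: its
maximal ideals are the points over `[v]` of the desingularizing Riemann surface. -/
abbrev NormalizedLocalRing (Δ : Poly3) (v : Fin 3 → ℂ) : Type :=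
  integralClosure (CurveLocalRing Δ v) (FractionRing (CurveLocalRing Δ v))

/-- The points over `[v]` of the desingularizing Riemann surface of the curve. -/
abbrev PointOver (Δ : Poly3) (v : Fin 3 → ℂ) : Type :=
  MaximalSpectrum (NormalizedLocalRing Δ v)

/-- The order of vanishing of a homogeneous polynomial at a point of the desingularizing Riemann
surface over `[v]` (it is `⊤` if the polynomial vanishes on the whole curve). -/
def PointOver.ord {Δ : Poly3} {v : Fin 3 → ℂ} (P : PointOver Δ v) (f : Poly3) : ℕ∞ :=
  emultiplicity P.asIdeal
    (Ideal.span {algebraMap (CurveLocalRing Δ v) (NormalizedLocalRing Δ v) (germ Δ v f)})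

/-- The number of common zeros of `p` and `q` on the curve, counted with multiplicities: the
multiplicity of a point of the desingularizing Riemann surface as a common zero of `p` and `q` is
the minimum of the two orders of vanishing. -/
def numCommonZeros {m : ℕ} (D : Fin 3 → Matrix (Fin m) (Fin m) ℂ) (p q : Poly3) : ℕ∞ :=
  ∑ᶠ x ∈ commonZeros D p q, ∑ᶠ P : PointOver (curvePoly D) x.rep, min (P.ord p) (P.ord q)

/-- The stalk at `[v]` of the cokernel sheaf of the determinantal representation. -/
abbrev CokerStalk {m : ℕ} (D : Fin 3 → Matrix (Fin m) (Fin m) ℂ) (v : Fin 3 → ℂ) : Type :=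
  (Fin m → CurveLocalRing (curvePoly D) v) ⧸
    LinearMap.range (Matrix.mulVecLin ((pencil D).map (germ (curvePoly D) v)))

/-- Near `[v]`, the cokernel sheaf of the determinantal representation is the direct image of a
line bundle on the desingularizing Riemann surface. -/
def IsDirectImageAt {m : ℕ} (D : Fin 3 → Matrix (Fin m) (Fin m) ℂ) (v : Fin 3 → ℂ) : Prop :=
  Nonempty (CokerStalk D v ≃ₗ[CurveLocalRing (curvePoly D) v]
    NormalizedLocalRing (curvePoly D) v)

/-- `[v]` is a singular point of the curve (for `v` on the curve). -/
def IsSingularAt (Δ : Poly3) (v : Fin 3 → ℂ) : Prop :=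
  ∀ l : Fin 3, eval v (pderiv l Δ) = 0

/-- The multiplicity of `[v]` as a common zero of `p` and `q` relative to the determinantal
representation: the length of the stalk at `[v]` of the cokernel sheaf modulo `p` and `q`. -/
def cokerMultiplicity {m : ℕ} (D : Fin 3 → Matrix (Fin m) (Fin m) ℂ) (p q : Poly3)
    (v : Fin 3 → ℂ) : ℕ∞ :=
  Module.length (CurveLocalRing (curvePoly D) v)
    (CokerStalk D v ⧸
      (Ideal.span {germ (curvePoly D) v p, germ (curvePoly D) v q} •
        (⊤ : Submodule (CurveLocalRing (curvePoly D) v) (CokerStalk D v))))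

end

/-! Let S be the polynomial ring, A the pencil and E = S^m / A S^m its cokernel, a graded module
supported on the curve. The kernel of B' turns out to have the dimension of the piece of degree 2n -
1 of E/(p,q)E, and this piece is the direct sum of the stalks of E/(p,q)E at the common zeros.

The Bezoutian as an operator. Consider functionals Φ on S^m that vanish on the image of the
transposed pencil; their values on monomial vectors of degree n - 1 fill V_n. A Bezoutian b of p and
q turns Φ into the polynomial vector b(Φ) obtained by letting Φ act on b_l(x,y) in the variables y,
applying D_l and summing over l. In coordinates this is w ↦ B w. Since the D_l are Hermitian, the
orthogonal complement of V_n is the part of degree n - 1 of A S^m, so B'w = 0 says that b(Φ) is zero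
in E. Everything rests on the exchange identity f b(gΦ) - g b(fΦ) = p b'(qΦ) - q b'(pΦ) in E, for b'
a Bezoutian of f and g (`bezoutApply_exchange`), which comes from D × (x × y) = x (D·y) - y (D·x):
here D·x is zero on E and D·y is zero on Φ.

The kernel. Let Δ not divide p (otherwise exchange p and q). Then p has finitely many zeros on the
curve, and a linear form ℓ avoiding them is a nonzerodivisor on E/pE. If b₁ is a Bezoutian of p and
ℓ^n, the exchange identity gives ℓ^n b(Φ) = q b₁(Φ) in E/pE. The map b₁ is injective on V_n, and V_n
and E_{n-1} both have dimension mn, so b₁ identifies ker B' with the kernel of q from E_{n-1} to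
(E/pE)_{2n-1}. The target also has dimension mn, so this kernel has the dimension of the cokernel
(E/(p,q)E)_{2n-1} (`finrank_ker_alongCurve`).

Localization. Multiplication by ℓ is bijective on E/(p,q)E from degree 2n - 1 on. With the
Nullstellensatz, an element of such a degree whose germs at all common zeros vanish is zero; in
large degrees the germs can be prescribed (`gradedDim_eq_sum`). The residue fields are ℂ, so
dimensions are lengths, which is (b). Where the stalk of E is the normalized local ring, as at every
nonsingular point, the quotient by p and q is a quotient of a Dedekind domain, whose length is the
sum of the minima of the orders (`finsum_ord_eq_cokerMultiplicity`); this is (a).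

The determinant. Evaluation at a common zero gives an explicit kernel vector, even if p and q both
vanish on the whole curve; the converse follows from the dimension formula. -/

noncomputable section

/-! ### Torsion and regularity for cokernels of square matrices -/

/-- Multiplying by the adjugate gives f adj(A) u = det(A) a, so det(A) divides every coordinate of
adj(A) u. Cancelling det(A) in A adj(A) u = det(A) u exhibits u in the image. Thus a nonzerodivisor
modulo the determinant is one on the cokernel. -/
theorem Matrix.exists_eq_mulVec_of_smul_eq_mulVec {R : Type*} [CommRing R] [IsDomain R] {m : ℕ}
    (A : Matrix (Fin m) (Fin m) R) (hA : A.det ≠ 0) (f : R)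
    (hf : ∀ g, A.det ∣ f * g → A.det ∣ g) (u a : Fin m → R) (h : f • u = A.mulVec a) :
    ∃ b, u = A.mulVec b := by
  have h1 : f • A.adjugate.mulVec u = A.det • a := by
    rw [← Matrix.mulVec_smul, h, Matrix.mulVec_mulVec, Matrix.adjugate_mul, Matrix.smul_mulVec,
      Matrix.one_mulVec]
  have h2 : ∀ i, ∃ b, A.adjugate.mulVec u i = A.det * b := fun i =>
    hf _ ⟨a i, by simpa using congrFun h1 i⟩
  choose b hb using h2
  refine ⟨b, ?_⟩
  have h3 : A.det • u = A.det • A.mulVec b := by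
    rw [← Matrix.mulVec_smul, ← (show A.adjugate.mulVec u = A.det • b from funext hb),
      Matrix.mulVec_mulVec, Matrix.mul_adjugate, Matrix.smul_mulVec, Matrix.one_mulVec]
  exact smul_right_injective _ hA h3

/-- The linear form with coefficients `c`. -/
def linForm (c : Fin 3 → ℂ) : Poly3 := ∑ l, C (c l) * X l

theorem eval_linForm (c x : Fin 3 → ℂ) : eval x (linForm c) = ∑ l, c l * x l := by
  simp [linForm]

theorem linForm_isHomogeneous (c : Fin 3 → ℂ) : (linForm c).IsHomogeneous 1 := by
  refine IsHomogeneous.sum _ _ _ fun l _ => ?_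
  simpa using (isHomogeneous_C (Fin 3) (c l)).mul (isHomogeneous_X ℂ l)

/-- The substitution that eliminates the variable `x_a` along the linear form `c`. -/
def elimVar (c : Fin 3 → ℂ) (a : Fin 3) : Poly3 →ₐ[ℂ] Poly3 :=
  aeval fun b => X b - if b = a then C (c a)⁻¹ * linForm c else 0

theorem elimVar_linForm (c : Fin 3 → ℂ) (a : Fin 3) (ha : c a ≠ 0) :
    elimVar c a (linForm c) = 0 := by
  have h : (C (c a) : Poly3) * C (c a)⁻¹ = 1 := by rw [← C_mul, mul_inv_cancel₀ ha, C_1]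
  conv_lhs => rw [linForm]
  simp only [elimVar, map_sum, map_mul, aeval_X, algHom_C, algebraMap_eq, mul_sub, mul_ite, mul_zero,
    Finset.sum_sub_distrib, Finset.sum_ite_eq', Finset.mem_univ, if_true]
  rw [← mul_assoc, h, one_mul, linForm, sub_self]

theorem linForm_dvd_sub_elimVar (c : Fin 3 → ℂ) (a : Fin 3) (f : Poly3) :
    linForm c ∣ f - elimVar c a f := by
  rw [← Ideal.mem_span_singleton, ← Ideal.Quotient.eq]
  let π := Ideal.Quotient.mkₐ ℂ (Ideal.span {linForm c})
  have h : π = π.comp (elimVar c a) := by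
    refine algHom_ext fun b => ?_
    have h0 : π (linForm c) = 0 :=
      Ideal.Quotient.eq_zero_iff_mem.2 (Ideal.mem_span_singleton_self _)
    by_cases hb : b = a <;> simp [elimVar, hb, h0]
  exact DFunLike.congr_fun h f

theorem eval_elimVar (c : Fin 3 → ℂ) (a : Fin 3) (f : Poly3) (x : Fin 3 → ℂ) :
    eval x (elimVar c a f) =
      eval (fun b => x b - if b = a then (c a)⁻¹ * ∑ l, c l * x l else 0) f := by
  have h : (eval x : Poly3 →+* ℂ).comp (elimVar c a : Poly3 →+* Poly3) =
      eval (fun b => x b - if b = a then (c a)⁻¹ * ∑ l, c l * x l else 0) := by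
    refine ringHom_ext (fun r => by simp [elimVar]) fun b => ?_
    by_cases hb : b = a <;> simp [elimVar, hb, eval_linForm]
  exact RingHom.congr_fun h f

theorem MvPolynomial.mem_radical_of_forall_eval (I : Ideal Poly3) (f : Poly3)
    (h : ∀ x : Fin 3 → ℂ, (∀ g ∈ I, eval x g = 0) → eval x f = 0) : f ∈ I.radical := by
  rw [← vanishingIdeal_zeroLocus_eq_radical (K := ℂ) I, mem_vanishingIdeal_iff]
  intro x hx
  have := h x fun g hg => by simpa [aeval_eq_eval] using hx g hg
  simpa [aeval_eq_eval] using this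

/-- A common divisor vanishes only on the axis of `x_a`, if at all, so by the Nullstellensatz it
divides powers of two different variables. The axis appears because the polynomials of interest no
longer involve `x_a` after an elimination. -/
theorem isRelPrime_of_forall_eval {f g : Poly3} (a : Fin 3)
    (h : ∀ x : Fin 3 → ℂ, eval x f = 0 → eval x g = 0 → ∀ b, b ≠ a → x b = 0) :
    IsRelPrime f g := by
  intro d hdf hdg
  have hrad : ∀ b, b ≠ a → ∃ n, d ∣ (X b : Poly3) ^ n := by
    intro b hb
    have : (X b : Poly3) ∈ (Ideal.span {d}).radical := by
      refine mem_radical_of_forall_eval _ _ fun x hx => ?_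
      have hd := hx d (Ideal.mem_span_singleton_self d)
      have hz : ∀ e, d ∣ e → eval x e = 0 := by
        rintro _ ⟨e, rfl⟩
        simp [hd]
      simpa using h x (hz f hdf) (hz g hdg) b hb
    obtain ⟨n, hn⟩ := this
    exact ⟨n, Ideal.mem_span_singleton.1 hn⟩
  obtain ⟨b, c, hb, hc, hbc⟩ : ∃ b c : Fin 3, b ≠ a ∧ c ≠ a ∧ b ≠ c :=
    (by decide : ∀ a : Fin 3, ∃ b c : Fin 3, b ≠ a ∧ c ≠ a ∧ b ≠ c) a
  obtain ⟨i, hi⟩ := hrad b hb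
  obtain ⟨j, hj⟩ := hrad c hc
  have hrel : IsRelPrime (X b : Poly3) (X c) := by
    refine (Irreducible.isRelPrime_iff_not_dvd (X_prime (R := ℂ)).irreducible).2 fun hdvd => ?_
    obtain ⟨e, he⟩ := hdvd
    have := congrArg (eval (Pi.single c 1)) he
    simp [hbc] at this
  exact (hrel.pow (m := i) (n := j)) hi hj

/-- If the linear form `c` has no nontrivial common zero with `p` and `det A`, then it is a
nonzerodivisor on the cokernel of `A` modulo `p`. -/
theorem exists_of_linForm_smul_eq {m : ℕ} (A : Matrix (Fin m) (Fin m) Poly3) (hA : Prime A.det)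
    (p : Poly3) (hp0 : eval 0 p = 0) (c : Fin 3 → ℂ)
    (hc : ∀ x, eval x A.det = 0 → eval x p = 0 → ∑ l, c l * x l = 0 → x = 0)
    (hc0 : c ≠ 0) (u a b : Fin m → Poly3)
    (h : linForm c • u = A.mulVec a + p • b) : ∃ a' b', u = A.mulVec a' + p • b' := by
  obtain ⟨i, hi⟩ : ∃ i, c i ≠ 0 := by
    by_contra! h'
    exact hc0 (funext h')
  set φ := elimVar c i with hφ
  have hzero : ∀ x : Fin 3 → ℂ,
      ∑ l, c l * (x l - if l = i then (c i)⁻¹ * ∑ j, c j * x j else 0) = 0 := by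
    intro x
    simp only [mul_sub, mul_ite, mul_zero, Finset.sum_sub_distrib, Finset.sum_ite_eq',
      Finset.mem_univ, if_true]
    rw [mul_inv_cancel_left₀ hi, sub_self]
  -- On the plane where the linear form vanishes, the determinant and `p` meet only at the origin.
  -- In the remaining two variables they are therefore coprime.
  have hrel : IsRelPrime (φ A.det) (φ p) := by
    refine isRelPrime_of_forall_eval i fun x hx1 hx2 j hj => ?_
    rw [hφ, eval_elimVar] at hx1 hx2
    have := congrFun (hc _ hx1 hx2 (hzero x)) j
    simpa [hj] using this
  -- If the restricted determinant were zero, coprimality would make the restriction of `p` a unit,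
  -- but `p` vanishes at the origin.
  have hdet : φ A.det ≠ 0 := by
    intro h0
    rw [h0] at hrel
    have hu : IsUnit (φ p) := hrel (dvd_zero _) dvd_rfl
    have h1 := hu.map (eval (0 : Fin 3 → ℂ))
    rw [hφ, eval_elimVar] at h1
    simp only [Pi.zero_apply, mul_zero, Finset.sum_const_zero, ite_self, sub_zero] at h1
    exact h1.ne_zero hp0
  let B : Matrix (Fin m) (Fin m) Poly3 := A.map φ
  have hB : B.det = φ A.det := (AlgHom.map_det φ A).symm
  have hmap : ∀ v : Fin m → Poly3, (fun s => φ (A.mulVec v s)) = B.mulVec fun s => φ (v s) := by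
    intro v
    ext1 s
    simp [Matrix.mulVec, dotProduct, B]
  have h1 : φ p • (fun s => φ (b s)) = B.mulVec (-fun s => φ (a s)) := by
    rw [Matrix.mulVec_neg, ← hmap]
    ext1 s
    have := congrArg φ (congrFun h s)
    simp only [Pi.smul_apply, Pi.add_apply, smul_eq_mul, map_mul, map_add, hφ,
      elimVar_linForm c i hi, zero_mul] at this
    simp only [Pi.smul_apply, Pi.neg_apply, smul_eq_mul, hφ]
    linear_combination -this
  obtain ⟨d, hd⟩ := B.exists_eq_mulVec_of_smul_eq_mulVec (hB ▸ hdet) _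
    (fun g hg => by
      rw [hB] at hg ⊢
      exact hrel.dvd_of_dvd_mul_left hg) _ _ h1
  choose e he using fun s t => linForm_dvd_sub_elimVar c i (A s t)
  choose b' hb' using fun s => linForm_dvd_sub_elimVar c i (b s)
  -- `b = A d + ℓ r`
  obtain ⟨r, hr⟩ : ∃ r, b = A.mulVec d + linForm c • r := by
    refine ⟨b' - Matrix.mulVec (Matrix.of e) d, ?_⟩
    have hBA : B = A - linForm c • Matrix.of e := by
      ext1 s t
      have := he s t
      simp only [B, Matrix.map_apply, Matrix.sub_apply, Matrix.smul_apply, Matrix.of_apply,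
        smul_eq_mul]
      linear_combination -this
    have hb2 : b = (fun s => φ (b s)) + linForm c • b' := by
      ext1 s
      have := hb' s
      simp only [Pi.add_apply, Pi.smul_apply, smul_eq_mul, hφ]
      linear_combination this
    rw [hb2, hd, hBA, Matrix.sub_mulVec, Matrix.smul_mulVec]
    module
  -- Substituting `b` turns the relation modulo `p` into one on the cokernel of `A` alone, where the
  -- linear form can be cancelled.
  have h2 : linForm c • (u - p • r) = A.mulVec (a + p • d) := by
    rw [smul_sub, h, hr, Matrix.mulVec_add, Matrix.mulVec_smul]
    module
  -- The elimination kills the linear form but not the determinant, so in a factorization the linear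
  -- form would divide the cofactor and the determinant would be a unit.
  have hlin : ¬ A.det ∣ linForm c := by
    rintro ⟨g, hg⟩
    have h3 : φ A.det * φ g = 0 := by
      rw [← map_mul, ← hg, hφ, elimVar_linForm c i hi]
    have h4 : φ g = 0 := (mul_eq_zero.1 h3).resolve_left hdet
    obtain ⟨g', hg'⟩ := linForm_dvd_sub_elimVar c i g
    rw [← hφ, h4, sub_zero] at hg'
    have hl0 : linForm c ≠ 0 := by
      intro h5
      have := congrArg (eval (Pi.single i 1)) h5
      simp [eval_linForm, Pi.single_apply, hi] at this
    refine hA.not_isUnit (IsUnit.of_mul_eq_one g' (mul_left_cancel₀ hl0 ?_))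
    rw [mul_one]
    conv_rhs => rw [hg, hg']
    ring
  obtain ⟨a', ha'⟩ := A.exists_eq_mulVec_of_smul_eq_mulVec hA.ne_zero _
    (fun g hg => (hA.dvd_or_dvd hg).resolve_left hlin) _ _ h2
  exact ⟨a', r, by rw [← ha']; simp⟩

/-! ### Graded pieces of cokernels -/

/-- The kernel condition makes the image of `g₁` the quotient of the image of `g₀` by `R`. Comparing
only subspaces of `H` avoids maps between the various quotient modules. -/
theorem LinearMap.finrank_range_add_of_ker_eq_comap {K H M₀ M₁ : Type*} [Field K]
    [AddCommGroup H] [Module K H] [FiniteDimensional K H] [AddCommGroup M₀] [Module K M₀]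
    [AddCommGroup M₁] [Module K M₁] (g₀ : H →ₗ[K] M₀) (g₁ : H →ₗ[K] M₁) (R : Submodule K M₀)
    (hR : R ≤ LinearMap.range g₀) (h : LinearMap.ker g₁ = R.comap g₀) :
    Module.finrank K (LinearMap.range g₁) + Module.finrank K R =
      Module.finrank K (LinearMap.range g₀) := by
  have e0 := LinearMap.finrank_range_add_finrank_ker g₀
  have e1 := LinearMap.finrank_range_add_finrank_ker g₁
  have e2 := LinearMap.finrank_range_add_finrank_ker (g₀.domRestrict (LinearMap.ker g₁))
  have h1 : LinearMap.range (g₀.domRestrict (LinearMap.ker g₁)) = R := by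
    rw [LinearMap.range_domRestrict, h, Submodule.map_comap_eq, inf_eq_right.2 hR]
  have hle : LinearMap.ker g₀ ≤ LinearMap.ker g₁ := by
    rw [h]
    exact LinearMap.ker_le_comap g₀
  have h2 : Module.finrank K (LinearMap.ker (g₀.domRestrict (LinearMap.ker g₁))) =
      Module.finrank K (LinearMap.ker g₀) := by
    rw [LinearMap.ker_domRestrict]
    exact (Submodule.comapSubtypeEquivOfLe hle).finrank_eq
  rw [h1, h2] at e2
  omega

theorem LinearMap.finrank_range_eq_of_ker_eq {K H M₀ M₁ : Type*} [Field K]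
    [AddCommGroup H] [Module K H] [FiniteDimensional K H] [AddCommGroup M₀] [Module K M₀]
    [AddCommGroup M₁] [Module K M₁] (g₀ : H →ₗ[K] M₀) (g₁ : H →ₗ[K] M₁)
    (h : LinearMap.ker g₀ = LinearMap.ker g₁) :
    Module.finrank K (LinearMap.range g₀) = Module.finrank K (LinearMap.range g₁) := by
  have e0 := LinearMap.finrank_range_add_finrank_ker g₀
  have e1 := LinearMap.finrank_range_add_finrank_ker g₁
  rw [h] at e0
  omega

/-- The vectors of homogeneous polynomials of degree `k`. -/
def homVec (m k : ℕ) : Submodule ℂ (Fin m → Poly3) :=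
  Submodule.pi Set.univ fun _ => homogeneousSubmodule (Fin 3) ℂ k

theorem mem_homVec {m k : ℕ} {u : Fin m → Poly3} :
    u ∈ homVec m k ↔ ∀ s, (u s).IsHomogeneous k := by
  simp [homVec]

theorem smul_mem_homVec {m d k : ℕ} {f : Poly3} (hf : f.IsHomogeneous d) {u : Fin m → Poly3}
    (hu : u ∈ homVec m k) : f • u ∈ homVec m (d + k) :=
  mem_homVec.2 fun s => hf.mul (mem_homVec.1 hu s)

theorem mulVec_mem_homVec {m k : ℕ} {A : Matrix (Fin m) (Fin m) Poly3}
    (hA : ∀ i j, (A i j).IsHomogeneous 1) {u : Fin m → Poly3}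
    (hu : u ∈ homVec m k) : A.mulVec u ∈ homVec m (1 + k) :=
  mem_homVec.2 fun s => IsHomogeneous.sum _ _ _ fun i _ => (hA s i).mul (mem_homVec.1 hu i)

/-- The homogeneous component of degree `t - d`, which is zero if `t < d`. -/
def shiftComp (d t : ℕ) : Poly3 →ₗ[ℂ] Poly3 :=
  if d ≤ t then homogeneousComponent (t - d) else 0

theorem homogeneousComponent_mul_eq {d : ℕ} {f : Poly3} (hf : f.IsHomogeneous d) (t : ℕ)
    (g : Poly3) : homogeneousComponent t (f * g) = f * shiftComp d t g := by
  have key : ∀ i, homogeneousComponent t (f * homogeneousComponent i g) =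
      f * shiftComp d t (homogeneousComponent i g) := by
    intro i
    have h1 : f * homogeneousComponent i g ∈ homogeneousSubmodule (Fin 3) ℂ (d + i) :=
      hf.mul (homogeneousComponent_isHomogeneous i g)
    rw [homogeneousComponent_of_mem h1]
    unfold shiftComp
    by_cases h : d ≤ t
    · rw [if_pos h, homogeneousComponent_of_mem (homogeneousComponent_mem i g)]
      by_cases h' : t - d = i
      · rw [if_pos h', if_pos (by omega)]
      · rw [if_neg h', if_neg (by omega), mul_zero]
    · rw [if_neg h, if_neg (by omega), LinearMap.zero_apply, mul_zero]
  conv_lhs => rw [← sum_homogeneousComponent g]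
  conv_rhs => rw [← sum_homogeneousComponent g]
  rw [Finset.mul_sum, map_sum, map_sum, Finset.mul_sum]
  exact Finset.sum_congr rfl fun i _ => key i

/-- The homogeneous component of degree `t` of a vector of polynomials. -/
def compVec (m t : ℕ) : (Fin m → Poly3) →ₗ[ℂ] (Fin m → Poly3) :=
  (homogeneousComponent t).compLeft (Fin m)

/-- The homogeneous component of degree `t - d` of a vector of polynomials. -/
def shiftVec (m d t : ℕ) : (Fin m → Poly3) →ₗ[ℂ] (Fin m → Poly3) :=
  (shiftComp d t).compLeft (Fin m)

theorem compVec_mem (m t : ℕ) (u : Fin m → Poly3) : compVec m t u ∈ homVec m t :=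
  mem_homVec.2 fun s => homogeneousComponent_isHomogeneous t (u s)

theorem shiftVec_eq_compVec (m d t : ℕ) (h : d ≤ t) : shiftVec m d t = compVec m (t - d) := by
  simp [shiftVec, compVec, shiftComp, h]

theorem shiftVec_eq_zero (m d t : ℕ) (h : t < d) : shiftVec m d t = 0 := by
  refine LinearMap.ext fun u => funext fun s => ?_
  simp [shiftVec, shiftComp, h.not_ge]

theorem shiftVec_mem (m d t k : ℕ) (h : d + k = t) (u : Fin m → Poly3) :
    shiftVec m d t u ∈ homVec m k := by
  rw [shiftVec_eq_compVec m d t (by omega), show t - d = k by omega]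
  exact compVec_mem m k u

theorem compVec_of_mem {m t k : ℕ} {u : Fin m → Poly3} (hu : u ∈ homVec m k) :
    compVec m t u = if t = k then u else 0 := by
  funext s
  have := homogeneousComponent_of_mem (m := t) (mem_homVec.1 hu s)
  split_ifs with h <;> simp_all [compVec]

theorem compVec_smul {m d : ℕ} {f : Poly3} (hf : f.IsHomogeneous d) (t : ℕ)
    (u : Fin m → Poly3) : compVec m t (f • u) = f • shiftVec m d t u := by
  funext s
  simpa [compVec, shiftVec] using homogeneousComponent_mul_eq hf t (u s)

theorem compVec_mulVec {m : ℕ} {A : Matrix (Fin m) (Fin m) Poly3}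
    (hA : ∀ i j, (A i j).IsHomogeneous 1) (t : ℕ) (u : Fin m → Poly3) :
    compVec m t (A.mulVec u) = A.mulVec (shiftVec m 1 t u) := by
  funext s
  simp [compVec, shiftVec, Matrix.mulVec, dotProduct, map_sum,
    homogeneousComponent_mul_eq (hA _ _)]

theorem exists_sum_compVec (m : ℕ) (u : Fin m → Poly3) :
    ∃ N, (∀ t, N ≤ t → compVec m t u = 0) ∧
      ∀ T, N ≤ T → u = ∑ t ∈ Finset.range T, compVec m t u := by
  let N := Finset.univ.sup (fun s => (u s).totalDegree) + 1
  have hN : ∀ t, N ≤ t → compVec m t u = 0 := by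
    intro t ht
    funext s
    have : (u s).totalDegree ≤ _ :=
      Finset.le_sup (f := fun s => (u s).totalDegree) (Finset.mem_univ s)
    exact homogeneousComponent_eq_zero _ _ (by omega)
  refine ⟨N, hN, fun T hT => ?_⟩
  funext s
  have h1 : (u s).totalDegree ≤ _ :=
    Finset.le_sup (f := fun s => (u s).totalDegree) (Finset.mem_univ s)
  rw [Finset.sum_apply]
  conv_lhs => rw [← sum_homogeneousComponent (u s)]
  refine Finset.sum_subset (Finset.range_mono (by omega)) fun i _ hi => ?_
  exact homogeneousComponent_eq_zero _ _ (by simpa using hi)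

/-- The submodule generated by the columns of `A` and the multiples of `p` and `q`. -/
def relations {m : ℕ} (A : Matrix (Fin m) (Fin m) Poly3) (p q : Poly3) :
    Submodule Poly3 (Fin m → Poly3) where
  carrier := {u | ∃ a b c, u = A.mulVec a + p • b + q • c}
  zero_mem' := ⟨0, 0, 0, by simp⟩
  add_mem' := by
    rintro _ _ ⟨a, b, c, rfl⟩ ⟨a', b', c', rfl⟩
    exact ⟨a + a', b + b', c + c', by rw [Matrix.mulVec_add]; module⟩
  smul_mem' := by
    rintro f _ ⟨a, b, c, rfl⟩
    exact ⟨f • a, f • b, f • c, by rw [Matrix.mulVec_smul]; module⟩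

theorem mem_relations {m : ℕ} {A : Matrix (Fin m) (Fin m) Poly3} {p q : Poly3}
    {u : Fin m → Poly3} :
    u ∈ relations A p q ↔ ∃ a b c, u = A.mulVec a + p • b + q • c := Iff.rfl

theorem mem_relations_single {m : ℕ} {A : Matrix (Fin m) (Fin m) Poly3} {p : Poly3}
    {u : Fin m → Poly3} : u ∈ relations A p 0 ↔ ∃ a b, u = A.mulVec a + p • b := by
  simp [mem_relations]

theorem mem_relations_zero {m : ℕ} {A : Matrix (Fin m) (Fin m) Poly3}
    {u : Fin m → Poly3} : u ∈ relations A 0 0 ↔ ∃ a, u = A.mulVec a := by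
  simp [mem_relations]

theorem relations_zero_le {m : ℕ} (A : Matrix (Fin m) (Fin m) Poly3) (p q : Poly3) :
    relations A 0 0 ≤ relations A p q := by
  intro u hu
  obtain ⟨a, rfl⟩ := mem_relations_zero.1 hu
  exact ⟨a, 0, 0, by simp⟩

theorem relations_single_le {m : ℕ} (A : Matrix (Fin m) (Fin m) Poly3) (p q : Poly3) :
    relations A p 0 ≤ relations A p q := by
  intro u hu
  obtain ⟨a, b, rfl⟩ := mem_relations_single.1 hu
  exact ⟨a, b, 0, by simp⟩

theorem mulVec_mem_relations {m : ℕ} (A : Matrix (Fin m) (Fin m) Poly3) (p q : Poly3)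
    (a : Fin m → Poly3) : A.mulVec a ∈ relations A p q :=
  ⟨a, 0, 0, by simp⟩

theorem left_smul_mem_relations {m : ℕ} (A : Matrix (Fin m) (Fin m) Poly3) (p q : Poly3)
    (a : Fin m → Poly3) : p • a ∈ relations A p q :=
  ⟨0, a, 0, by simp⟩

theorem right_smul_mem_relations {m : ℕ} (A : Matrix (Fin m) (Fin m) Poly3) (p q : Poly3)
    (a : Fin m → Poly3) : q • a ∈ relations A p q :=
  ⟨0, 0, a, by simp⟩

theorem det_smul_mem_relations {m : ℕ} (A : Matrix (Fin m) (Fin m) Poly3) (p q : Poly3)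
    (a : Fin m → Poly3) : A.det • a ∈ relations A p q := by
  have : A.det • a = A.mulVec (A.adjugate.mulVec a) := by
    rw [Matrix.mulVec_mulVec, Matrix.mul_adjugate, Matrix.smul_mulVec, Matrix.one_mulVec]
  rw [this]
  exact mulVec_mem_relations A p q _

section graded

variable {m : ℕ} {A : Matrix (Fin m) (Fin m) Poly3} (hA : ∀ i j, (A i j).IsHomogeneous 1)
  {n : ℕ} {p q : Poly3} (hp : p.IsHomogeneous n) (hq : q.IsHomogeneous n)

-- Taking a graded component of a relation takes graded components of its coefficient vectors. Hence
-- the relations form a graded submodule, and homogeneous elements have homogeneous coefficient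
-- vectors.
include hA hp hq in
theorem compVec_relation (t : ℕ) (a b c : Fin m → Poly3) :
    compVec m t (A.mulVec a + p • b + q • c) =
      A.mulVec (shiftVec m 1 t a) + p • shiftVec m n t b + q • shiftVec m n t c := by
  rw [map_add, map_add, compVec_mulVec hA, compVec_smul hp, compVec_smul hq]

include hA hp hq in
theorem compVec_mem_relations (t : ℕ) {u : Fin m → Poly3} (hu : u ∈ relations A p q) :
    compVec m t u ∈ relations A p q := by
  obtain ⟨a, b, c, rfl⟩ := hu
  exact ⟨_, _, _, compVec_relation hA hp hq t a b c⟩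

include hA in
theorem mem_relations_zero_of_mem_homVec {k : ℕ} {u : Fin m → Poly3} (hu : u ∈ homVec m (k + 1))
    (h : u ∈ relations A 0 0) : ∃ a ∈ homVec m k, u = A.mulVec a := by
  obtain ⟨a, rfl⟩ := mem_relations_zero.1 h
  refine ⟨shiftVec m 1 (k + 1) a, shiftVec_mem _ _ _ _ (by omega) _, ?_⟩
  rw [← compVec_mulVec hA, compVec_of_mem hu, if_pos rfl]

include hA in
theorem eq_zero_of_mem_relations_zero {u : Fin m → Poly3} (hu : u ∈ homVec m 0)
    (h : u ∈ relations A 0 0) : u = 0 := by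
  obtain ⟨a, rfl⟩ := mem_relations_zero.1 h
  rw [← if_pos (c := (0 = 0)) rfl (t := A.mulVec a) (e := 0), ← compVec_of_mem hu,
    compVec_mulVec hA, shiftVec_eq_zero _ _ _ one_pos]
  simp

-- In degrees below n a coefficient of `p` would have negative degree, so E and E/pE agree there.
include hA hp in
theorem mem_relations_zero_of_lt {k : ℕ} (hk : k < n) {u : Fin m → Poly3} (hu : u ∈ homVec m k)
    (h : u ∈ relations A p 0) : u ∈ relations A 0 0 := by
  obtain ⟨a, b, rfl⟩ := mem_relations_single.1 h
  have h1 := compVec_of_mem (t := k) hu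
  rw [if_pos rfl, map_add, compVec_mulVec hA, compVec_smul hp, shiftVec_eq_zero _ _ _ hk] at h1
  rw [← h1]
  simpa using mulVec_mem_relations A 0 0 _

include hA hp in
theorem exists_of_mem_relations_single {k : ℕ} {u : Fin m → Poly3} (hu : u ∈ homVec m (n + k))
    (h : u ∈ relations A p 0) : ∃ b ∈ homVec m k, u - p • b ∈ relations A 0 0 := by
  obtain ⟨a, b, rfl⟩ := mem_relations_single.1 h
  have h1 := compVec_of_mem (t := n + k) hu
  rw [if_pos rfl, map_add, compVec_mulVec hA, compVec_smul hp] at h1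
  refine ⟨shiftVec m n (n + k) b, shiftVec_mem _ _ _ _ rfl _, ?_⟩
  rw [← h1, add_sub_cancel_right]
  exact mulVec_mem_relations A 0 0 _

include hA hp hq in
theorem exists_of_mem_relations {k : ℕ} {u : Fin m → Poly3} (hu : u ∈ homVec m (n + k))
    (h : u ∈ relations A p q) : ∃ c ∈ homVec m k, u - q • c ∈ relations A p 0 := by
  obtain ⟨a, b, c, rfl⟩ := mem_relations.1 h
  have h1 := compVec_of_mem (t := n + k) hu
  rw [if_pos rfl, compVec_relation hA hp hq] at h1
  refine ⟨shiftVec m n (n + k) c, shiftVec_mem _ _ _ _ rfl _, ?_⟩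
  rw [← h1, add_sub_cancel_right]
  exact mem_relations_single.2 ⟨_, _, rfl⟩

end graded

/-! ### Dimensions -/

/-- The vector of polynomials with given coefficients. -/
def blownPoly (m k : ℕ) : BlownSpace m k →ₗ[ℂ] (Fin m → Poly3) where
  toFun w s := ∑ i : Expo k, monomial i.1 (w (i, s))
  map_add' v w := by
    funext s
    simp [Finset.sum_add_distrib]
  map_smul' c w := by
    funext s
    simp [Finset.smul_sum, smul_monomial]

theorem Expo.degree_eq {k : ℕ} (i : Expo k) : i.1.degree = k := by
  have := i.2
  simp only [Finset.mem_finsuppAntidiag, Finset.subset_univ, and_true] at this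
  rw [Finsupp.degree_eq_sum, this]

/-- An exponent of total degree `k`. -/
def Expo.mk' {k : ℕ} (i : Fin 3 →₀ ℕ) (h : i.degree = k) : Expo k :=
  ⟨i, by simpa [Finsupp.degree_eq_sum] using h⟩

theorem coeff_blownPoly {m k : ℕ} (w : BlownSpace m k) (i : Expo k) (s : Fin m) :
    coeff i.1 (blownPoly m k w s) = w (i, s) := by
  simp only [blownPoly, LinearMap.coe_mk, AddHom.coe_mk, coeff_sum, coeff_monomial,
    Subtype.val_inj, Finset.sum_ite_eq', Finset.mem_univ, if_true]

theorem blownPoly_mem (m k : ℕ) (w : BlownSpace m k) : blownPoly m k w ∈ homVec m k :=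
  mem_homVec.2 fun _ => IsHomogeneous.sum _ _ _ fun i _ =>
    isHomogeneous_monomial _ i.degree_eq

theorem blownPoly_injective (m k : ℕ) : Function.Injective (blownPoly m k) := by
  intro v w h
  ext ⟨i, s⟩
  rw [← coeff_blownPoly, ← coeff_blownPoly, h]

theorem exists_blownPoly_eq {m k : ℕ} {u : Fin m → Poly3} (hu : u ∈ homVec m k) :
    ∃ w, blownPoly m k w = u := by
  refine ⟨WithLp.toLp 2 fun x => coeff x.1.1 (u x.2), funext fun s => ?_⟩
  ext d
  by_cases hd : d.degree = k
  · exact coeff_blownPoly _ (Expo.mk' d hd) s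
  · rw [(mem_homVec.1 (blownPoly_mem m k _) s).coeff_eq_zero hd,
      (mem_homVec.1 hu s).coeff_eq_zero hd]

/-- The blown space is the space of vectors of homogeneous polynomials. -/
def blownEquiv (m k : ℕ) : BlownSpace m k ≃ₗ[ℂ] homVec m k :=
  LinearEquiv.ofBijective ((blownPoly m k).codRestrict (homVec m k) (blownPoly_mem m k))
    ⟨fun _ _ h => blownPoly_injective m k (congrArg Subtype.val h),
      fun u => (exists_blownPoly_eq u.2).imp fun _ h => Subtype.ext h⟩

instance (m k : ℕ) : FiniteDimensional ℂ (homVec m k) :=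
  (blownEquiv m k).finiteDimensional

theorem finrank_homVec (m k : ℕ) :
    Module.finrank ℂ (homVec m k) = (k + 2).choose 2 * m := by
  rw [← (blownEquiv m k).finrank_eq, finrank_euclideanSpace, Fintype.card_prod, Fintype.card_fin,
    Fintype.card_coe, Finset.card_finsuppAntidiag_nat_eq_choose, Finset.card_univ,
    Fintype.card_fin, show 3 + k - 1 = k + 2 by omega, Nat.choose_symm_add]

/-- The graded piece of degree `k` of the projection onto the cokernel modulo `p` and `q`. -/
def gradedMap {m : ℕ} (A : Matrix (Fin m) (Fin m) Poly3) (p q : Poly3) (k : ℕ) :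
    homVec m k →ₗ[ℂ] (Fin m → Poly3) ⧸ relations A p q :=
  ((relations A p q).mkQ.restrictScalars ℂ) ∘ₗ (homVec m k).subtype

theorem gradedMap_eq_zero {m : ℕ} {A : Matrix (Fin m) (Fin m) Poly3} {p q : Poly3} {k : ℕ}
    (u : homVec m k) : gradedMap A p q k u = 0 ↔ (u : Fin m → Poly3) ∈ relations A p q := by
  simp [gradedMap]

/-- The dimension of the graded piece of degree `k` of the cokernel modulo `p` and `q`. -/
def gradedDim {m : ℕ} (A : Matrix (Fin m) (Fin m) Poly3) (p q : Poly3) (k : ℕ) : ℕ :=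
  Module.finrank ℂ (LinearMap.range (gradedMap A p q k))

/-- Multiplication by `f` from the vectors of degree `k` into the cokernel modulo `p` and `q`. -/
def gradedMul {m : ℕ} (A : Matrix (Fin m) (Fin m) Poly3) (p q f : Poly3) (k : ℕ) :
    homVec m k →ₗ[ℂ] (Fin m → Poly3) ⧸ relations A p q :=
  ((relations A p q).mkQ.restrictScalars ℂ) ∘ₗ
    ((LinearMap.lsmul Poly3 (Fin m → Poly3) f).restrictScalars ℂ) ∘ₗ (homVec m k).subtype

theorem gradedMul_eq_zero {m : ℕ} {A : Matrix (Fin m) (Fin m) Poly3} {p q f : Poly3} {k : ℕ}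
    (u : homVec m k) :
    gradedMul A p q f k u = 0 ↔ f • (u : Fin m → Poly3) ∈ relations A p q :=
  Submodule.Quotient.mk_eq_zero (relations A p q)

theorem range_gradedMul_le {m : ℕ} (A : Matrix (Fin m) (Fin m) Poly3) (p q : Poly3) {f : Poly3}
    {d : ℕ} (hf : f.IsHomogeneous d) (k : ℕ) :
    LinearMap.range (gradedMul A p q f k) ≤ LinearMap.range (gradedMap A p q (d + k)) := by
  rintro _ ⟨u, rfl⟩
  exact ⟨⟨f • (u : Fin m → Poly3), smul_mem_homVec hf u.2⟩, rfl⟩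

/-! ### Hilbert functions of the cokernel and of its quotients by `p` and by `p`, `q` -/

section graded

variable {m : ℕ} {A : Matrix (Fin m) (Fin m) Poly3} (hA : ∀ i j, (A i j).IsHomogeneous 1)
  (hprime : Prime A.det)
  {n : ℕ} {p q : Poly3} (hp : p.IsHomogeneous n) (hq : q.IsHomogeneous n)

include hprime in
theorem mem_relations_zero_of_smul {f : Poly3} (hf : ¬ A.det ∣ f) {u : Fin m → Poly3}
    (h : f • u ∈ relations A 0 0) : u ∈ relations A 0 0 := by
  obtain ⟨a, ha⟩ := mem_relations_zero.1 h
  exact mem_relations_zero.2 (A.exists_eq_mulVec_of_smul_eq_mulVec hprime.ne_zero f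
    (fun g hg => (hprime.dvd_or_dvd hg).resolve_left hf) u a ha)

include hprime in
theorem mulVec_injective_of_prime : Function.Injective A.mulVec :=
  Matrix.mulVec_injective_of_det_ne_zero hprime.ne_zero

-- The pencil is injective, so 0 → S(-1)^m → S^m → E → 0 is exact, and the dimension is m times the
-- difference of two consecutive binomial coefficients.
include hA hprime in
theorem gradedDim_zero (k : ℕ) : gradedDim A 0 0 k = m * (k + 1) := by
  have e := LinearMap.finrank_range_add_finrank_ker (gradedMap A 0 0 k)
  rw [finrank_homVec] at e
  change gradedDim A 0 0 k + _ = _ at e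
  cases k with
  | zero =>
    have : LinearMap.ker (gradedMap A 0 0 0) = ⊥ := by
      rw [LinearMap.ker_eq_bot']
      exact fun u hu => Subtype.ext (eq_zero_of_mem_relations_zero hA u.2
        ((gradedMap_eq_zero u).1 hu))
    rw [this, finrank_bot] at e
    simpa using e
  | succ k =>
    let f : homVec m k →ₗ[ℂ] homVec m (k + 1) :=
      ((A.mulVecLin.restrictScalars ℂ) ∘ₗ (homVec m k).subtype).codRestrict _ fun u => by
        rw [add_comm k 1]
        exact mulVec_mem_homVec hA u.2
    have hf : Function.Injective f := fun u v h =>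
      Subtype.ext (mulVec_injective_of_prime hprime (congrArg Subtype.val h))
    have h1 : LinearMap.ker (gradedMap A 0 0 (k + 1)) = LinearMap.range f := by
      ext u
      rw [LinearMap.mem_ker, gradedMap_eq_zero]
      constructor
      · intro h
        obtain ⟨a, ha, hu⟩ := mem_relations_zero_of_mem_homVec hA u.2 h
        exact ⟨⟨a, ha⟩, Subtype.ext hu.symm⟩
      · rintro ⟨a, rfl⟩
        exact mulVec_mem_relations A 0 0 _
    rw [h1, LinearMap.finrank_range_of_inj hf, finrank_homVec] at e
    have h2 : (k + 1 + 2).choose 2 = (k + 2).choose 2 + (k + 2) := by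
      rw [show k + 1 + 2 = (k + 2) + 1 by ring, Nat.choose_succ_succ' (k + 2) 1, Nat.choose_one_right]
      ring
    rw [h2] at e
    have : gradedDim A 0 0 (k + 1) + (k + 2).choose 2 * m =
      m * (k + 1 + 1) + (k + 2).choose 2 * m := by rw [e]; ring
    exact Nat.add_right_cancel this

-- In degree n - 1 nothing has been divided out yet, and E has dimension mn. From degree n on, `p`
-- is a nonzerodivisor on E and the dimension is the difference m(k + 1) - m(k + 1 - n).
include hA hprime hp in
theorem gradedDim_single (hpd : ¬ A.det ∣ p) {k : ℕ} (hk : n ≤ k + 1) :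
    gradedDim A p 0 k = m * n := by
  rcases Nat.lt_or_ge k n with h | h
  · have : gradedDim A p 0 k = gradedDim A 0 0 k := by
      refine LinearMap.finrank_range_eq_of_ker_eq _ _ ?_
      ext u
      rw [LinearMap.mem_ker, LinearMap.mem_ker, gradedMap_eq_zero, gradedMap_eq_zero]
      exact ⟨mem_relations_zero_of_lt hA hp h u.2, fun h => relations_zero_le A p 0 h⟩
    rw [this, gradedDim_zero hA hprime, show k + 1 = n by omega]
  · obtain ⟨j, rfl⟩ := Nat.exists_eq_add_of_le h
    have h1 := LinearMap.finrank_range_add_of_ker_eq_comap (gradedMap A 0 0 (n + j))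
      (gradedMap A p 0 (n + j)) (LinearMap.range (gradedMul A 0 0 p j))
      (range_gradedMul_le A 0 0 hp j) (by
        ext u
        rw [LinearMap.mem_ker, gradedMap_eq_zero, Submodule.mem_comap]
        constructor
        · intro h
          obtain ⟨b, hb, hub⟩ := exists_of_mem_relations_single hA hp u.2 h
          refine ⟨⟨b, hb⟩, ?_⟩
          symm
          exact (Submodule.Quotient.eq _).2 hub
        · rintro ⟨b, hb⟩
          have := (Submodule.Quotient.eq _).1 hb.symm
          have h2 := add_mem (relations_zero_le A p 0 this)
            (left_smul_mem_relations A p 0 (b : Fin m → Poly3))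
          simpa using h2)
    have h2 : Module.finrank ℂ (LinearMap.range (gradedMul A 0 0 p j)) = gradedDim A 0 0 j := by
      refine LinearMap.finrank_range_eq_of_ker_eq _ _ ?_
      ext u
      rw [LinearMap.mem_ker, LinearMap.mem_ker, gradedMap_eq_zero, gradedMul_eq_zero]
      exact ⟨mem_relations_zero_of_smul hprime hpd, fun h => Submodule.smul_mem _ _ h⟩
    change gradedDim A p 0 (n + j) + _ = gradedDim A 0 0 (n + j) at h1
    rw [h2, gradedDim_zero hA hprime, gradedDim_zero hA hprime] at h1
    nlinarith

variable {c : Fin 3 → ℂ}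
  (hreg : ∀ u, linForm c • u ∈ relations A p 0 → u ∈ relations A p 0)

-- Multiplication by the linear form on E/pE is injective between pieces of the same dimension mn,
-- hence surjective.
include hA hprime hp hreg in
theorem exists_linForm_smul_sub_mem_single (hpd : ¬ A.det ∣ p) {k : ℕ} (hk : n ≤ k + 1)
    {u : Fin m → Poly3} (hu : u ∈ homVec m (1 + k)) :
    ∃ v ∈ homVec m k, u - linForm c • v ∈ relations A p 0 := by
  have hle := range_gradedMul_le A p 0 (linForm_isHomogeneous c) k
  have hr : Module.finrank ℂ (LinearMap.range (gradedMul A p 0 (linForm c) k)) =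
      gradedDim A p 0 k := by
    refine LinearMap.finrank_range_eq_of_ker_eq _ _ ?_
    ext u
    rw [LinearMap.mem_ker, LinearMap.mem_ker, gradedMap_eq_zero, gradedMul_eq_zero]
    exact ⟨hreg u, fun h => Submodule.smul_mem _ _ h⟩
  have heq := Submodule.eq_of_le_of_finrank_eq hle (by
    rw [hr, gradedDim_single hA hprime hp hpd hk]
    exact (gradedDim_single hA hprime hp hpd (by omega)).symm)
  have hmem : gradedMap A p 0 (1 + k) ⟨u, hu⟩ ∈
      LinearMap.range (gradedMul A p 0 (linForm c) k) := by
    rw [heq]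
    exact ⟨_, rfl⟩
  obtain ⟨v, hv⟩ := hmem
  exact ⟨v, v.2, (Submodule.Quotient.eq _).1 hv.symm⟩

-- Write ℓu = qv modulo (A, p). The degree of v is large enough for v = ℓw modulo (A, p), and
-- cancelling ℓ in ℓ(u - qw) = 0 leaves u = qw. Divisibility of v by ℓ needs deg w ≥ n - 1, which is
-- where the bound 2n - 1 for the degree of u comes from.
include hA hprime hp hq hreg in
theorem mem_relations_of_linForm_smul_mem (hn : 1 ≤ n) (hpd : ¬ A.det ∣ p) {k : ℕ} (hk : n + n ≤ k + 1)
    {u : Fin m → Poly3} (hu : u ∈ homVec m k) (h : linForm c • u ∈ relations A p q) :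
    u ∈ relations A p q := by
  obtain ⟨j, rfl⟩ : ∃ j, k = n + j := ⟨k - n, by omega⟩
  have hu1 := smul_mem_homVec (linForm_isHomogeneous c) hu
  rw [show 1 + (n + j) = n + (1 + j) by ring] at hu1
  obtain ⟨v, hv, hv'⟩ := exists_of_mem_relations hA hp hq hu1 h
  obtain ⟨w, -, hw'⟩ := exists_linForm_smul_sub_mem_single hA hprime hp hreg hpd (by omega) hv
  have h1 : linForm c • (u - q • w) ∈ relations A p 0 := by
    have := add_mem hv' (Submodule.smul_mem _ q hw')
    convert this using 1
    module
  have h2 := add_mem (relations_single_le A p q (hreg _ h1))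
    (right_smul_mem_relations A p q w)
  simpa using h2

-- Multiplication by the linear form is bijective from each of these degrees to the next.
include hA hprime hp hq hreg in
theorem gradedDim_eq_of_le (hn : 1 ≤ n) (hpd : ¬ A.det ∣ p) {k₀ : ℕ} (hk₀ : n + n ≤ k₀ + 1) (k : ℕ)
    (hk : k₀ ≤ k) : gradedDim A p q k = gradedDim A p q k₀ := by
  induction k, hk using Nat.le_induction with
  | base => rfl
  | succ k hk ih =>
    rw [← ih]
    have h1 : LinearMap.range (gradedMul A p q (linForm c) k) =
        LinearMap.range (gradedMap A p q (1 + k)) := by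
      refine le_antisymm (range_gradedMul_le A p q (linForm_isHomogeneous c) k) ?_
      rintro _ ⟨u, rfl⟩
      obtain ⟨v, hv, hv'⟩ :=
        exists_linForm_smul_sub_mem_single hA hprime hp hreg hpd (by omega) u.2
      refine ⟨⟨v, hv⟩, ?_⟩
      symm
      exact (Submodule.Quotient.eq _).2 (relations_single_le A p q hv')
    rw [gradedDim, add_comm k 1, ← h1]
    refine LinearMap.finrank_range_eq_of_ker_eq _ _ ?_
    ext u
    rw [LinearMap.mem_ker, LinearMap.mem_ker, gradedMap_eq_zero, gradedMul_eq_zero]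
    exact ⟨mem_relations_of_linForm_smul_mem hA hprime hp hq hreg hn hpd (by omega) u.2,
      fun h => Submodule.smul_mem _ _ h⟩

/-- The dimension of the cokernel modulo `p` and `q` in degree `2n - 1` is the corank of the
multiplication by `q` from degree `n - 1` modulo `p`. -/
theorem gradedDim_add_finrank_gradedMul (hA : ∀ i j, (A i j).IsHomogeneous 1)
    (hprime : Prime A.det) (hp : p.IsHomogeneous n) (hq : q.IsHomogeneous n)
    (hpd : ¬ A.det ∣ p) {k : ℕ} (hk : n = k + 1) :
    gradedDim A p q (n + k) + Module.finrank ℂ (LinearMap.range (gradedMul A p 0 q k)) =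
      m * n := by
  rw [← gradedDim_single hA hprime hp hpd (k := n + k) (by omega)]
  refine LinearMap.finrank_range_add_of_ker_eq_comap _ _ _ (range_gradedMul_le A p 0 hq k) ?_
  ext u
  rw [LinearMap.mem_ker, gradedMap_eq_zero, Submodule.mem_comap]
  constructor
  · intro h
    obtain ⟨b, hb, hub⟩ := exists_of_mem_relations hA hp hq u.2 h
    refine ⟨⟨b, hb⟩, ?_⟩
    symm
    exact (Submodule.Quotient.eq _).2 hub
  · rintro ⟨b, hb⟩
    have := (Submodule.Quotient.eq _).1 hb.symm
    have h2 := add_mem (relations_single_le A p q this)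
      (right_smul_mem_relations A p q (b : Fin m → Poly3))
    simpa using h2

end graded

/-! ### Functionals on vectors of polynomials and the Bezout identity -/

/-- The polynomials in `y₀, y₁, y₂` with coefficients in `ℂ[x₀, x₁, x₂]`. -/
abbrev Poly33 : Type := MvPolynomial (Fin 3) Poly3

/-- The polynomial `f(y)`. -/
def inY : Poly3 →+* Poly33 := MvPolynomial.map (C : ℂ →+* Poly3)

/-- The coordinates of the cross product of `x` and `y`. -/
def crossXY : Fin 3 → Poly33
  | 0 => C (X 1) * X 2 - C (X 2) * X 1
  | 1 => C (X 2) * X 0 - C (X 0) * X 2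
  | 2 => C (X 0) * X 1 - C (X 1) * X 0

/-- `b` expresses `f(x) g(y) - g(x) f(y)` through the cross product of `x` and `y`. -/
def IsBezoutian (f g : Poly3) (b : Fin 3 → Poly33) : Prop :=
  C f * inY g - C g * inY f = ∑ l, b l * crossXY l

/-- The functional `u ↦ Φ (f u)`. -/
def actDual {m : ℕ} (f : Poly3) (Φ : Module.Dual ℂ (Fin m → Poly3)) :
    Module.Dual ℂ (Fin m → Poly3) :=
  Φ ∘ₗ (LinearMap.lsmul Poly3 (Fin m → Poly3) f).restrictScalars ℂ

@[simp] theorem actDual_apply {m : ℕ} (f : Poly3) (Φ : Module.Dual ℂ (Fin m → Poly3))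
    (u : Fin m → Poly3) : actDual f Φ u = Φ (f • u) := rfl

theorem actDual_mul {m : ℕ} (f g : Poly3) (Φ : Module.Dual ℂ (Fin m → Poly3)) :
    actDual (f * g) Φ = actDual f (actDual g Φ) := by
  refine LinearMap.ext fun u => ?_
  simp [smul_smul, mul_comm f g]

/-- The extension of a functional to vectors of polynomials in `y`, applied to `G(y) e_s`. -/
def extendDual {m : ℕ} (Φ : Module.Dual ℂ (Fin m → Poly3)) :
    Poly33 →ₗ[Poly3] (Fin m → Poly3) :=
  (basisMonomials (Fin 3) Poly3).constr Poly3
    fun α s => C (Φ (Pi.single s (monomial α 1)))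

theorem extendDual_monomial {m : ℕ} (Φ : Module.Dual ℂ (Fin m → Poly3)) (α : Fin 3 →₀ ℕ)
    (s : Fin m) : extendDual Φ (monomial α 1) s = C (Φ (Pi.single s (monomial α 1))) := by
  have h := (basisMonomials (Fin 3) Poly3).constr_basis Poly3
    (fun α s => (C (Φ (Pi.single s (monomial α 1))) : Poly3)) α
  rw [coe_basisMonomials] at h
  exact congrFun h s

/-- The variables y are the ones on which the functional acts, while polynomials in x are mere
scalars. A factor f(y) can therefore be moved onto the functional. -/
theorem extendDual_inY_mul {m : ℕ} (Φ : Module.Dual ℂ (Fin m → Poly3)) (f : Poly3) (G : Poly33) :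
    extendDual Φ (inY f * G) = extendDual (actDual f Φ) G := by
  suffices h : extendDual Φ ∘ₗ LinearMap.mulLeft Poly3 (inY f) = extendDual (actDual f Φ) from
    LinearMap.congr_fun h G
  refine (basisMonomials (Fin 3) Poly3).ext fun α => ?_
  simp only [coe_basisMonomials, LinearMap.comp_apply, LinearMap.mulLeft_apply]
  funext s
  rw [extendDual_monomial, actDual_apply]
  induction f using MvPolynomial.induction_on' with
  | monomial β r =>
    have h1 : inY (monomial β r) * monomial α 1 =
        (C r : Poly3) • (monomial (β + α) 1 : Poly33) := by
      rw [inY, map_monomial, monomial_mul, smul_monomial, smul_eq_mul, mul_one]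
    have h2 : (monomial β r : Poly3) • (Pi.single s (monomial α 1) : Fin m → Poly3) =
        r • Pi.single s (monomial (β + α) 1) := by
      rw [← Pi.single_smul, ← Pi.single_smul, smul_eq_mul, monomial_mul, smul_monomial,
        smul_eq_mul]
    rw [h1, map_smul, Pi.smul_apply, extendDual_monomial, h2, map_smul, smul_eq_mul, smul_eq_mul,
      C_mul]
  | add p q hp hq =>
    rw [map_add, add_mul, map_add, Pi.add_apply, hp, hq, add_smul, map_add, C_add]

variable {m : ℕ} (D : Fin 3 → Matrix (Fin m) (Fin m) ℂ)

/-- The functionals that vanish on the range of the transposed pencil. -/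
def IsDualVector (Φ : Module.Dual ℂ (Fin m → Poly3)) : Prop :=
  ∀ u, Φ ((pencil D).transpose.mulVec u) = 0

theorem IsDualVector.actDual {D : Fin 3 → Matrix (Fin m) (Fin m) ℂ}
    {Φ : Module.Dual ℂ (Fin m → Poly3)} (h : IsDualVector D Φ)
    (f : Poly3) : IsDualVector D (actDual f Φ) := by
  intro u
  rw [actDual_apply, ← Matrix.mulVec_smul, h]

theorem pencil_apply (i j : Fin m) : pencil D i j = ∑ l, X l * C (D l i j) := by
  simp [pencil, Matrix.sum_apply]

theorem pencil_isHomogeneous (i j : Fin m) : (pencil D i j).IsHomogeneous 1 := by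
  rw [pencil_apply]
  refine IsHomogeneous.sum _ _ _ fun l _ => ?_
  simpa using (isHomogeneous_X ℂ l).mul (isHomogeneous_C (Fin 3) (D l i j))

theorem pencil_mulVec (u : Fin m → Poly3) :
    (pencil D).mulVec u = ∑ l, (X l : Poly3) • ((D l).map C).mulVec u := by
  simp [pencil, Matrix.sum_mulVec, Matrix.smul_mulVec]

theorem pencil_transpose : (pencil D).transpose = pencil fun l => (D l).transpose := by
  ext1 i j
  rw [Matrix.transpose_apply, pencil_apply, pencil_apply]
  rfl

/-- `D_l` applied to the extension of `Φ`. -/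
def slot (Φ : Module.Dual ℂ (Fin m → Poly3)) (l : Fin 3) : Poly33 →ₗ[Poly3] (Fin m → Poly3) :=
  ((D l).map C).mulVecLin ∘ₗ extendDual Φ

theorem slot_apply (Φ : Module.Dual ℂ (Fin m → Poly3)) (l : Fin 3) (G : Poly33) :
    slot D Φ l G = ((D l).map C).mulVec (extendDual Φ G) := rfl

theorem slot_C_mul (Φ : Module.Dual ℂ (Fin m → Poly3)) (l : Fin 3) (f : Poly3) (G : Poly33) :
    slot D Φ l (C f * G) = f • slot D Φ l G := by
  rw [← smul_eq_C_mul, map_smul]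

theorem slot_inY_mul (Φ : Module.Dual ℂ (Fin m → Poly3)) (l : Fin 3) (f : Poly3) (G : Poly33) :
    slot D Φ l (inY f * G) = slot D (actDual f Φ) l G := by
  rw [slot_apply, extendDual_inY_mul, slot_apply]

/-- This is the condition D·y = 0 on dual vectors, monomial by monomial. The transposed pencil in
the definition of dual vectors is what makes D_l itself act on the values. -/
theorem sum_slot_X {Φ : Module.Dual ℂ (Fin m → Poly3)} (hΦ : IsDualVector D Φ) (G : Poly33) :
    ∑ l, slot D Φ l (X l * G) = 0 := by
  suffices h : ∑ l, slot D Φ l ∘ₗ LinearMap.mulLeft Poly3 (X l) = 0 by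
    simpa using LinearMap.congr_fun h G
  refine (basisMonomials (Fin 3) Poly3).ext fun α => ?_
  funext r
  have hX : ∀ l, (X l : Poly33) * monomial α 1 = monomial (Finsupp.single l 1 + α) 1 := by
    intro l
    rw [X, monomial_mul, one_mul]
  have h1 := hΦ (Pi.single r (monomial α 1))
  have h2 : (pencil D).transpose.mulVec (Pi.single r (monomial α 1)) =
      ∑ l, ∑ s, D l r s • (Pi.single s (monomial (Finsupp.single l 1 + α) 1) :
        Fin m → Poly3) := by
    funext s
    rw [Matrix.mulVec_single, Finset.sum_apply]
    simp only [Pi.smul_apply, Matrix.col_apply, Matrix.transpose_apply, pencil_apply,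
      Finset.sum_apply, op_smul_eq_smul, smul_eq_mul]
    rw [Finset.mul_sum]
    refine Finset.sum_congr rfl fun l _ => ?_
    rw [Finset.sum_eq_single s (fun b _ hb => by rw [Pi.single_eq_of_ne hb.symm, smul_zero])
      (by simp), Pi.single_eq_same, X, mul_comm (monomial _ _) (C _), mul_comm, mul_assoc,
      monomial_mul, one_mul, smul_eq_C_mul]
  rw [h2] at h1
  simp only [map_sum, map_smul, smul_eq_mul] at h1
  simp only [coe_basisMonomials, LinearMap.coe_sum, Finset.sum_apply, LinearMap.comp_apply,
    LinearMap.mulLeft_apply, hX, slot_apply, LinearMap.zero_apply, Pi.zero_apply, Matrix.mulVec,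
    dotProduct, Matrix.map_apply, extendDual_monomial]
  rw [← C_0, ← h1]
  simp only [map_sum, map_mul]

theorem sum_smul_slot_mem (Φ : Module.Dual ℂ (Fin m → Poly3)) (G : Poly33) :
    ∑ l, (X l : Poly3) • slot D Φ l G ∈ relations (pencil D) 0 0 := by
  simp only [slot_apply]
  rw [← pencil_mulVec]
  exact mulVec_mem_relations _ 0 0 _

/-- The differences D_i c_j - D_j c_i for c = x × y are, up to sign, the coordinates of D × (x × y)
= x (D·y) - y (D·x). The first term vanishes because Φ is a dual vector, the second lies in the
image of the pencil. -/
theorem slot_crossXY_sub_mem {Φ : Module.Dual ℂ (Fin m → Poly3)} (hΦ : IsDualVector D Φ)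
    (i j : Fin 3) (G : Poly33) :
    slot D Φ i (crossXY j * G) - slot D Φ j (crossXY i * G) ∈ relations (pencil D) 0 0 := by
  have hy : ∀ a : Fin 3, (X a : Poly3) • slot D Φ 0 (X 0 * G) + (X a : Poly3) • slot D Φ 1 (X 1 * G)
      + (X a : Poly3) • slot D Φ 2 (X 2 * G) = 0 := by
    intro a
    rw [← smul_add, ← smul_add, ← Fin.sum_univ_three (fun l => slot D Φ l (X l * G)),
      sum_slot_X D hΦ, smul_zero]
  have hx : ∀ a : Fin 3, (X 0 : Poly3) • slot D Φ 0 (X a * G) +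
      (X 1 : Poly3) • slot D Φ 1 (X a * G) + (X 2 : Poly3) • slot D Φ 2 (X a * G) ∈
        relations (pencil D) 0 0 := by
    intro a
    rw [← Fin.sum_univ_three (fun l => (X l : Poly3) • slot D Φ l (X a * G))]
    exact sum_smul_slot_mem D Φ (X a * G)
  have hc : ∀ (l : Fin 3) (a b : Fin 3), slot D Φ l ((C (X a) * X b) * G) =
      (X a : Poly3) • slot D Φ l (X b * G) := by
    intro l a b
    rw [mul_assoc, slot_C_mul]
  wlog hij : i ≤ j generalizing i j
  · rw [← neg_mem_iff, neg_sub]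
    exact this j i (le_of_not_ge hij)
  -- Each of the three remaining cases is one coordinate of the triple product formula, a difference
  -- of an `hx` and an `hy`.
  fin_cases i <;> fin_cases j <;> first
    | (exact absurd hij (by decide))
    | (simp only [sub_self]; exact zero_mem _)
    | (simp only [Fin.zero_eta, Fin.mk_one, Fin.reduceFinMk, crossXY, sub_mul, map_sub, hc])
  · have h := sub_mem (hx 2) (by rw [hy 2]; exact zero_mem _ : (X 2 : Poly3) • slot D Φ 0 (X 0 * G)
      + (X 2 : Poly3) • slot D Φ 1 (X 1 * G) + (X 2 : Poly3) • slot D Φ 2 (X 2 * G) ∈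
        relations (pencil D) 0 0)
    rw [← neg_mem_iff]
    convert h using 1
    module
  · have h := sub_mem (hx 1) (by rw [hy 1]; exact zero_mem _ : (X 1 : Poly3) • slot D Φ 0 (X 0 * G)
      + (X 1 : Poly3) • slot D Φ 1 (X 1 * G) + (X 1 : Poly3) • slot D Φ 2 (X 2 * G) ∈
        relations (pencil D) 0 0)
    convert h using 1
    module
  · have h := sub_mem (hx 0) (by rw [hy 0]; exact zero_mem _ : (X 0 : Poly3) • slot D Φ 0 (X 0 * G)
      + (X 0 : Poly3) • slot D Φ 1 (X 1 * G) + (X 0 : Poly3) • slot D Φ 2 (X 2 * G) ∈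
        relations (pencil D) 0 0)
    rw [← neg_mem_iff]
    convert h using 1
    module

/-- The vector of polynomials obtained by applying the Bezoutian `b` to the functional `Φ`. -/
def bezoutApply (b : Fin 3 → Poly33) (Φ : Module.Dual ℂ (Fin m → Poly3)) : Fin m → Poly3 :=
  ∑ l, slot D Φ l (b l)

/-- Both brackets are sums over l and i of products of the coefficients b_l and b'_i with one
coordinate of the cross product. The first has D_l with coordinate i, the second D_i with coordinate
l, so the difference is a combination of the antisymmetric terms of `slot_crossXY_sub_mem`. -/
theorem bezoutApply_exchange {f g p q : Poly3} {b b' : Fin 3 → Poly33} (hb : IsBezoutian p q b)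
    (hb' : IsBezoutian f g b') {Φ : Module.Dual ℂ (Fin m → Poly3)} (hΦ : IsDualVector D Φ) :
    (f • bezoutApply D b (actDual g Φ) - g • bezoutApply D b (actDual f Φ)) -
      (p • bezoutApply D b' (actDual q Φ) - q • bezoutApply D b' (actDual p Φ)) ∈
        relations (pencil D) 0 0 := by
  have key : ∀ (c : Fin 3 → Poly33) (r s : Poly3),
      r • bezoutApply D c (actDual s Φ) - s • bezoutApply D c (actDual r Φ) =
        ∑ l, slot D Φ l ((C r * inY s - C s * inY r) * c l) := by
    intro c r s
    simp only [bezoutApply, Finset.smul_sum, ← Finset.sum_sub_distrib]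
    refine Finset.sum_congr rfl fun l _ => ?_
    rw [sub_mul, map_sub, mul_assoc, mul_assoc, slot_C_mul, slot_C_mul, slot_inY_mul, slot_inY_mul]
  rw [key, key, hb', hb]
  have h1 : ∀ l, slot D Φ l ((∑ i, b' i * crossXY i) * b l) =
      ∑ i, slot D Φ l (crossXY i * (b' i * b l)) := by
    intro l
    rw [Finset.sum_mul, map_sum]
    exact Finset.sum_congr rfl fun i _ => by congr 1; ring
  have h2 : ∀ i, slot D Φ i ((∑ l, b l * crossXY l) * b' i) =
      ∑ l, slot D Φ i (crossXY l * (b' i * b l)) := by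
    intro l
    rw [Finset.sum_mul, map_sum]
    exact Finset.sum_congr rfl fun i _ => by congr 1; ring
  simp only [h1, h2]
  rw [Finset.sum_comm, ← Finset.sum_sub_distrib]
  refine sum_mem fun i _ => ?_
  rw [← Finset.sum_sub_distrib]
  exact sum_mem fun l _ => slot_crossXY_sub_mem D hΦ l i _

/-! ### Bezout coefficients -/

theorem Poly33.ext_eval {F G : Poly33}
    (h : ∀ x y : Fin 3 → ℂ, eval y (map (eval x) F) = eval y (map (eval x) G)) : F = G := by
  ext1 α
  refine MvPolynomial.funext fun x => ?_
  have := MvPolynomial.funext fun y => h x y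
  simpa [coeff_map] using congrArg (coeff α) this

theorem Expo.monomial_eq {k : ℕ} (i : Expo k) (x : Fin 3 → ℂ) :
    i.monomial x = i.1.prod fun l e => x l ^ e := by
  rw [Expo.monomial, Finsupp.prod_fintype _ _ fun _ => pow_zero _]

theorem eval_eval_inY (f : Poly3) (x y : Fin 3 → ℂ) :
    eval y (map (eval x) (inY f)) = eval y f := by
  rw [inY, map_map, show (eval x : Poly3 →+* ℂ).comp C = RingHom.id ℂ from
    RingHom.ext fun r => by simp, map_id]

theorem eval_eval_C (f : Poly3) (x y : Fin 3 → ℂ) :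
    eval y (map (eval x) (C f : Poly33)) = eval x f := by
  simp

/-- The Bezout coefficients, ordered as the coordinates of the cross product. -/
def BezoutCoeffs.coeffs {k : ℕ} {p q : Poly3} (b : BezoutCoeffs k p q) :
    Fin 3 → Matrix (Expo k) (Expo k) ℂ
  | 0 => b.b12
  | 1 => b.b20
  | 2 => -b.b10

/-- The polynomials in `x` and `y` with the given Bezout coefficients. -/
def BezoutCoeffs.toPoly {k : ℕ} {p q : Poly3} (b : BezoutCoeffs k p q) (l : Fin 3) : Poly33 :=
  ∑ i : Expo k, ∑ j : Expo k, MvPolynomial.monomial j.1 (MvPolynomial.monomial i.1 (b.coeffs l i j))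

theorem BezoutCoeffs.eval_toPoly {k : ℕ} {p q : Poly3} (b : BezoutCoeffs k p q) (l : Fin 3)
    (x y : Fin 3 → ℂ) : eval y (map (eval x) (b.toPoly l)) =
      ∑ i : Expo k, ∑ j : Expo k, b.coeffs l i j * i.monomial x * j.monomial y := by
  simp only [BezoutCoeffs.toPoly, map_sum, map_monomial, eval_monomial, Expo.monomial_eq]

theorem BezoutCoeffs.isBezoutian {k : ℕ} {p q : Poly3} (b : BezoutCoeffs k p q) :
    IsBezoutian p q b.toPoly := by
  refine Poly33.ext_eval fun x y => ?_
  simp only [map_sub, map_mul, Fin.sum_univ_three, map_add, eval_eval_inY, eval_eval_C,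
    b.eval_toPoly]
  rw [b.identity x y]
  simp only [crossXY, map_sub, map_mul, map_C, map_X, eval_C, eval_X, Finset.sum_mul,
    ← Finset.sum_add_distrib]
  refine Finset.sum_congr rfl fun i _ => Finset.sum_congr rfl fun j _ => ?_
  simp only [BezoutCoeffs.coeffs, Matrix.neg_apply]
  ring

theorem BezoutCoeffs.matrix_apply {m k : ℕ} {p q : Poly3} (b : BezoutCoeffs k p q)
    (D : Fin 3 → Matrix (Fin m) (Fin m) ℂ) (x y : Expo k × Fin m) :
    b.matrix D x y = ∑ l, b.coeffs l x.1 y.1 * D l x.2 y.2 := by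
  simp only [BezoutCoeffs.matrix, Matrix.sub_apply, Matrix.add_apply, Matrix.kroneckerMap_apply,
    Fin.sum_univ_three, BezoutCoeffs.coeffs, Matrix.neg_apply]
  ring

/-- The restriction of a functional to the vectors of polynomials of degree `k`. -/
def restrictDual {m : ℕ} (k : ℕ) :
    Module.Dual ℂ (Fin m → Poly3) →ₗ[ℂ] BlownSpace m k where
  toFun Φ := WithLp.toLp 2 fun x => Φ (Pi.single x.2 (MvPolynomial.monomial x.1.1 1))
  map_add' _ _ := rfl
  map_smul' _ _ := rfl

theorem restrictDual_apply {m k : ℕ} (Φ : Module.Dual ℂ (Fin m → Poly3)) (x : Expo k × Fin m) :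
    restrictDual k Φ x = Φ (Pi.single x.2 (MvPolynomial.monomial x.1.1 1)) := rfl

/-- This translates between the matrix B acting on families of vectors and the Bezoutian acting on
functionals. -/
theorem BezoutCoeffs.bezoutApply_toPoly {m k : ℕ} {p q : Poly3} (b : BezoutCoeffs k p q)
    (D : Fin 3 → Matrix (Fin m) (Fin m) ℂ) (Φ : Module.Dual ℂ (Fin m → Poly3)) :
    bezoutApply D b.toPoly Φ =
      blownPoly m k (Matrix.toEuclideanLin (b.matrix D) (restrictDual k Φ)) := by
  have hmon : ∀ (i j : Expo k) (r : ℂ), (MvPolynomial.monomial j.1 (MvPolynomial.monomial i.1 r) :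
      Poly33) = (MvPolynomial.monomial i.1 r : Poly3) • MvPolynomial.monomial j.1 1 := by
    intro i j r
    rw [smul_monomial, smul_eq_mul, mul_one]
  funext r
  simp only [bezoutApply, slot_apply, BezoutCoeffs.toPoly, hmon, Finset.sum_apply, Matrix.mulVec,
    dotProduct, Matrix.map_apply, map_sum, map_smul, Pi.smul_apply, extendDual_monomial,
    smul_eq_mul]
  simp only [blownPoly, LinearMap.coe_mk, AddHom.coe_mk]
  have hB : ∀ i : Expo k, Matrix.toEuclideanLin (b.matrix D) (restrictDual k Φ) (i, r) =
      ∑ j : Expo k, ∑ s, ∑ l, b.coeffs l i j * D l r s *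
        Φ (Pi.single s (MvPolynomial.monomial j.1 1)) := by
    intro i
    simp only [Matrix.toLpLin_apply, Matrix.mulVec, dotProduct]
    rw [Fintype.sum_prod_type]
    simp only [b.matrix_apply, Finset.sum_mul]
    rfl
  simp only [hB, map_sum, Finset.mul_sum]
  have hterm : ∀ (i j : Expo k) (s : Fin m) (l : Fin 3),
      (MvPolynomial.monomial i.1 (b.coeffs l i j) : Poly3) *
        (C (D l r s) * C (Φ (Pi.single s (MvPolynomial.monomial j.1 1)))) =
      MvPolynomial.monomial i.1 (b.coeffs l i j * D l r s *
        Φ (Pi.single s (MvPolynomial.monomial j.1 1))) := by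
    intro i j s l
    rw [← C_mul, mul_comm (MvPolynomial.monomial _ _) (C _), C_mul_monomial]
    congr 1
    ring
  simp only [hterm]
  rw [Finset.sum_comm]
  refine Finset.sum_congr rfl fun i _ => ?_
  rw [Finset.sum_comm]
  exact Finset.sum_congr rfl fun j _ => Finset.sum_comm

/-! ### The principal subspace as a space of functionals -/

section dual

variable {m : ℕ} (D : Fin 3 → Matrix (Fin m) (Fin m) ℂ)

theorem pencil_mulVec_single (α : Fin 3 →₀ ℕ) (r : Fin m) :
    (pencil D).mulVec (Pi.single r (monomial α 1)) =
      ∑ l, ∑ s, D l s r • (Pi.single s (monomial (α + Finsupp.single l 1) 1) :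
        Fin m → Poly3) := by
  funext s
  rw [Matrix.mulVec_single, Finset.sum_apply]
  simp only [Pi.smul_apply, Matrix.col_apply, pencil_apply,
    Finset.sum_apply, op_smul_eq_smul, smul_eq_mul]
  rw [Finset.mul_sum]
  refine Finset.sum_congr rfl fun l _ => ?_
  rw [Finset.sum_eq_single s (fun b _ hb => by rw [Pi.single_eq_of_ne hb.symm, smul_zero])
    (by simp), Pi.single_eq_same, X, mul_comm (monomial _ _) (C _), mul_comm, mul_assoc,
    monomial_mul, one_mul, add_comm α, smul_eq_C_mul]

theorem LinearMap.ext_single_monomial {M : Type*} [AddCommGroup M] [Module ℂ M]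
    {f g : (Fin m → Poly3) →ₗ[ℂ] M}
    (h : ∀ s α, f (Pi.single s (monomial α 1)) = g (Pi.single s (monomial α 1))) : f = g := by
  refine LinearMap.pi_ext fun s u => ?_
  have : f ∘ₗ LinearMap.single ℂ (fun _ => Poly3) s = g ∘ₗ LinearMap.single ℂ (fun _ => Poly3) s :=
    (basisMonomials (Fin 3) ℂ).ext fun α => by simpa using h s α
  exact LinearMap.congr_fun this u

theorem isDualVector_iff (Φ : Module.Dual ℂ (Fin m → Poly3)) :
    IsDualVector D Φ ↔ ∀ (r : Fin m) (α : Fin 3 →₀ ℕ),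
      ∑ l, ∑ s, D l r s * Φ (Pi.single s (monomial (α + Finsupp.single l 1) 1)) = 0 := by
  have key : ∀ r α, Φ ((pencil D).transpose.mulVec (Pi.single r (monomial α 1))) =
      ∑ l, ∑ s, D l r s * Φ (Pi.single s (monomial (α + Finsupp.single l 1) 1)) := by
    intro r α
    rw [pencil_transpose, pencil_mulVec_single]
    simp only [map_sum, map_smul, smul_eq_mul, Matrix.transpose_apply]
  constructor
  · intro h r α
    rw [← key, h]
  · intro h u
    have : Φ ∘ₗ (pencil D).transpose.mulVecLin.restrictScalars ℂ = 0 :=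
      LinearMap.ext_single_monomial fun s α => by
        change Φ ((pencil D).transpose.mulVec _) = 0
        rw [key, h]
    exact LinearMap.congr_fun this u

theorem restrictDual_mem {Φ : Module.Dual ℂ (Fin m → Poly3)} (h : IsDualVector D Φ) (k : ℕ) :
    restrictDual k Φ ∈ principalSubspace D k := by
  cases k with
  | zero => trivial
  | succ k =>
    intro j
    funext r
    have := (isDualVector_iff D Φ).1 h r j.1
    simp only [Finset.sum_apply, Matrix.mulVec, dotProduct, Pi.zero_apply]
    exact this

/-- The functional on vectors of polynomials that is defined by a family of vectors. -/
def blownDual {m k : ℕ} (w : BlownSpace m k) : Module.Dual ℂ (Fin m → Poly3) where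
  toFun u := ∑ x : Expo k × Fin m, coeff x.1.1 (u x.2) * w x
  map_add' u v := by simp [add_mul, Finset.sum_add_distrib]
  map_smul' c u := by simp [Finset.mul_sum, mul_assoc]

theorem blownDual_single {m k : ℕ} (w : BlownSpace m k) (s : Fin m) (α : Fin 3 →₀ ℕ) :
    blownDual w (Pi.single s (monomial α 1)) =
      if h : α.degree = k then w (Expo.mk' α h, s) else 0 := by
  change ∑ x : Expo k × Fin m, coeff x.1.1 ((Pi.single s (monomial α 1) : Fin m → Poly3) x.2) * w x
    = _
  split_ifs with h
  · rw [Finset.sum_eq_single (Expo.mk' α h, s)]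
    · simp [Expo.mk']
    · rintro ⟨i, t⟩ - hne
      by_cases ht : t = s
      · subst ht
        rw [Pi.single_eq_same, coeff_monomial, if_neg, zero_mul]
        rintro rfl
        exact hne rfl
      · simp [Pi.single_eq_of_ne ht]
    · simp
  · refine Finset.sum_eq_zero ?_
    rintro ⟨i, t⟩ -
    by_cases ht : t = s
    · subst ht
      rw [Pi.single_eq_same, coeff_monomial, if_neg, zero_mul]
      rintro rfl
      exact h i.degree_eq
    · simp [Pi.single_eq_of_ne ht]

theorem restrictDual_blownDual {m k : ℕ} (w : BlownSpace m k) :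
    restrictDual k (blownDual w) = w := by
  ext ⟨i, s⟩
  rw [restrictDual_apply, blownDual_single, dif_pos i.degree_eq]
  rfl

theorem blownDual_isDualVector {k : ℕ} {w : BlownSpace m k} (hw : w ∈ principalSubspace D k) :
    IsDualVector D (blownDual w) := by
  rw [isDualVector_iff]
  intro r α
  have hdeg : ∀ l : Fin 3, (α + Finsupp.single l 1).degree = α.degree + 1 := fun l => by
    rw [map_add, Finsupp.degree_single]
  by_cases h : α.degree + 1 = k
  · subst h
    have := congrFun (hw (Expo.mk' α rfl)) r
    simp only [Finset.sum_apply, Matrix.mulVec, dotProduct, Pi.zero_apply] at this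
    rw [← this]
    refine Finset.sum_congr rfl fun l _ => Finset.sum_congr rfl fun s _ => ?_
    rw [blownDual_single, dif_pos (hdeg l)]
    rfl
  · refine Finset.sum_eq_zero fun l _ => Finset.sum_eq_zero fun s _ => ?_
    rw [blownDual_single, dif_neg (by rw [hdeg]; exact h), mul_zero]

end dual

/-! ### Existence of Bezout coefficients -/

/-- The coordinates of the cross product of two points. -/
def crossCoord (x y : Fin 3 → ℂ) : Fin 3 → ℂ
  | 0 => x 1 * y 2 - x 2 * y 1
  | 1 => x 2 * y 0 - x 0 * y 2
  | 2 => x 0 * y 1 - x 1 * y 0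

theorem crossCoord_swap (x y : Fin 3 → ℂ) (l : Fin 3) : crossCoord y x l = -crossCoord x y l := by
  fin_cases l <;> simp only [crossCoord] <;> ring

theorem Expo.succ_monomial {k : ℕ} (i : Expo k) (l : Fin 3) (x : Fin 3 → ℂ) :
    (i.succ l).monomial x = x l * i.monomial x := by
  simp only [Expo.monomial_eq, Expo.succ]
  rw [Finsupp.prod_add_index' (fun _ => pow_zero _) (fun _ _ _ => pow_add _ _ _),
    Finsupp.prod_single_index (h := fun l e => x l ^ e) (pow_zero _), pow_one, mul_comm]

theorem Expo.exists_eq_succ {k : ℕ} (i : Expo (k + 1)) : ∃ (j : Expo k) (l : Fin 3), i = j.succ l := by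
  obtain ⟨l, hl⟩ : ∃ l, i.1 l ≠ 0 := by
    by_contra! h
    have h0 : i.1 = 0 := Finsupp.ext h
    have := i.degree_eq
    rw [h0, map_zero] at this
    omega
  have hadd : i.1 - Finsupp.single l 1 + Finsupp.single l 1 = i.1 :=
    tsub_add_cancel_of_le (Finsupp.single_le_iff.2 (Nat.one_le_iff_ne_zero.2 hl))
  refine ⟨Expo.mk' (i.1 - Finsupp.single l 1) ?_, l, Subtype.ext hadd.symm⟩
  have := congrArg Finsupp.degree hadd
  rw [map_add, Finsupp.degree_single, i.degree_eq] at this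
  omega

/-- The span of the products of the cross product coordinates with two monomials of degree `k`. -/
def bezoutSpan (k : ℕ) : Submodule ℂ ((Fin 3 → ℂ) → (Fin 3 → ℂ) → ℂ) :=
  Submodule.span ℂ (Set.range fun (t : Fin 3 × Expo k × Expo k) x y =>
    t.2.1.monomial x * crossCoord x y t.1 * t.2.2.monomial y)

theorem mul_mem_bezoutSpan {k : ℕ} {G : (Fin 3 → ℂ) → (Fin 3 → ℂ) → ℂ} (hG : G ∈ bezoutSpan k)
    (a b : Fin 3) : (fun x y => x a * y b * G x y) ∈ bezoutSpan (k + 1) := by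
  induction hG using Submodule.span_induction with
  | mem _ h =>
    obtain ⟨⟨l, i, j⟩, rfl⟩ := h
    refine Submodule.subset_span ⟨(l, i.succ a, j.succ b), ?_⟩
    funext x y
    simp only [Expo.succ_monomial]
    ring
  | zero =>
    convert zero_mem (bezoutSpan (k + 1)) using 1
    funext x y
    exact mul_zero _
  | add G H _ _ h1 h2 =>
    convert add_mem h1 h2 using 1
    funext x y
    exact mul_add _ _ _
  | smul c G _ h =>
    convert (bezoutSpan (k + 1)).smul_mem c h using 1
    funext x y
    simp only [Pi.smul_apply, smul_eq_mul]
    ring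

theorem cross_mul_mem_bezoutSpan {k : ℕ} (i j : Expo k) (a b : Fin 3) :
    (fun x y : Fin 3 → ℂ => (x a * y b - x b * y a) * (i.monomial x * j.monomial y)) ∈
      bezoutSpan k := by
  have h : ∀ l : Fin 3, (fun x y : Fin 3 → ℂ => crossCoord x y l *
      (i.monomial x * j.monomial y)) ∈ bezoutSpan k := fun l =>
    Submodule.subset_span ⟨(l, i, j), by funext x y; ring⟩
  wlog hab : a ≤ b generalizing a b
  · have := neg_mem (this b a (le_of_not_ge hab))
    convert this using 1
    funext x y
    simp only [Pi.neg_apply]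
    ring
  fin_cases a <;> fin_cases b <;> first
    | exact absurd hab (by decide)
    | (simp only [sub_self, zero_mul]; exact zero_mem _)
    | skip
  · exact h 2
  · convert neg_mem (h 1) using 1
    funext x y
    simp only [Pi.neg_apply, crossCoord, Fin.zero_eta, Fin.reduceFinMk]
    ring
  · exact h 0

/-- The induction uses x_a x^i y_b y^j - x_b x^j y_a y^i = (x_a y_b - x_b y_a) x^i y^j + x_b y_a
(x^i y^j - x^j y^i). -/
theorem monomial_sub_mem_bezoutSpan {k : ℕ} (i j : Expo (k + 1)) :
    (fun x y : Fin 3 → ℂ => i.monomial x * j.monomial y - j.monomial x * i.monomial y) ∈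
      bezoutSpan k := by
  induction k with
  | zero =>
    obtain ⟨i, a, rfl⟩ := i.exists_eq_succ
    obtain ⟨j, b, rfl⟩ := j.exists_eq_succ
    have h0 : ∀ (i : Expo 0) (x : Fin 3 → ℂ), i.monomial x = 1 := by
      intro i x
      have : i.1 = 0 := (Finsupp.degree_eq_zero_iff _).1 i.degree_eq
      rw [Expo.monomial_eq, this, Finsupp.prod_zero_index]
    convert cross_mul_mem_bezoutSpan i j a b using 1
    funext x y
    simp only [Expo.succ_monomial, h0]
    ring
  | succ k ih =>
    obtain ⟨i, a, rfl⟩ := i.exists_eq_succ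
    obtain ⟨j, b, rfl⟩ := j.exists_eq_succ
    convert add_mem (cross_mul_mem_bezoutSpan i j a b) (mul_mem_bezoutSpan (ih i j) b a) using 1
    funext x y
    simp only [Expo.succ_monomial, Pi.add_apply]
    ring

theorem eval_eq_sum_expo {n : ℕ} {p : Poly3} (hp : p.IsHomogeneous n) (x : Fin 3 → ℂ) :
    eval x p = ∑ i : Expo n, coeff i.1 p * i.monomial x := by
  rw [eval_eq]
  have h : p.support ⊆ Finset.finsuppAntidiag Finset.univ n := by
    intro α hα
    have := hp (mem_support_iff.1 hα)
    rw [Finsupp.weight_apply] at this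
    simpa [Finsupp.sum_fintype] using this
  rw [Finset.sum_subset h fun α _ hα => by rw [notMem_support_iff.1 hα, zero_mul],
    ← Finset.sum_coe_sort]
  refine Finset.sum_congr rfl fun i _ => ?_
  congr 1
  refine (Finset.prod_subset (Finset.subset_univ _) fun l _ hl => ?_)
  rw [Finsupp.notMem_support_iff.1 hl, pow_zero]

theorem sum_mul_sum_sub_sum_mul_sum {ι R : Type*} [Fintype ι] [CommRing R] (a b f g : ι → R) :
    (∑ i, a i * f i) * (∑ i, b i * g i) - (∑ i, b i * f i) * (∑ i, a i * g i) =
      ∑ i, ∑ j, a i * b j * (f i * g j - f j * g i) := by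
  simp only [Finset.sum_mul_sum, mul_sub, Finset.sum_sub_distrib]
  congr 1
  · exact Finset.sum_congr rfl fun i _ => Finset.sum_congr rfl fun j _ => by ring
  · rw [Finset.sum_comm]
    exact Finset.sum_congr rfl fun i _ => Finset.sum_congr rfl fun j _ => by ring

theorem bezoutCoeffs_nonempty {k : ℕ} {p q : Poly3} (hp : p.IsHomogeneous (k + 1))
    (hq : q.IsHomogeneous (k + 1)) : Nonempty (BezoutCoeffs k p q) := by
  have hmem : (fun x y => eval x p * eval y q - eval x q * eval y p) ∈ bezoutSpan k := by
    have h : (fun x y : Fin 3 → ℂ => eval x p * eval y q - eval x q * eval y p) =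
        ∑ i : Expo (k + 1), ∑ j : Expo (k + 1), (coeff i.1 p * coeff j.1 q) •
          fun x y : Fin 3 → ℂ => i.monomial x * j.monomial y - j.monomial x * i.monomial y := by
      funext x y
      simp only [Finset.sum_apply, Pi.smul_apply, smul_eq_mul]
      rw [eval_eq_sum_expo hp x, eval_eq_sum_expo hp y, eval_eq_sum_expo hq x,
        eval_eq_sum_expo hq y]
      exact sum_mul_sum_sub_sum_mul_sum _ _ _ _
    rw [h]
    exact sum_mem fun i _ => sum_mem fun j _ =>
      Submodule.smul_mem _ _ (monomial_sub_mem_bezoutSpan i j)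
  obtain ⟨c, hc⟩ := (Submodule.mem_span_range_iff_exists_fun ℂ).1 hmem
  have h1 : ∀ x y : Fin 3 → ℂ, eval x p * eval y q - eval x q * eval y p =
      ∑ l, ∑ i, ∑ j, c (l, i, j) * (i.monomial x * crossCoord x y l * j.monomial y) := by
    intro x y
    have := congrFun (congrFun hc x) y
    rw [← this]
    simp only [Finset.sum_apply, Pi.smul_apply, smul_eq_mul, Fintype.sum_prod_type]
  -- Exchanging x and y changes the sign of the left side and of every cross product coordinate, so
  -- the transposed coefficients also work. The average of the two choices is symmetric.
  have h2 : ∀ x y : Fin 3 → ℂ, eval x p * eval y q - eval x q * eval y p =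
      ∑ l, ∑ i, ∑ j, c (l, j, i) * (i.monomial x * crossCoord x y l * j.monomial y) := by
    intro x y
    have := h1 y x
    rw [show eval x p * eval y q - eval x q * eval y p =
      -(eval y p * eval x q - eval y q * eval x p) by ring, this]
    simp only [← Finset.sum_neg_distrib]
    refine Finset.sum_congr rfl fun l _ => ?_
    rw [Finset.sum_comm]
    refine Finset.sum_congr rfl fun i _ => Finset.sum_congr rfl fun j _ => ?_
    rw [crossCoord_swap x y]
    ring
  let β : Fin 3 → Matrix (Expo k) (Expo k) ℂ := fun l =>
    Matrix.of fun i j => (c (l, i, j) + c (l, j, i)) / 2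
  have hβ : ∀ l, (β l).IsSymm := fun l => Matrix.IsSymm.ext fun i j => by
    simp only [β, Matrix.of_apply, add_comm]
  refine ⟨⟨-β 2, β 1, β 0, (hβ 2).neg, hβ 1, hβ 0, fun x y => ?_⟩⟩
  have h3 : eval x p * eval y q - eval x q * eval y p =
      ∑ l, ∑ i, ∑ j, β l i j * (i.monomial x * crossCoord x y l * j.monomial y) := by
    have : eval x p * eval y q - eval x q * eval y p =
      ((eval x p * eval y q - eval x q * eval y p) +
        (eval x p * eval y q - eval x q * eval y p)) / 2 := by ring
    rw [this]
    conv_lhs => enter [1, 1]; rw [h1]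
    conv_lhs => enter [1, 2]; rw [h2]
    simp only [← Finset.sum_add_distrib, Finset.sum_div]
    refine Finset.sum_congr rfl fun l _ => Finset.sum_congr rfl fun i _ =>
      Finset.sum_congr rfl fun j _ => ?_
    simp only [β, Matrix.of_apply]
    ring
  rw [h3, Fin.sum_univ_three]
  simp only [← Finset.sum_add_distrib]
  refine Finset.sum_congr rfl fun i _ => Finset.sum_congr rfl fun j _ => ?_
  simp only [crossCoord, Matrix.neg_apply]
  ring

/-- The Bezout coefficients of `q` and `p`. -/
def BezoutCoeffs.swap {k : ℕ} {p q : Poly3} (b : BezoutCoeffs k p q) : BezoutCoeffs k q p where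
  b10 := -b.b10
  b20 := -b.b20
  b12 := -b.b12
  symm10 := b.symm10.neg
  symm20 := b.symm20.neg
  symm12 := b.symm12.neg
  identity x y := by
    have := b.identity x y
    rw [show eval x q * eval y p - eval x p * eval y q =
      -(eval x p * eval y q - eval x q * eval y p) by ring, this]
    simp only [← Finset.sum_neg_distrib, Matrix.neg_apply]
    refine Finset.sum_congr rfl fun i _ => Finset.sum_congr rfl fun j _ => ?_
    ring

/-- The kernel is unchanged when `p` and `q` are exchanged, so `p` may be taken to be one that does
not vanish on the whole curve. -/
theorem BezoutCoeffs.swap_alongCurve {m k : ℕ} {p q : Poly3} (b : BezoutCoeffs k p q)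
    (D : Fin 3 → Matrix (Fin m) (Fin m) ℂ) : b.swap.alongCurve D = -b.alongCurve D := by
  have h : b.swap.matrix D = -b.matrix D := by
    ext x y
    simp only [BezoutCoeffs.matrix, BezoutCoeffs.swap, Matrix.sub_apply, Matrix.add_apply,
      Matrix.kroneckerMap_apply, Matrix.neg_apply]
    ring
  refine LinearMap.ext fun w => ?_
  simp only [BezoutCoeffs.alongCurve, h, map_neg, LinearMap.comp_apply, LinearMap.neg_apply]

/-! ### The orthogonal complement of the principal subspace -/

section orthogonal

variable {m : ℕ} {D : Fin 3 → Matrix (Fin m) (Fin m) ℂ}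

theorem blownPoly_single {k : ℕ} (i : Expo k) (s : Fin m) (c : ℂ) :
    blownPoly m k (EuclideanSpace.single (i, s) c) =
      c • (Pi.single s (monomial i.1 1) : Fin m → Poly3) := by
  funext t
  ext α
  simp only [blownPoly, LinearMap.coe_mk, AddHom.coe_mk, PiLp.single_apply, Prod.mk.injEq]
  by_cases ht : t = s
  · subst ht
    by_cases h : i.1 = α <;> simp [smul_monomial, coeff_monomial, apply_ite, h]
  · simp [ht]

/-- The image of a monomial vector under the pencil. -/
def pencilBlown (D : Fin 3 → Matrix (Fin m) (Fin m) ℂ) {k : ℕ} (j : Expo k) (r : Fin m) :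
    BlownSpace m (k + 1) :=
  ∑ l, ∑ s, EuclideanSpace.single (j.succ l, s) (D l s r)

theorem blownPoly_pencilBlown {k : ℕ} (j : Expo k) (r : Fin m) :
    blownPoly m (k + 1) (pencilBlown D j r) =
      (pencil D).mulVec (Pi.single r (monomial j.1 1)) := by
  rw [pencil_mulVec_single]
  simp only [pencilBlown, map_sum, blownPoly_single]
  rfl

/-- The defining equations of the principal subspace are orthogonality to the images of monomial
vectors under the pencil. This is where the matrices have to be Hermitian: the conjugated column
entries are row entries. -/
theorem inner_pencilBlown (hD : ∀ l, (D l).IsHermitian) {k : ℕ} (j : Expo k) (r : Fin m)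
    (w : BlownSpace m (k + 1)) : inner ℂ (pencilBlown D j r) w =
      (∑ l, (D l).mulVec (fun s => w (j.succ l, s))) r := by
  simp only [pencilBlown, sum_inner, EuclideanSpace.inner_single_left, Finset.sum_apply,
    Matrix.mulVec, dotProduct]
  refine Finset.sum_congr rfl fun l _ => Finset.sum_congr rfl fun s _ => ?_
  rw [← (hD l).apply r s]
  rfl

theorem mem_span_pencilBlown {k : ℕ} {w : BlownSpace m (k + 1)}
    (h : blownPoly m (k + 1) w ∈ relations (pencil D) 0 0) :
    w ∈ Submodule.span ℂ (Set.range fun x : Expo k × Fin m => pencilBlown D x.1 x.2) := by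
  obtain ⟨a, ha, hw⟩ := mem_relations_zero_of_mem_homVec (pencil_isHomogeneous D)
    (blownPoly_mem m _ w) h
  obtain ⟨v, rfl⟩ := exists_blownPoly_eq ha
  have hv : v = ∑ x, EuclideanSpace.single x (v x) := by
    ext y
    simp [Finset.sum_apply]
  have : w = ∑ x : Expo k × Fin m, v x • pencilBlown D x.1 x.2 := by
    refine blownPoly_injective m (k + 1) ?_
    rw [hw]
    conv_lhs => rw [hv]
    have h1 : ∀ (i : Expo k) (s : Fin m) (c : ℂ),
        (pencil D).mulVec (blownPoly m k (EuclideanSpace.single (i, s) c)) =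
          c • blownPoly m (k + 1) (pencilBlown D i s) := by
      intro i s c
      rw [blownPoly_single, blownPoly_pencilBlown, Matrix.mulVec_smul]
    simp only [map_sum, Matrix.mulVec_sum, h1, map_smul]
  rw [this]
  exact sum_mem fun x _ => Submodule.smul_mem _ _ (Submodule.subset_span ⟨x, rfl⟩)

/-- The principal subspace is the orthogonal complement of the homogeneous part of the image of the
pencil; taking complements again returns that image. So vectors modulo this complement are elements
of the cokernel. -/
theorem mem_orthogonal_principalSubspace (hD : ∀ l, (D l).IsHermitian) {k : ℕ}
    (w : BlownSpace m k) :
    w ∈ (principalSubspace D k)ᗮ ↔ blownPoly m k w ∈ relations (pencil D) 0 0 := by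
  cases k with
  | zero =>
    rw [show principalSubspace D 0 = ⊤ from rfl, Submodule.top_orthogonal_eq_bot,
      Submodule.mem_bot]
    constructor
    · rintro rfl
      rw [map_zero]
      exact zero_mem _
    · intro h
      refine blownPoly_injective m 0 ?_
      rw [eq_zero_of_mem_relations_zero (pencil_isHomogeneous D) (blownPoly_mem m 0 w) h, map_zero]
  | succ k =>
    have h1 : principalSubspace D (k + 1) =
        (Submodule.span ℂ (Set.range fun x : Expo k × Fin m => pencilBlown D x.1 x.2))ᗮ := by
      ext v
      rw [Submodule.mem_orthogonal]
      constructor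
      · intro hv u hu
        induction hu using Submodule.span_induction with
        | mem _ h =>
          obtain ⟨x, rfl⟩ := h
          rw [inner_pencilBlown hD, hv x.1]
          rfl
        | zero => exact inner_zero_left _
        | add _ _ _ _ h1 h2 => rw [inner_add_left, h1, h2, add_zero]
        | smul c _ _ h => rw [inner_smul_left, h, mul_zero]
      · intro hv j
        funext r
        rw [← inner_pencilBlown hD, hv _ (Submodule.subset_span ⟨(j, r), rfl⟩)]
        rfl
    rw [h1, Submodule.orthogonal_orthogonal]
    refine ⟨fun h => ?_, mem_span_pencilBlown⟩
    induction h using Submodule.span_induction with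
    | mem _ h =>
      obtain ⟨x, rfl⟩ := h
      rw [blownPoly_pencilBlown]
      exact mulVec_mem_relations _ _ _ _
    | zero =>
      rw [map_zero]
      exact zero_mem _
    | add _ _ _ _ h1 h2 =>
      rw [map_add]
      exact add_mem h1 h2
    | smul c v _ h =>
      have h2 : blownPoly m (k + 1) (c • v) = (C c : Poly3) • blownPoly m (k + 1) v := by
        rw [map_smul]
        exact (algebraMap_smul Poly3 c _).symm
      rw [h2]
      exact Submodule.smul_mem _ _ h

theorem BezoutCoeffs.alongCurve_eq_zero (hD : ∀ l, (D l).IsHermitian) {k : ℕ} {p q : Poly3}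
    (b : BezoutCoeffs k p q) (w : principalSubspace D k) :
    b.alongCurve D w = 0 ↔
      blownPoly m k (Matrix.toEuclideanLin (b.matrix D) w) ∈ relations (pencil D) 0 0 := by
  rw [← mem_orthogonal_principalSubspace hD, BezoutCoeffs.alongCurve, LinearMap.comp_apply,
    LinearMap.comp_apply, Submodule.subtype_apply]
  generalize Matrix.toEuclideanLin (b.matrix D) (w : BlownSpace m k) = v
  exact Submodule.orthogonalProjectionOnto_eq_zero_iff

theorem finrank_principalSubspace (hD : ∀ l, (D l).IsHermitian)
    (hprime : Prime (pencil D).det) (k : ℕ) :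
    Module.finrank ℂ (principalSubspace D k) = m * (k + 1) := by
  have h1 := (principalSubspace D k).finrank_add_finrank_orthogonal
  have h2 := LinearMap.finrank_range_add_finrank_ker
    (gradedMap (pencil D) 0 0 k ∘ₗ (blownEquiv m k).toLinearMap)
  have h3 : LinearMap.ker (gradedMap (pencil D) 0 0 k ∘ₗ (blownEquiv m k).toLinearMap) =
      (principalSubspace D k)ᗮ := by
    ext w
    rw [mem_orthogonal_principalSubspace hD, LinearMap.mem_ker, LinearMap.comp_apply,
      gradedMap_eq_zero]
    rfl
  rw [LinearMap.range_comp_of_range_eq_top _ (blownEquiv m k).range, h3] at h2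
  have h4 := gradedDim_zero (pencil_isHomogeneous D) hprime k
  rw [gradedDim] at h4
  omega

end orthogonal

/-! ### The kernel of the Bezout matrix along the curve -/

section kernel

variable {m : ℕ} {D : Fin 3 → Matrix (Fin m) (Fin m) ℂ}

/-- Multiplication by `f` is injective on the quotient by `J`, so its transpose is surjective on the
full algebraic dual: functionals that vanish on `J` can be divided by `f`. -/
theorem exists_actDual_eq {J : Submodule Poly3 (Fin m → Poly3)} {f : Poly3}
    (hf : ∀ u, f • u ∈ J → u ∈ J) (Φ : Module.Dual ℂ (Fin m → Poly3)) (hΦ : ∀ u ∈ J, Φ u = 0) :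
    ∃ Ψ : Module.Dual ℂ (Fin m → Poly3), (∀ u ∈ J, Ψ u = 0) ∧ actDual f Ψ = Φ := by
  let J' := J.restrictScalars ℂ
  let T : (Fin m → Poly3) →ₗ[ℂ] (Fin m → Poly3) ⧸ J' :=
    J'.mkQ ∘ₗ (LinearMap.lsmul Poly3 (Fin m → Poly3) f).restrictScalars ℂ
  have hT : ∀ u, T u = 0 ↔ f • u ∈ J := fun u => Submodule.Quotient.mk_eq_zero J'
  have h1 : Φ ∈ (LinearMap.ker T).dualAnnihilator := by
    rw [Submodule.mem_dualAnnihilator]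
    intro u hu
    exact hΦ u (hf u ((hT u).1 hu))
  rw [← LinearMap.range_dualMap_eq_dualAnnihilator_ker] at h1
  obtain ⟨ψ, hψ⟩ := h1
  refine ⟨ψ ∘ₗ J'.mkQ, fun u hu => ?_, ?_⟩
  · rw [LinearMap.comp_apply, Submodule.mkQ_apply, (Submodule.Quotient.mk_eq_zero J').2 hu, map_zero]
  · rw [← hψ]
    rfl

theorem exists_dual_extension {J : Submodule Poly3 (Fin m → Poly3)} {k : ℕ}
    (Φ : Module.Dual ℂ (Fin m → Poly3)) (hΦ : ∀ u ∈ homVec m k, u ∈ J → Φ u = 0) :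
    ∃ Ψ : Module.Dual ℂ (Fin m → Poly3), (∀ u ∈ J, Ψ u = 0) ∧ ∀ u ∈ homVec m k, Ψ u = Φ u := by
  let J' := J.restrictScalars ℂ
  let T : homVec m k →ₗ[ℂ] (Fin m → Poly3) ⧸ J' := J'.mkQ ∘ₗ (homVec m k).subtype
  have hT : ∀ u : homVec m k, T u = 0 ↔ (u : Fin m → Poly3) ∈ J :=
    fun u => Submodule.Quotient.mk_eq_zero J'
  have h1 : Φ ∘ₗ (homVec m k).subtype ∈ (LinearMap.ker T).dualAnnihilator := by
    rw [Submodule.mem_dualAnnihilator]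
    intro u hu
    exact hΦ u u.2 ((hT u).1 hu)
  rw [← LinearMap.range_dualMap_eq_dualAnnihilator_ker] at h1
  obtain ⟨ψ, hψ⟩ := h1
  refine ⟨ψ ∘ₗ J'.mkQ, fun u hu => ?_, fun u hu => ?_⟩
  · rw [LinearMap.comp_apply, Submodule.mkQ_apply, (Submodule.Quotient.mk_eq_zero J').2 hu, map_zero]
  · exact LinearMap.congr_fun hψ ⟨u, hu⟩

theorem isDualVector_iff_relations (Φ : Module.Dual ℂ (Fin m → Poly3)) :
    IsDualVector D Φ ↔ ∀ u ∈ relations (pencil D).transpose 0 0, Φ u = 0 := by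
  constructor
  · intro h u hu
    obtain ⟨a, rfl⟩ := mem_relations_zero.1 hu
    exact h a
  · exact fun h u => h _ (mulVec_mem_relations _ _ _ _)

theorem isDualVector_and_actDual_iff (p : Poly3) (Φ : Module.Dual ℂ (Fin m → Poly3)) :
    (IsDualVector D Φ ∧ actDual p Φ = 0) ↔
      ∀ u ∈ relations (pencil D).transpose p 0, Φ u = 0 := by
  constructor
  · rintro ⟨h1, h2⟩ u hu
    obtain ⟨a, b, rfl⟩ := mem_relations_single.1 hu
    rw [map_add, h1, zero_add]
    exact LinearMap.congr_fun h2 b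
  · exact fun h => ⟨fun u => h _ (mulVec_mem_relations _ _ _ _),
      LinearMap.ext fun u => h _ (left_smul_mem_relations _ _ _ _)⟩

theorem bezoutApply_zero (b : Fin 3 → Poly33) : bezoutApply D b 0 = 0 := by
  have h : extendDual (0 : Module.Dual ℂ (Fin m → Poly3)) = 0 := by
    refine (basisMonomials (Fin 3) Poly3).ext fun α => ?_
    funext s
    rw [coe_basisMonomials, extendDual_monomial]
    simp
  simp [bezoutApply, slot_apply, h]

theorem slot_one (Φ : Module.Dual ℂ (Fin m → Poly3)) (l : Fin 3) :
    slot D Φ l 1 = ((D l).map C).mulVec fun s => C (Φ (Pi.single s 1)) := by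
  rw [slot_apply]
  congr 1
  funext s
  exact extendDual_monomial Φ 0 s

/-- `b_l = δ_{l i}` expresses `x_j y_k - x_k y_j` where `(i, j, k)` is cyclic. -/
theorem isBezoutian_X (i : Fin 3) : IsBezoutian (X (i + 1)) (X (i + 2)) (Pi.single i 1) := by
  have h : ∀ l, inY (X l) = X l := fun l => by simp [inY]
  rw [IsBezoutian, h, h, Finset.sum_eq_single i (fun j _ hj => by
    rw [Pi.single_eq_of_ne hj, zero_mul]) (by simp), Pi.single_eq_same, one_mul]
  fin_cases i <;> rfl

variable {k : ℕ} {p q : Poly3} {c : Fin 3 → ℂ}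

/-- The dual vectors that are killed by `p` and by the Bezoutian `b`. -/
structure IsBezoutKernel (D : Fin 3 → Matrix (Fin m) (Fin m) ℂ) (p : Poly3) (b : Fin 3 → Poly33)
    (Φ : Module.Dual ℂ (Fin m → Poly3)) : Prop where
  dual : IsDualVector D Φ
  act : actDual p Φ = 0
  bezout : bezoutApply D b Φ ∈ relations (pencil D) 0 0

theorem actDual_comm (f g : Poly3) (Φ : Module.Dual ℂ (Fin m → Poly3)) :
    actDual f (actDual g Φ) = actDual g (actDual f Φ) := by
  rw [← actDual_mul, ← actDual_mul, mul_comm]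

theorem actDual_zero (f : Poly3) : actDual f (0 : Module.Dual ℂ (Fin m → Poly3)) = 0 := rfl

theorem bezoutApply_mem_homVec (b : BezoutCoeffs k p q) (Φ : Module.Dual ℂ (Fin m → Poly3)) :
    bezoutApply D b.toPoly Φ ∈ homVec m k := by
  rw [b.bezoutApply_toPoly]
  exact blownPoly_mem _ _ _

/-! ### The Bezout matrix of `p` and a power of a regular linear form -/

section

variable (hprime : Prime (pencil D).det) (hp : p.IsHomogeneous (k + 1)) (hpd : ¬ (pencil D).det ∣ p)
  (hreg : ∀ u, linForm c • u ∈ relations (pencil D) p 0 → u ∈ relations (pencil D) p 0)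
  (hregT : ∀ u, linForm c • u ∈ relations (pencil D).transpose p 0 →
    u ∈ relations (pencil D).transpose p 0)
  (b₁ : BezoutCoeffs k p (linForm c ^ (k + 1)))

-- Apply the exchange identity to x_a and ℓ. As pΨ = 0, it gives ℓ b₁(x_aΨ) = x_a b₁(ℓΨ) = 0 modulo
-- (A, p), and ℓ cancels. The result has degree n - 1, where relations modulo p are already
-- relations of the pencil.
include hp hreg in
theorem IsBezoutKernel.actDual_X {Ψ : Module.Dual ℂ (Fin m → Poly3)} (hΨ : IsDualVector D Ψ)
    (hΨ' : actDual p Ψ = 0) (h : IsBezoutKernel D p b₁.toPoly (actDual (linForm c) Ψ)) (a : Fin 3) :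
    IsBezoutKernel D p b₁.toPoly (actDual (X a) Ψ) := by
  refine ⟨hΨ.actDual _, by rw [actDual_comm, hΨ', actDual_zero], ?_⟩
  obtain ⟨b'⟩ := bezoutCoeffs_nonempty (k := 0) (isHomogeneous_X ℂ a) (linForm_isHomogeneous c)
  have h1 := bezoutApply_exchange D b₁.isBezoutian b'.isBezoutian hΨ
  rw [hΨ', bezoutApply_zero, smul_zero, sub_zero] at h1
  have h2 : linForm c • bezoutApply D b₁.toPoly (actDual (X a) Ψ) ∈ relations (pencil D) p 0 := by
    have h3 := sub_mem (relations_zero_le _ p 0 (Submodule.smul_mem _ (X a) h.bezout))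
      (relations_zero_le _ p 0 h1)
    have h4 := sub_mem h3 (left_smul_mem_relations (pencil D) p 0
      (bezoutApply D b'.toPoly (actDual (linForm c ^ (k + 1)) Ψ)))
    convert h4 using 1
    module
  exact mem_relations_zero_of_lt (pencil_isHomogeneous D) hp (Nat.lt_succ_self k)
    (bezoutApply_mem_homVec _ _) (hreg _ h2)

-- Divide Φ = ℓΨ, so that every x_aΨ is again in the kernel. The exchange identity for two
-- coordinates, whose Bezoutian is a constant unit vector, shows that p D_i v is a relation, where v
-- is the vector of values of ℓ^nΨ on the constant unit vectors. Cancelling p, the constant vector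
-- D_i v is zero for every i, so the pencil kills v and v = 0. The entries of v are the values of Φ
-- at ℓ^(n-1) e_s.
include hp hprime hpd hreg hregT in
theorem IsBezoutKernel.apply_single {Φ : Module.Dual ℂ (Fin m → Poly3)}
    (h : IsBezoutKernel D p b₁.toPoly Φ) (s : Fin m) :
    Φ (linForm c ^ k • Pi.single s 1) = 0 := by
  obtain ⟨Ψ, hΨ, hΨΦ⟩ := exists_actDual_eq hregT Φ
    ((isDualVector_and_actDual_iff p Φ).1 ⟨h.dual, h.act⟩)
  obtain ⟨hΨ1, hΨ2⟩ := (isDualVector_and_actDual_iff p Ψ).2 hΨ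
  rw [← hΨΦ] at h
  have hX := IsBezoutKernel.actDual_X hp hreg b₁ hΨ1 hΨ2 h
  set Φ' := actDual (linForm c ^ (k + 1)) Ψ with hΦ'
  have hv : ∀ t, Φ' (Pi.single t 1) = Φ (linForm c ^ k • Pi.single t 1) := by
    intro t
    rw [hΦ', ← hΨΦ, actDual_apply, actDual_apply, smul_smul, pow_succ']
  have hzero : ∀ i, slot D Φ' i 1 = 0 := by
    intro i
    have h1 := bezoutApply_exchange D b₁.isBezoutian (isBezoutian_X i) hΨ1
    rw [hΨ2, bezoutApply_zero, smul_zero, sub_zero] at h1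
    have h2 : bezoutApply D (Pi.single i 1) Φ' = slot D Φ' i 1 := by
      rw [bezoutApply, Finset.sum_eq_single i (fun j _ hj => by
        rw [Pi.single_eq_of_ne hj, map_zero]) (by simp), Pi.single_eq_same]
    rw [h2] at h1
    have h3 : p • slot D Φ' i 1 ∈ relations (pencil D) 0 0 := by
      have h4 := sub_mem (sub_mem (Submodule.smul_mem _ (X (i + 1)) (hX (i + 2)).bezout)
        (Submodule.smul_mem _ (X (i + 2)) (hX (i + 1)).bezout)) h1
      convert h4 using 1
      module
    refine eq_zero_of_mem_relations_zero (pencil_isHomogeneous D) ?_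
      (mem_relations_zero_of_smul hprime hpd h3)
    rw [slot_one]
    refine mem_homVec.2 fun r => IsHomogeneous.sum _ _ _ fun t _ => ?_
    simpa using (isHomogeneous_C (Fin 3) (D i r t)).mul (isHomogeneous_C (Fin 3) _)
  have hker : (pencil D).mulVec (fun t => C (Φ' (Pi.single t 1))) = (pencil D).mulVec 0 := by
    rw [pencil_mulVec, Matrix.mulVec_zero]
    refine Finset.sum_eq_zero fun l _ => ?_
    rw [← slot_one, hzero, smul_zero]
  have := congrFun (mulVec_injective_of_prime hprime hker) s
  rw [← hv]
  exact C_eq_zero.1 this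

-- Dividing by ℓ repeatedly and exchanging one factor ℓ for a coordinate at each stage keeps all the
-- resulting functionals in the kernel.
include hp hreg hregT in
theorem IsBezoutKernel.exists_monomial {Φ : Module.Dual ℂ (Fin m → Poly3)}
    (h : IsBezoutKernel D p b₁.toPoly Φ) (d : ℕ) :
    ∃ Ψ, IsDualVector D Ψ ∧ actDual p Ψ = 0 ∧ actDual (linForm c ^ d) Ψ = Φ ∧
      ∀ α : Fin 3 →₀ ℕ, α.degree = d → IsBezoutKernel D p b₁.toPoly (actDual (monomial α 1) Ψ) := by
  have hone : ∀ Ψ : Module.Dual ℂ (Fin m → Poly3), actDual 1 Ψ = Ψ := fun Ψ =>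
    LinearMap.ext fun u => by rw [actDual_apply, one_smul]
  induction d with
  | zero =>
    refine ⟨Φ, h.dual, h.act, by rw [pow_zero, hone], fun α hα => ?_⟩
    rw [(Finsupp.degree_eq_zero_iff α).1 hα, show (monomial 0 (1 : ℂ) : Poly3) = 1 from rfl, hone]
    exact h
  | succ d ih =>
    obtain ⟨Ψ, h1, h2, h3, h4⟩ := ih
    obtain ⟨Ψ', hΨ', hΨΨ'⟩ := exists_actDual_eq hregT Ψ
      ((isDualVector_and_actDual_iff p Ψ).1 ⟨h1, h2⟩)
    obtain ⟨h1', h2'⟩ := (isDualVector_and_actDual_iff p Ψ').2 hΨ'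
    refine ⟨Ψ', h1', h2', by rw [pow_succ, actDual_mul, hΨΨ', h3], fun α hα => ?_⟩
    obtain ⟨j, l, hj⟩ := (Expo.mk' α hα).exists_eq_succ
    have hα' : α = j.1 + Finsupp.single l 1 := congrArg Subtype.val hj
    have hmon : (monomial α (1 : ℂ) : Poly3) = X l * monomial j.1 1 := by
      rw [hα', X, monomial_mul, one_mul, add_comm]
    rw [hmon, actDual_mul]
    refine IsBezoutKernel.actDual_X hp hreg b₁ (h1'.actDual _)
      (by rw [actDual_comm, h2', actDual_zero]) ?_ l
    rw [actDual_comm, hΨΨ']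
    exact h4 j.1 j.degree_eq

-- Multiples of `p` impose no new condition in degree n - 1, so the degree n - 1 values of a dual
-- vector can be extended to a functional that is also killed by `p`.
include hp in
theorem exists_isDualVector_of_mem {w : BlownSpace m k} (hw : w ∈ principalSubspace D k) :
    ∃ Φ, IsDualVector D Φ ∧ actDual p Φ = 0 ∧ restrictDual k Φ = w := by
  have hΦ := (isDualVector_iff_relations _).1 (blownDual_isDualVector D hw)
  have hA : ∀ i j, ((pencil D).transpose i j).IsHomogeneous 1 := fun i j =>
    pencil_isHomogeneous D j i
  obtain ⟨Ψ, h1, h2⟩ := exists_dual_extension (J := relations (pencil D).transpose p 0) (k := k)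
    (blownDual w) fun u hu hu' => hΦ u (mem_relations_zero_of_lt hA hp (Nat.lt_succ_self k) hu hu')
  obtain ⟨h3, h4⟩ := (isDualVector_and_actDual_iff p Ψ).2 h1
  refine ⟨Ψ, h3, h4, ?_⟩
  rw [← restrictDual_blownDual w]
  ext x
  rw [restrictDual_apply, restrictDual_apply]
  refine h2 _ (mem_homVec.2 fun s => ?_)
  by_cases hs : s = x.2
  · subst hs
    rw [Pi.single_eq_same]
    exact isHomogeneous_monomial _ x.1.degree_eq
  · rw [Pi.single_eq_of_ne hs]
    exact isHomogeneous_zero _ _ _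

-- Write Φ = ℓ^k Ψ with k = n - 1 and all x^αΨ, |α| = k, in the kernel. The value of x^αΨ at ℓ^k e_s
-- is zero, and it is also Φ(x^α e_s), a coordinate of w.
include hp hprime hpd hreg hregT in
theorem eq_zero_of_bezout_linForm_mem {w : BlownSpace m k} (hw : w ∈ principalSubspace D k)
    (h : blownPoly m k (Matrix.toEuclideanLin (b₁.matrix D) w) ∈ relations (pencil D) 0 0) :
    w = 0 := by
  obtain ⟨Φ, h1, h2, rfl⟩ := exists_isDualVector_of_mem hp hw
  have hK : IsBezoutKernel D p b₁.toPoly Φ := ⟨h1, h2, by rwa [b₁.bezoutApply_toPoly]⟩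
  obtain ⟨Ψ, -, -, hΨ, hα⟩ := hK.exists_monomial hp hreg hregT b₁ k
  ext ⟨i, s⟩
  have := (hα i.1 i.degree_eq).apply_single hprime hp hpd hreg hregT b₁ s
  rw [restrictDual_apply, ← hΨ, actDual_apply]
  rw [actDual_apply, smul_comm, ← Pi.single_smul, smul_eq_mul, mul_one] at this
  exact this

-- Divide Φ = pΨ and apply the exchange identity to the two Bezoutians `b` and `b₁`, which share the
-- polynomial `p`. The terms with a factor p disappear modulo p.
include hprime hpd in
theorem bezout_linForm_congr (b : BezoutCoeffs k p q) {Φ : Module.Dual ℂ (Fin m → Poly3)}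
    (hΦ : IsDualVector D Φ) :
    linForm c ^ (k + 1) • bezoutApply D b.toPoly Φ - q • bezoutApply D b₁.toPoly Φ ∈
      relations (pencil D) p 0 := by
  have hprimeT : Prime (pencil D).transpose.det := by rwa [Matrix.det_transpose]
  obtain ⟨Ψ, hΨ, rfl⟩ := exists_actDual_eq (J := relations (pencil D).transpose 0 0) (f := p)
    (fun u => mem_relations_zero_of_smul hprimeT (by rwa [Matrix.det_transpose])) Φ
    ((isDualVector_iff_relations _).1 hΦ)
  have h1 := bezoutApply_exchange D b.isBezoutian b₁.isBezoutian
    ((isDualVector_iff_relations _).2 hΨ)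
  have h2 := sub_mem (left_smul_mem_relations (pencil D) p 0
    (bezoutApply D b.toPoly (actDual (linForm c ^ (k + 1)) Ψ) -
      bezoutApply D b₁.toPoly (actDual q Ψ))) (relations_zero_le _ p 0 h1)
  convert h2 using 1
  module

end

theorem mem_of_pow_smul_mem {R M : Type*} [CommRing R] [AddCommGroup M] [Module R M]
    {J : Submodule R M} {f : R} (h : ∀ u, f • u ∈ J → u ∈ J) (d : ℕ) {u : M}
    (hu : f ^ d • u ∈ J) : u ∈ J := by
  induction d with
  | zero => simpa using hu
  | succ d ih => exact ih (h _ (by rwa [smul_smul, ← pow_succ']))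

/-- The map `B₁` carries the principal subspace isomorphically onto E in degree n - 1, and there B'
becomes multiplication by `q` into E/pE in degree 2n - 1. Source and target have dimension mn, so
kernel and cokernel have the same dimension. -/
theorem finrank_ker_alongCurve (hD : ∀ l, (D l).IsHermitian) (hprime : Prime (pencil D).det)
    (hp : p.IsHomogeneous (k + 1)) (hq : q.IsHomogeneous (k + 1)) (hpd : ¬ (pencil D).det ∣ p)
    (hreg : ∀ u, linForm c • u ∈ relations (pencil D) p 0 → u ∈ relations (pencil D) p 0)
    (hregT : ∀ u, linForm c • u ∈ relations (pencil D).transpose p 0 →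
      u ∈ relations (pencil D).transpose p 0) (b : BezoutCoeffs k p q) :
    Module.finrank ℂ (LinearMap.ker (b.alongCurve D)) =
      gradedDim (pencil D) p q (k + 1 + k) := by
  have hA := pencil_isHomogeneous D
  obtain ⟨b₁⟩ := bezoutCoeffs_nonempty (k := k) hp
    (by simpa using (linForm_isHomogeneous c).pow (k + 1))
  let B₁ : principalSubspace D k →ₗ[ℂ] homVec m k :=
    (blownEquiv m k).toLinearMap ∘ₗ Matrix.toEuclideanLin (b₁.matrix D) ∘ₗ
      (principalSubspace D k).subtype
  have hB₁ : ∀ w, (B₁ w : Fin m → Poly3) =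
    blownPoly m k (Matrix.toEuclideanLin (b₁.matrix D) w) := fun w => rfl
  have hinj : Function.Injective (gradedMap (pencil D) 0 0 k ∘ₗ B₁) := by
    rw [← LinearMap.ker_eq_bot, LinearMap.ker_eq_bot']
    intro w hw
    rw [LinearMap.comp_apply, gradedMap_eq_zero, hB₁] at hw
    exact Subtype.ext (eq_zero_of_bezout_linForm_mem hprime hp hpd hreg hregT b₁ w.2 hw)
  have hsurj : LinearMap.range (gradedMap (pencil D) 0 0 k ∘ₗ B₁) =
      LinearMap.range (gradedMap (pencil D) 0 0 k) := by
    -- The injective map is onto because the principal subspace and the graded piece both have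
    -- dimension m(k + 1).
    refine Submodule.eq_of_le_of_finrank_eq (LinearMap.range_comp_le_range _ _) ?_
    rw [LinearMap.finrank_range_of_inj hinj, finrank_principalSubspace hD hprime]
    exact (gradedDim_zero hA hprime k).symm
  have hrange : LinearMap.range (gradedMul (pencil D) p 0 q k ∘ₗ B₁) =
      LinearMap.range (gradedMul (pencil D) p 0 q k) := by
    refine le_antisymm (LinearMap.range_comp_le_range _ _) ?_
    rintro _ ⟨u, rfl⟩
    obtain ⟨w, hw⟩ : gradedMap (pencil D) 0 0 k u ∈
        LinearMap.range (gradedMap (pencil D) 0 0 k ∘ₗ B₁) := by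
      rw [hsurj]
      exact ⟨u, rfl⟩
    have h1 : ((B₁ w - u : homVec m k) : Fin m → Poly3) ∈ relations (pencil D) 0 0 := by
      rw [← gradedMap_eq_zero, map_sub, ← hw]
      exact sub_self _
    refine ⟨w, ?_⟩
    rw [← sub_eq_zero, LinearMap.comp_apply, ← map_sub, gradedMul_eq_zero]
    exact Submodule.smul_mem _ _ (relations_zero_le _ _ _ h1)
  -- Modulo (A, p) the vectors ℓ^n b(Φ) and q b₁(Φ) agree. If they vanish, cancelling ℓ gives b(Φ)
  -- in (A, p), hence in the image of A, since the degree is n - 1.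
  have hker : LinearMap.ker (gradedMul (pencil D) p 0 q k ∘ₗ B₁) =
      LinearMap.ker (b.alongCurve D) := by
    ext w
    rw [LinearMap.mem_ker, LinearMap.mem_ker, b.alongCurve_eq_zero hD, LinearMap.comp_apply,
      gradedMul_eq_zero, hB₁]
    obtain ⟨Φ, h1, -, h3⟩ := exists_isDualVector_of_mem hp w.2
    have h4 := bezout_linForm_congr (c := c) hprime hpd b₁ b h1
    rw [b.bezoutApply_toPoly, b₁.bezoutApply_toPoly, h3] at h4
    constructor
    · intro h
      refine mem_relations_zero_of_lt hA hp (Nat.lt_succ_self k) (blownPoly_mem _ _ _)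
        (mem_of_pow_smul_mem hreg (k + 1) ?_)
      simpa using add_mem h4 h
    · intro h
      have h5 := Submodule.smul_mem _ (linForm c ^ (k + 1)) (relations_zero_le _ p 0 h)
      simpa using sub_mem h5 h4
  have e1 := LinearMap.finrank_range_add_finrank_ker (gradedMul (pencil D) p 0 q k ∘ₗ B₁)
  rw [hrange, hker, finrank_principalSubspace hD hprime] at e1
  have e2 := gradedDim_add_finrank_gradedMul hA hprime hp hq hpd rfl
  omega

end kernel

/-! ### Points of the curve -/

theorem MvPolynomial.IsHomogeneous.eval_smul_point {f : Poly3} {n : ℕ} (hf : f.IsHomogeneous n)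
    (t : ℂ) (x : Fin 3 → ℂ) : eval (t • x) f = t ^ n * eval x f := by
  have h : ∀ i : Expo n, i.monomial (t • x) = t ^ n * i.monomial x := by
    intro i
    simp only [Expo.monomial, Pi.smul_apply, smul_eq_mul, mul_pow, Finset.prod_mul_distrib]
    rw [Finset.prod_pow_eq_pow_sum, ← Finsupp.degree_eq_sum, i.degree_eq]
  rw [eval_eq_sum_expo hf, eval_eq_sum_expo hf, Finset.mul_sum]
  exact Finset.sum_congr rfl fun i _ => by rw [h]; ring

theorem MvPolynomial.IsHomogeneous.eval_rep_eq_zero_iff {f : Poly3} {n : ℕ}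
    (hf : f.IsHomogeneous n) {x : Fin 3 → ℂ} (hx : x ≠ 0) :
    eval (Projectivization.mk ℂ x hx).rep f = 0 ↔ eval x f = 0 := by
  obtain ⟨a, ha⟩ := Projectivization.exists_smul_eq_mk_rep ℂ x hx
  rw [← ha, Units.smul_def, hf.eval_smul_point]
  simp

theorem eval_linForm_dual (f : Module.Dual ℂ (Fin 3 → ℂ)) (x : Fin 3 → ℂ) :
    eval x (linForm fun l => f (Pi.single l 1)) = f x := by
  rw [eval_linForm]
  conv_rhs => rw [pi_eq_sum_univ' x]
  simp only [map_sum, map_smul, smul_eq_mul]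
  exact Finset.sum_congr rfl fun l _ => mul_comm _ _

theorem exists_linForm_eval_ne_zero {v w : Fin 3 → ℂ} (h : ∀ t : ℂ, v ≠ t • w) :
    ∃ c, eval w (linForm c) = 0 ∧ eval v (linForm c) ≠ 0 := by
  obtain ⟨f, hf, hf'⟩ := Submodule.exists_dual_map_eq_bot_of_notMem (p := Submodule.span ℂ {w})
    (x := v) (by
      rw [Submodule.mem_span_singleton]
      rintro ⟨t, ht⟩
      exact h t ht.symm) inferInstance
  have hc := eval_linForm_dual f
  refine ⟨fun l => f (Pi.single l 1), ?_, ?_⟩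
  · rw [hc]
    have : f w ∈ (Submodule.span ℂ {w}).map f :=
      ⟨w, Submodule.mem_span_singleton_self w, rfl⟩
    rwa [hf', Submodule.mem_bot] at this
  · rwa [hc]

theorem Projectivization.rep_ne_smul_rep {x y : ℙ ℂ (Fin 3 → ℂ)} (h : x ≠ y) (t : ℂ) :
    x.rep ≠ t • y.rep := by
  intro ht
  refine h ?_
  rw [← x.mk_rep, ← y.mk_rep, Projectivization.mk_eq_mk_iff']
  exact ⟨t, ht.symm⟩

open scoped Classical in
/-- Finitely many points of the projective plane are separated by forms. -/
theorem exists_separating_form (T : Finset (ℙ ℂ (Fin 3 → ℂ))) (x : ℙ ℂ (Fin 3 → ℂ)) (hx : x ∈ T) :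
    ∃ e : Poly3, e.IsHomogeneous (T.card - 1) ∧ eval x.rep e ≠ 0 ∧
      ∀ y ∈ T, x ≠ y → eval y.rep e = 0 := by
  have h : ∀ y, ∃ c : Fin 3 → ℂ, y ∈ T.erase x →
      eval y.rep (linForm c) = 0 ∧ eval x.rep (linForm c) ≠ 0 := by
    intro y
    by_cases hy : y ∈ T.erase x
    · obtain ⟨c, hc⟩ := exists_linForm_eval_ne_zero
        (Projectivization.rep_ne_smul_rep (Finset.ne_of_mem_erase hy).symm)
      exact ⟨c, fun _ => hc⟩
    · exact ⟨0, fun h => absurd h hy⟩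
  choose c hc using h
  refine ⟨∏ y ∈ T.erase x, linForm (c y), ?_, ?_, fun y hy hxy => ?_⟩
  · have := IsHomogeneous.prod (T.erase x) (fun y => linForm (c y)) (fun _ => 1)
      fun y _ => linForm_isHomogeneous (c y)
    rwa [Finset.sum_const, Finset.card_erase_of_mem hx, smul_eq_mul, mul_one] at this
  · rw [map_prod]
    exact Finset.prod_ne_zero_iff.2 fun y hy => (hc y hy).2
  · have hy' : y ∈ T.erase x := Finset.mem_erase.2 ⟨hxy.symm, hy⟩
    rw [map_prod]
    exact Finset.prod_eq_zero hy' (hc y hy').1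

theorem eval_mulVec {m : ℕ} (A : Matrix (Fin m) (Fin m) Poly3) (v : Fin 3 → ℂ)
    (a : Fin m → Poly3) : (fun s => eval v (A.mulVec a s)) =
      (A.map (eval v)).mulVec fun s => eval v (a s) := by
  funext s
  simp [Matrix.mulVec, dotProduct]

/-- A functional on the fibre at `v` of the cokernel that is not zero if `v` is on the curve. -/
theorem exists_fibre_functional {m : ℕ} (A : Matrix (Fin m) (Fin m) Poly3) (v : Fin 3 → ℂ)
    (hv : eval v A.det = 0) : ∃ r : Fin m → ℂ, r ≠ 0 ∧
      ∀ (p q : Poly3), eval v p = 0 → eval v q = 0 → ∀ u ∈ relations A p q,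
        r ⬝ᵥ (fun s => eval v (u s)) = 0 := by
  obtain ⟨r, hr, hr'⟩ := (Matrix.exists_vecMul_eq_zero_iff (M := A.map (eval v))).2 (by
    rw [RingHom.map_det] at hv
    exact hv)
  refine ⟨r, hr, fun p q hp hq u hu => ?_⟩
  obtain ⟨a, b, c, rfl⟩ := hu
  have : (fun s => eval v ((A.mulVec a + p • b + q • c) s)) =
      (A.map (eval v)).mulVec fun s => eval v (a s) := by
    rw [← eval_mulVec]
    funext s
    simp [hp, hq]
  rw [this, Matrix.dotProduct_mulVec, hr', zero_dotProduct]

/-! ### Finiteness of the zeros of `p` on the curve and the choice of a regular linear form -/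

section zeros

variable {m : ℕ} {A : Matrix (Fin m) (Fin m) Poly3}

/-- From mn + 1 zeros, separating forms of degree mn and nonzero functionals on the fibres would
produce mn + 1 independent elements of a graded piece of E/pE, whose dimension is mn. -/
theorem finite_zeros (hA : ∀ i j, (A i j).IsHomogeneous 1) (hprime : Prime A.det)
    {n : ℕ} {p : Poly3} (hp : p.IsHomogeneous n) (hpd : ¬ A.det ∣ p) :
    {x : ℙ ℂ (Fin 3 → ℂ) | eval x.rep A.det = 0 ∧ eval x.rep p = 0}.Finite := by
  by_contra hinf
  obtain ⟨T, hT, hcard⟩ := Set.Infinite.exists_subset_card_eq hinf (m * n + 1)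
  -- The empty matrix has determinant 1, which is not prime. The bound puts the degree mn in the
  -- range where the dimension formula holds.
  have hm : 1 ≤ m := by
    rcases Nat.eq_zero_or_pos m with rfl | hm
    · exact absurd (isUnit_one (M := Poly3)) (by simpa using hprime.not_isUnit)
    · exact hm
  choose e hc2 hc1 hc0 using fun x : T => exists_separating_form T x.1 x.2
  choose r hr0 hr using fun x : T => exists_fibre_functional A x.1.rep (hT x.2).1
  choose s hs using fun x => Function.ne_iff.1 (hr0 x)
  have he : ∀ x y : T, x ≠ y → eval y.1.rep (e x) = 0 := fun x y hxy =>
    hc0 x y y.2 fun h => hxy (Subtype.ext h)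
  let u : T → homVec m (m * n) := fun x => ⟨Pi.single (s x) (e x), mem_homVec.2 fun t => by
    by_cases ht : t = s x
    · subst ht
      rw [Pi.single_eq_same]
      simpa [hcard] using hc2 x
    · rw [Pi.single_eq_of_ne ht]
      exact isHomogeneous_zero _ _ _⟩
  have hli : LinearIndependent ℂ fun x => gradedMap A p 0 (m * n) (u x) := by
    rw [Fintype.linearIndependent_iff]
    intro g hg y
    have h1 : ((∑ x, g x • u x : homVec m (m * n)) : Fin m → Poly3) ∈ relations A p 0 := by
      rw [← gradedMap_eq_zero, map_sum, ← hg]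
      simp only [map_smul]
    have h2 := hr y p 0 (hT y.2).2 (map_zero _) _ h1
    have h3 : (fun t => eval y.1.rep (((∑ x, g x • u x : homVec m (m * n)) : Fin m → Poly3) t)) =
        Pi.single (s y) (g y * eval y.1.rep (e y)) := by
      funext t
      simp only [AddSubmonoidClass.coe_finsetSum, Submodule.coe_smul, Finset.sum_apply,
        Pi.smul_apply, map_sum, smul_eval]
      rw [Finset.sum_eq_single y]
      · by_cases ht : t = s y
        · subst ht
          simp [u]
        · simp [u, Pi.single_eq_of_ne ht]
      · intro x _ hxy
        by_cases ht : t = s x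
        · subst ht
          simp [u, he x y hxy]
        · simp [u, Pi.single_eq_of_ne ht]
      · simp
    rw [h3, dotProduct_single] at h2
    exact ((mul_eq_zero.1 ((mul_eq_zero.1 h2).resolve_left (hs y)))).resolve_right (hc1 y)
  have hli' : LinearIndependent ℂ fun x => (gradedMap A p 0 (m * n)).rangeRestrict (u x) :=
    LinearIndependent.of_comp (LinearMap.range (gradedMap A p 0 (m * n))).subtype hli
  have h4 := hli'.fintype_card_le_finrank
  have h5 := gradedDim_single hA hprime hp hpd (k := m * n) (by nlinarith)
  rw [gradedDim] at h5
  rw [h5, Fintype.card_coe, hcard] at h4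
  omega

theorem exists_linForm_regular (hdet : A.det.IsHomogeneous m) (hA : ∀ i j, (A i j).IsHomogeneous 1)
    (hprime : Prime A.det)
    {n : ℕ} {p : Poly3} (hp : p.IsHomogeneous n) (hpd : ¬ A.det ∣ p) :
    ∃ c : Fin 3 → ℂ, c ≠ 0 ∧
      ∀ x, eval x A.det = 0 → eval x p = 0 → ∑ l, c l * x l = 0 → x = 0 := by
  have hfin := finite_zeros hA hprime hp hpd
  have := hfin.to_subtype
  let Z := {x : ℙ ℂ (Fin 3 → ℂ) | eval x.rep A.det = 0 ∧ eval x.rep p = 0}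
  -- The additional vector indexed by `none` makes the functional nonzero even if there are no zeros
  -- to avoid.
  obtain ⟨f, hf⟩ := Module.exists_dual_forall_apply_ne_zero (K := ℂ)
    (fun o : Option Z => o.elim (Pi.single (0 : Fin 3) (1 : ℂ)) fun x => x.1.rep) (by
      rintro (_ | x)
      · exact fun h => one_ne_zero (α := ℂ) (by simpa using congrFun h 0)
      · exact x.1.rep_nonzero)
  have hc : ∀ x : Fin 3 → ℂ, ∑ l, f (Pi.single l 1) * x l = f x := fun x => by
    rw [← eval_linForm_dual f x, eval_linForm]
  refine ⟨fun l => f (Pi.single l 1), fun h => hf none (congrFun h 0), fun x h1 h2 h3 => ?_⟩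
  by_contra hx
  rw [hc] at h3
  have hmem : Projectivization.mk ℂ x hx ∈ Z :=
    ⟨(hdet.eval_rep_eq_zero_iff hx).2 h1, (hp.eval_rep_eq_zero_iff hx).2 h2⟩
  refine hf (some ⟨_, hmem⟩) ?_
  obtain ⟨a, ha⟩ := Projectivization.exists_smul_eq_mk_rep ℂ x hx
  change f (Projectivization.mk ℂ x hx).rep = 0
  rw [← ha, Units.smul_def, map_smul, h3, smul_zero]

theorem relations_regular_of_forall {n : ℕ} (hn : 1 ≤ n) (hprime : Prime A.det) {p : Poly3}
    (hp : p.IsHomogeneous n) {c : Fin 3 → ℂ} (hc0 : c ≠ 0)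
    (hc : ∀ x, eval x A.det = 0 → eval x p = 0 → ∑ l, c l * x l = 0 → x = 0)
    (u : Fin m → Poly3) (hu : linForm c • u ∈ relations A p 0) : u ∈ relations A p 0 := by
  obtain ⟨a, b, h⟩ := mem_relations_single.1 hu
  have hp0 : eval 0 p = 0 := by
    rw [← zero_smul ℂ (0 : Fin 3 → ℂ), hp.eval_smul_point, zero_pow (by omega), zero_mul]
  exact mem_relations_single.2 (exists_of_linForm_smul_eq A hprime p hp0 c hc hc0 u a b h)

end zeros

theorem curvePoly_isHomogeneous {m : ℕ} (D : Fin 3 → Matrix (Fin m) (Fin m) ℂ) :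
    (curvePoly D).IsHomogeneous m := by
  rw [curvePoly, Matrix.det_apply]
  refine IsHomogeneous.sum _ _ _ fun σ _ => ?_
  have h : (∏ i, pencil D (σ i) i).IsHomogeneous m := by
    have := IsHomogeneous.prod Finset.univ (fun i => pencil D (σ i) i) (fun _ => 1)
      fun i _ => pencil_isHomogeneous D _ _
    simpa using this
  rcases Int.units_eq_one_or (Equiv.Perm.sign σ) with h1 | h1
  · rwa [h1, one_smul]
  · rw [h1, Units.neg_smul, one_smul]
    exact (homogeneousSubmodule (Fin 3) ℂ m).neg_mem h

/-! ### The local rings of the curve -/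

section localRing

variable {Δ : Poly3} {v : Fin 3 → ℂ}

theorem mem_pointIdeal {f : Poly3} : f ∈ pointIdeal v ↔ eval v f = 0 := Iff.rfl

theorem eval_chartEq (x : Fin 3 → ℂ) :
    eval x (chartEq v) = ∑ l, star (v l) * (x l - v l) := by
  simp [chartEq]

theorem eval_chartEq_self : eval v (chartEq v) = 0 := by
  simp [eval_chartEq]

theorem isUnit_germ {s : Poly3} (hs : eval v s ≠ 0) : IsUnit (germ Δ v s) := by
  have : IsUnit (algebraMap Poly3 (SpaceLocalRing v) s) :=
    IsLocalization.map_units (SpaceLocalRing v) (⟨s, hs⟩ : (pointIdeal v).primeCompl)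
  exact this.map (Ideal.Quotient.mk _)

theorem exists_germ_mul_eq (z : CurveLocalRing Δ v) :
    ∃ s f : Poly3, eval v s ≠ 0 ∧ germ Δ v s * z = germ Δ v f := by
  obtain ⟨y, rfl⟩ := Ideal.Quotient.mk_surjective z
  obtain ⟨⟨f, s⟩, h⟩ := IsLocalization.surj (pointIdeal v).primeCompl y
  refine ⟨s, f, s.2, ?_⟩
  have h' : algebraMap Poly3 (SpaceLocalRing v) s * y = algebraMap Poly3 (SpaceLocalRing v) f := by
    rw [mul_comm]
    exact h
  exact congrArg (Ideal.Quotient.mk (Ideal.span {algebraMap Poly3 (SpaceLocalRing v) Δ,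
    algebraMap Poly3 (SpaceLocalRing v) (chartEq v)})) h'

theorem germ_eq_zero_iff {f : Poly3} :
    germ Δ v f = 0 ↔ ∃ s a b : Poly3, eval v s ≠ 0 ∧ s * f = a * Δ + b * chartEq v := by
  constructor
  · intro h
    have h1 : algebraMap Poly3 (SpaceLocalRing v) f ∈
        Ideal.span {algebraMap Poly3 (SpaceLocalRing v) Δ,
          algebraMap Poly3 (SpaceLocalRing v) (chartEq v)} := Ideal.Quotient.eq_zero_iff_mem.1 h
    obtain ⟨y, z, hyz⟩ := Ideal.mem_span_pair.1 h1
    obtain ⟨⟨a, s⟩, ha⟩ := IsLocalization.surj (pointIdeal v).primeCompl y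
    obtain ⟨⟨b, t⟩, hb⟩ := IsLocalization.surj (pointIdeal v).primeCompl z
    have h2 : algebraMap Poly3 (SpaceLocalRing v) (s * t * f) =
        algebraMap Poly3 (SpaceLocalRing v) (t * a * Δ + s * b * chartEq v) := by
      simp only [map_mul, map_add] at ha hb ⊢
      rw [← hyz, ← ha, ← hb]
      ring
    obtain ⟨c, hc⟩ := (IsLocalization.eq_iff_exists (pointIdeal v).primeCompl _).1 h2
    refine ⟨c * (s * t), c * (t * a), c * (s * b), ?_, ?_⟩
    · rw [map_mul, map_mul]
      exact mul_ne_zero c.2 (mul_ne_zero s.2 t.2)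
    · linear_combination hc
  · rintro ⟨s, a, b, hs, h⟩
    have h1 : germ Δ v Δ = 0 :=
      Ideal.Quotient.eq_zero_iff_mem.2 (Ideal.subset_span (Set.mem_insert _ _))
    have h2 : germ Δ v (chartEq v) = 0 :=
      Ideal.Quotient.eq_zero_iff_mem.2
        (Ideal.subset_span (Set.mem_insert_of_mem _ (Set.mem_singleton _)))
    have h3 := congrArg (germ Δ v) h
    rw [map_mul, map_add, map_mul, map_mul, h1, h2, mul_zero, mul_zero, add_zero] at h3
    exact (isUnit_germ hs).mul_right_eq_zero.1 h3

theorem germ_curve : germ Δ v Δ = 0 :=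
  germ_eq_zero_iff.2 ⟨1, 1, 0, by simp, by ring⟩

theorem germ_chartEq : germ Δ v (chartEq v) = 0 :=
  germ_eq_zero_iff.2 ⟨1, 0, 1, by simp, by ring⟩

theorem curveLocalRing_nontrivial (hv : eval v Δ = 0) : Nontrivial (CurveLocalRing Δ v) := by
  refine ⟨⟨germ Δ v 1, 0, fun h => ?_⟩⟩
  obtain ⟨s, a, b, hs, h⟩ := germ_eq_zero_iff.1 h
  have := congrArg (eval v) h
  simp only [mul_one, map_add, map_mul, hv, eval_chartEq_self, mul_zero, add_zero] at this
  exact hs this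

theorem isUnit_germ_iff (hv : eval v Δ = 0) {f : Poly3} :
    IsUnit (germ Δ v f) ↔ eval v f ≠ 0 := by
  refine ⟨fun h h0 => ?_, isUnit_germ⟩
  obtain ⟨z, hz⟩ := h.exists_right_inv
  obtain ⟨s, g, hs, hg⟩ := exists_germ_mul_eq z
  have h1 : germ Δ v (f * g - s) = 0 := by
    rw [map_sub, map_mul, ← hg]
    linear_combination germ Δ v s * hz
  obtain ⟨t, a, b, ht, h2⟩ := germ_eq_zero_iff.1 h1
  have := congrArg (eval v) h2
  simp only [map_add, map_sub, map_mul, hv, eval_chartEq_self, mul_zero, add_zero, h0, zero_mul,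
    zero_sub, mul_neg, neg_eq_zero] at this
  exact mul_ne_zero ht hs this

theorem curveLocalRing_isLocalRing (hv : eval v Δ = 0) : IsLocalRing (CurveLocalRing Δ v) := by
  have := curveLocalRing_nontrivial hv
  exact IsLocalRing.of_surjective' (Ideal.Quotient.mk (Ideal.span
    {algebraMap Poly3 (SpaceLocalRing v) Δ, algebraMap Poly3 (SpaceLocalRing v) (chartEq v)}) :
      SpaceLocalRing v →+* CurveLocalRing Δ v) Ideal.Quotient.mk_surjective

instance : IsNoetherianRing (CurveLocalRing Δ v) :=
  inferInstanceAs (IsNoetherianRing (SpaceLocalRing v ⧸ Ideal.span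
    {algebraMap Poly3 (SpaceLocalRing v) Δ, algebraMap Poly3 (SpaceLocalRing v) (chartEq v)}))

instance : Algebra ℂ (CurveLocalRing Δ v) := ((germ Δ v).comp C).toAlgebra

theorem algebraMap_curveLocalRing (c : ℂ) :
    algebraMap ℂ (CurveLocalRing Δ v) c = germ Δ v (C c) := rfl

theorem germ_smul (c : ℂ) (f : Poly3) : germ Δ v (c • f) = c • germ Δ v f := by
  rw [smul_eq_C_mul, map_mul]
  rfl

theorem germ_mem_maximalIdeal [IsLocalRing (CurveLocalRing Δ v)] (hv : eval v Δ = 0) {f : Poly3} :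
    germ Δ v f ∈ IsLocalRing.maximalIdeal (CurveLocalRing Δ v) ↔ eval v f = 0 := by
  rw [IsLocalRing.mem_maximalIdeal, mem_nonunits_iff, isUnit_germ_iff hv, not_not]

theorem exists_sub_algebraMap_mem [IsLocalRing (CurveLocalRing Δ v)] (hv : eval v Δ = 0)
    (z : CurveLocalRing Δ v) :
    ∃ c : ℂ, z - algebraMap ℂ _ c ∈ IsLocalRing.maximalIdeal (CurveLocalRing Δ v) := by
  obtain ⟨s, f, hs, h⟩ := exists_germ_mul_eq z
  refine ⟨eval v f / eval v s, ?_⟩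
  have h1 : germ Δ v s * (z - algebraMap ℂ _ (eval v f / eval v s)) =
      germ Δ v (f - s * C (eval v f / eval v s)) := by
    rw [mul_sub, h, map_sub, map_mul, algebraMap_curveLocalRing]
  have h2 : germ Δ v (f - s * C (eval v f / eval v s)) ∈
      IsLocalRing.maximalIdeal (CurveLocalRing Δ v) := by
    rw [germ_mem_maximalIdeal hv, map_sub, map_mul, eval_C, mul_div_cancel₀ _ hs, sub_self]
  rw [← h1] at h2
  exact (Ideal.unit_mul_mem_iff_mem _ (isUnit_germ hs)).1 h2

/-- The residue field of the local ring is ℂ, so every composition factor contributes one complex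
dimension. -/
theorem length_curveLocalRing_eq (hv : eval v Δ = 0) (M : Type*) [AddCommGroup M]
    [Module (CurveLocalRing Δ v) M] [Module ℂ M] [IsScalarTower ℂ (CurveLocalRing Δ v) M] :
    Module.length (CurveLocalRing Δ v) M = Module.length ℂ M := by
  have := curveLocalRing_isLocalRing hv
  rw [IsLocalRing.length_restrictScalars ℂ (CurveLocalRing Δ v) M]
  have h : Function.Surjective (algebraMap (IsLocalRing.ResidueField ℂ)
      (IsLocalRing.ResidueField (CurveLocalRing Δ v))) := by
    intro z
    obtain ⟨y, rfl⟩ := IsLocalRing.residue_surjective z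
    obtain ⟨c, hc⟩ := exists_sub_algebraMap_mem hv y
    refine ⟨IsLocalRing.residue ℂ c, ?_⟩
    rw [IsLocalRing.ResidueField.algebraMap_residue]
    symm
    rw [← sub_eq_zero, ← map_sub]
    exact (IsLocalRing.residue_eq_zero_iff _).2 hc
  have h1 : Module.length (IsLocalRing.ResidueField ℂ)
      (IsLocalRing.ResidueField (CurveLocalRing Δ v)) = 1 := by
    rw [Module.length_eq_of_surjective (M := IsLocalRing.ResidueField (CurveLocalRing Δ v)) h]
    exact Module.length_eq_one (R := IsLocalRing.ResidueField (CurveLocalRing Δ v))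
      (M := IsLocalRing.ResidueField (CurveLocalRing Δ v))
  rw [h1, mul_one]

theorem exists_germ_smul_eq {ι : Type*} [Fintype ι] (z : ι → CurveLocalRing Δ v) :
    ∃ (s : Poly3) (f : ι → Poly3), eval v s ≠ 0 ∧ germ Δ v s • z = fun i => germ Δ v (f i) := by
  classical
  choose s f hs h using fun i => exists_germ_mul_eq (z i)
  refine ⟨∏ i, s i, fun i => (∏ j ∈ Finset.univ.erase i, s j) * f i, ?_, ?_⟩
  · rw [map_prod]
    exact Finset.prod_ne_zero_iff.2 fun i _ => hs i
  · funext i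
    rw [Pi.smul_apply, smul_eq_mul, map_mul, ← h i, ← mul_assoc, ← map_mul,
      Finset.prod_erase_mul _ _ (Finset.mem_univ i)]

end localRing

/-! ### The stalks of the cokernel modulo `p` and `q` -/

section stalk

variable {m : ℕ} (D : Fin 3 → Matrix (Fin m) (Fin m) ℂ) (p q : Poly3) (v : Fin 3 → ℂ)

/-- The stalk at `[v]` of the cokernel modulo `p` and `q`. -/
abbrev MultStalk : Type :=
  CokerStalk D v ⧸ (Ideal.span {germ (curvePoly D) v p, germ (curvePoly D) v q} •
    (⊤ : Submodule (CurveLocalRing (curvePoly D) v) (CokerStalk D v)))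

/-- The germ of a vector of polynomials in the stalk modulo `p` and `q`. -/
def stalkMap : (Fin m → Poly3) →ₛₗ[germ (curvePoly D) v] MultStalk D p q v where
  toFun u := Submodule.Quotient.mk (Submodule.Quotient.mk fun s => germ (curvePoly D) v (u s))
  map_add' u w := by
    rw [← Submodule.Quotient.mk_add, ← Submodule.Quotient.mk_add]
    congr 2
    funext s
    exact map_add _ _ _
  map_smul' f u := by
    rw [← Submodule.Quotient.mk_smul, ← Submodule.Quotient.mk_smul]
    congr 2
    funext s
    exact map_mul _ _ _

theorem mem_span_pair_smul_top {R M : Type*} [CommRing R] [AddCommGroup M] [Module R M] {a b : R}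
    {x : M} : x ∈ Ideal.span {a, b} • (⊤ : Submodule R M) ↔ ∃ y z, x = a • y + b • z := by
  rw [Ideal.span_insert, Submodule.sup_smul, Submodule.ideal_span_singleton_smul,
    Submodule.ideal_span_singleton_smul, Submodule.mem_sup]
  constructor
  · rintro ⟨_, ⟨y, -, rfl⟩, _, ⟨z, -, rfl⟩, rfl⟩
    exact ⟨y, z, rfl⟩
  · rintro ⟨y, z, rfl⟩
    exact ⟨_, ⟨y, trivial, rfl⟩, _, ⟨z, trivial, rfl⟩, rfl⟩

variable {D p q v}

theorem map_germ_mulVec (a : Fin m → Poly3) :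
    (fun s => germ (curvePoly D) v ((pencil D).mulVec a s)) =
      ((pencil D).map (germ (curvePoly D) v)).mulVec fun s => germ (curvePoly D) v (a s) := by
  funext s
  simp [Matrix.mulVec, dotProduct]

theorem mk_germ_eq_zero_iff (z : Fin m → CurveLocalRing (curvePoly D) v) :
    (Submodule.Quotient.mk (Submodule.Quotient.mk z : CokerStalk D v) : MultStalk D p q v) = 0 ↔
      ∃ a b c, z = ((pencil D).map (germ (curvePoly D) v)).mulVec a +
        germ (curvePoly D) v p • b + germ (curvePoly D) v q • c := by
  rw [Submodule.Quotient.mk_eq_zero, mem_span_pair_smul_top]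
  constructor
  · rintro ⟨y, w, h⟩
    obtain ⟨b, rfl⟩ := Submodule.Quotient.mk_surjective _ y
    obtain ⟨c, rfl⟩ := Submodule.Quotient.mk_surjective _ w
    rw [← Submodule.Quotient.mk_smul, ← Submodule.Quotient.mk_smul, ← Submodule.Quotient.mk_add,
      Submodule.Quotient.eq] at h
    obtain ⟨a, ha⟩ := h
    refine ⟨a, b, c, ?_⟩
    rw [Matrix.mulVecLin_apply] at ha
    rw [ha]
    module
  · rintro ⟨a, b, c, rfl⟩
    refine ⟨Submodule.Quotient.mk b, Submodule.Quotient.mk c, ?_⟩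
    rw [← Submodule.Quotient.mk_smul, ← Submodule.Quotient.mk_smul, ← Submodule.Quotient.mk_add,
      Submodule.Quotient.eq]
    exact ⟨a, by rw [Matrix.mulVecLin_apply]; module⟩

theorem stalkMap_eq_zero_of_mem {u : Fin m → Poly3} (hu : u ∈ relations (pencil D) p q) :
    stalkMap D p q v u = 0 := by
  obtain ⟨a, b, c, rfl⟩ := hu
  refine (mk_germ_eq_zero_iff _).2 ⟨fun s => germ _ v (a s), fun s => germ _ v (b s),
    fun s => germ _ v (c s), ?_⟩
  rw [← map_germ_mulVec]
  funext s
  simp only [Pi.add_apply, Pi.smul_apply, smul_eq_mul, map_add, map_mul]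

/-- Clear all denominators. What remains is a combination of Δ and of the chart equation in every
coordinate, and multiples of Δ are relations because the determinant annihilates the cokernel. -/
theorem exists_of_stalkMap_eq_zero {u : Fin m → Poly3} (hu : stalkMap D p q v u = 0) :
    ∃ s d, eval v s ≠ 0 ∧ s • u - chartEq v • d ∈ relations (pencil D) p q := by
  obtain ⟨a, b, c, h⟩ := (mk_germ_eq_zero_iff _).1 hu
  obtain ⟨s, f, hs, hf⟩ := exists_germ_smul_eq
    (fun x : Fin m ⊕ Fin m ⊕ Fin m => Sum.elim a (Sum.elim b c) x)
  let a' : Fin m → Poly3 := fun i => f (Sum.inl i)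
  let b' : Fin m → Poly3 := fun i => f (Sum.inr (Sum.inl i))
  let c' : Fin m → Poly3 := fun i => f (Sum.inr (Sum.inr i))
  have ha : germ (curvePoly D) v s • a = fun i => germ (curvePoly D) v (a' i) :=
    funext fun i => congrFun hf (Sum.inl i)
  have hb : germ (curvePoly D) v s • b = fun i => germ (curvePoly D) v (b' i) :=
    funext fun i => congrFun hf (Sum.inr (Sum.inl i))
  have hc : germ (curvePoly D) v s • c = fun i => germ (curvePoly D) v (c' i) :=
    funext fun i => congrFun hf (Sum.inr (Sum.inr i))
  let w : Fin m → Poly3 := s • u - ((pencil D).mulVec a' + p • b' + q • c')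
  have hw : ∀ i, germ (curvePoly D) v (w i) = 0 := by
    intro i
    have h1 := congrFun (congrArg (fun z => germ (curvePoly D) v s • z) h) i
    simp only [smul_add, smul_comm (germ (curvePoly D) v s), ← Matrix.mulVec_smul, ha, hb, hc,
      ← map_germ_mulVec] at h1
    simp only [Pi.add_apply, Pi.smul_apply, smul_eq_mul] at h1
    simp only [w, Pi.sub_apply, Pi.add_apply, Pi.smul_apply, smul_eq_mul, map_sub, map_add, map_mul,
      h1, sub_self]
  choose t α β ht hαβ using fun i => germ_eq_zero_iff.1 (hw i)
  classical
  let e : Fin m → Poly3 := fun i => ∏ j ∈ Finset.univ.erase i, t j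
  have he : ∀ i, ∏ j, t j = e i * t i := fun i =>
    (Finset.prod_erase_mul _ _ (Finset.mem_univ i)).symm
  refine ⟨(∏ j, t j) * s, fun i => e i * β i, ?_, ?_⟩
  · rw [map_mul, map_prod]
    exact mul_ne_zero (Finset.prod_ne_zero_iff.2 fun i _ => ht i) hs
  · have h2 : ((∏ j, t j) * s) • u - chartEq v • (fun i => e i * β i) =
        (∏ j, t j) • ((pencil D).mulVec a' + p • b' + q • c') +
          (pencil D).det • (fun i => e i * α i) := by
      funext i
      have h3 := hαβ i
      simp only [w, Pi.sub_apply, Pi.smul_apply, smul_eq_mul] at h3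
      simp only [Pi.sub_apply, Pi.add_apply, Pi.smul_apply, smul_eq_mul, he i] at h3 ⊢
      rw [curvePoly] at h3
      linear_combination e i * h3
    rw [h2]
    exact add_mem (Submodule.smul_mem _ _ ⟨a', b', c', rfl⟩) (det_smul_mem_relations _ _ _ _)

theorem exists_germ_smul_eq_stalkMap (z : MultStalk D p q v) :
    ∃ s u, eval v s ≠ 0 ∧ germ (curvePoly D) v s • z = stalkMap D p q v u := by
  obtain ⟨y, rfl⟩ := Submodule.Quotient.mk_surjective _ z
  obtain ⟨y, rfl⟩ := Submodule.Quotient.mk_surjective _ y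
  obtain ⟨s, u, hs, h⟩ := exists_germ_smul_eq y
  refine ⟨s, u, hs, ?_⟩
  rw [← Submodule.Quotient.mk_smul, ← Submodule.Quotient.mk_smul, h]
  rfl

end stalk

/-! ### The dimension as a sum of local multiplicities -/

/-- The linear form, equal to `1` at `v`, whose dehomogenization in the chart around `[v]`
is `1`. -/
def chartForm (v : Fin 3 → ℂ) : Poly3 :=
  linForm fun l => star (v l) / ∑ j, star (v j) * v j

open scoped ComplexOrder in
theorem sum_star_mul_self_ne_zero {v : Fin 3 → ℂ} (hv : v ≠ 0) : ∑ j, star (v j) * v j ≠ 0 :=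
  (dotProduct_star_self_eq_zero (v := v)).not.2 hv

theorem eval_chartForm {v : Fin 3 → ℂ} (hv : v ≠ 0) : eval v (chartForm v) = 1 := by
  rw [chartForm, eval_linForm]
  simp only [div_mul_eq_mul_div]
  rw [← Finset.sum_div]
  exact div_self (sum_star_mul_self_ne_zero hv)

theorem chartForm_isHomogeneous (v : Fin 3 → ℂ) : (chartForm v).IsHomogeneous 1 :=
  linForm_isHomogeneous _

theorem chartEq_eq {v : Fin 3 → ℂ} (hv : v ≠ 0) :
    chartEq v = C (∑ j, star (v j) * v j) * (chartForm v - 1) := by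
  have h := sum_star_mul_self_ne_zero hv
  refine funext fun x => ?_
  rw [eval_chartEq, map_mul, map_sub, chartForm, eval_linForm, eval_C, map_one]
  simp only [div_mul_eq_mul_div]
  rw [← Finset.sum_div, mul_sub, mul_div_cancel₀ _ h, mul_one, ← Finset.sum_sub_distrib]
  exact Finset.sum_congr rfl fun l _ => mul_sub _ _ _

theorem germ_chartForm {Δ : Poly3} {v : Fin 3 → ℂ} (hv : v ≠ 0) :
    germ Δ v (chartForm v) = 1 := by
  have h : germ Δ v (chartEq v) = 0 := germ_chartEq
  rw [chartEq_eq hv, map_mul, map_sub, map_one] at h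
  have hu : IsUnit (germ Δ v (C (∑ j, star (v j) * v j))) :=
    isUnit_germ (by rw [eval_C]; exact sum_star_mul_self_ne_zero hv)
  exact sub_eq_zero.1 (hu.mul_right_eq_zero.1 h)

section stalkLin

variable {m : ℕ} (D : Fin 3 → Matrix (Fin m) (Fin m) ℂ) (p q : Poly3) (v : Fin 3 → ℂ)

/-- The germ of a vector of polynomials in the stalk modulo `p` and `q`, as a complex linear
map. -/
def stalkLin : (Fin m → Poly3) →ₗ[ℂ] MultStalk D p q v where
  toFun := stalkMap D p q v
  map_add' := map_add _
  map_smul' c u := by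
    have h : c • u = (C c : Poly3) • u := funext fun s => smul_eq_C_mul _ _
    rw [h, LinearMap.map_smulₛₗ, ← algebraMap_curveLocalRing, algebraMap_smul, RingHom.id_apply]

theorem stalkLin_apply (u : Fin m → Poly3) : stalkLin D p q v u = stalkMap D p q v u := rfl

variable {D p q v}

theorem stalkMap_chartForm_pow_smul (hv : v ≠ 0) (j : ℕ) (u : Fin m → Poly3) :
    stalkMap D p q v (chartForm v ^ j • u) = stalkMap D p q v u := by
  rw [LinearMap.map_smulₛₗ, map_pow, germ_chartForm hv, one_pow, one_smul]

/-- The chart form has germ 1, so multiplying by its powers raises the degree without changing the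
germ. -/
theorem map_stalkLin_homVec_mono (hv : v ≠ 0) :
    Monotone fun k => (homVec m k).map (stalkLin D p q v) := by
  intro k l hkl
  rintro _ ⟨u, hu, rfl⟩
  refine ⟨chartForm v ^ (l - k) • u, ?_, stalkMap_chartForm_pow_smul hv _ _⟩
  have := smul_mem_homVec ((chartForm_isHomogeneous v).pow (l - k)) hu
  rwa [one_mul, Nat.sub_add_cancel hkl] at this

theorem finrank_map_stalkLin_le (k : ℕ) :
    Module.finrank ℂ ((homVec m k).map (stalkLin D p q v)) ≤ gradedDim (pencil D) p q k := by
  have h1 : (homVec m k).map (stalkLin D p q v) =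
      LinearMap.range (stalkLin D p q v ∘ₗ (homVec m k).subtype) := by
    rw [LinearMap.range_comp, Submodule.range_subtype]
  have h2 : LinearMap.ker (gradedMap (pencil D) p q k) ≤
      LinearMap.ker (stalkLin D p q v ∘ₗ (homVec m k).subtype) := by
    intro u hu
    exact stalkMap_eq_zero_of_mem ((gradedMap_eq_zero u).1 hu)
  have h3 := Submodule.finrank_mono h2
  have e1 := LinearMap.finrank_range_add_finrank_ker (gradedMap (pencil D) p q k)
  have e2 := LinearMap.finrank_range_add_finrank_ker (stalkLin D p q v ∘ₗ (homVec m k).subtype)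
  rw [h1, gradedDim]
  omega

/-- If the graded dimensions are bounded, the stalk consists of germs of vectors of forms of a
given large degree. -/
theorem exists_homVec_stalkMap_eq (hv : v ≠ 0) {d k₀ : ℕ}
    (hd : ∀ k, k₀ ≤ k → gradedDim (pencil D) p q k ≤ d) :
    ∃ K, ∀ k, K ≤ k → ∀ z : MultStalk D p q v, ∃ u ∈ homVec m k, stalkMap D p q v u = z := by
  let G : ℕ → Submodule ℂ (MultStalk D p q v) := fun k => (homVec m k).map (stalkLin D p q v)
  have hmono : Monotone G := map_stalkLin_homVec_mono hv
  have hfd : ∀ k, FiniteDimensional ℂ (G k) := fun k => inferInstance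
  have hbd : ∀ k, Module.finrank ℂ (G k) ≤ d := fun k =>
    (Submodule.finrank_mono (hmono (le_max_left k k₀))).trans
      ((finrank_map_stalkLin_le _).trans (hd _ (le_max_right k k₀)))
  -- The increasing spaces of germs have bounded dimension, so they stop growing; the final one
  -- contains the germs of all polynomial vectors.
  obtain ⟨K, hK⟩ : ∃ K, ∀ k, Module.finrank ℂ (G k) ≤ Module.finrank ℂ (G K) := by
    have hfin : (Set.range fun k => Module.finrank ℂ (G k)).Finite :=
      (Set.finite_Iic d).subset (by rintro _ ⟨k, rfl⟩; exact hbd k)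
    obtain ⟨_, ⟨K, rfl⟩, hK⟩ := Set.exists_max_image _ id hfin ⟨_, ⟨0, rfl⟩⟩
    exact ⟨K, fun k => hK _ ⟨k, rfl⟩⟩
  have hG : ∀ u, stalkMap D p q v u ∈ G K := by
    intro u
    obtain ⟨N, -, hN⟩ := exists_sum_compVec m u
    have hle : G (max N K) = G K :=
      (Submodule.eq_of_le_of_finrank_le (hmono (le_max_right _ _)) (hK _)).symm
    rw [← hle, hN N le_rfl, map_sum]
    refine Submodule.sum_mem _ fun t ht => ?_
    exact hmono ((Finset.mem_range.1 ht).le.trans (le_max_left N K))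
      ⟨_, compVec_mem m t u, rfl⟩
  -- Denominators are harmless: multiplication by a unit germ is an injective endomorphism of a
  -- finite-dimensional space, hence surjective.
  have hall : ∀ z : MultStalk D p q v, z ∈ G K := by
    intro z
    obtain ⟨s, u, hs, h⟩ := exists_germ_smul_eq_stalkMap z
    have hunit : IsUnit (germ (curvePoly D) v s) := isUnit_germ hs
    let f : G K →ₗ[ℂ] G K :=
      { toFun := fun y => ⟨germ (curvePoly D) v s • (y : MultStalk D p q v), by
          obtain ⟨w, -, hw⟩ := y.2
          rw [← hw, stalkLin_apply, ← LinearMap.map_smulₛₗ]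
          exact hG _⟩
        map_add' := fun y w => Subtype.ext (smul_add _ _ _)
        map_smul' := fun c y => Subtype.ext (smul_comm _ _ _) }
    have hinj : Function.Injective f := by
      intro y w hyw
      exact Subtype.ext (hunit.smul_left_cancel.1 (congrArg Subtype.val hyw))
    obtain ⟨y, hy⟩ := (LinearMap.injective_iff_surjective.1 hinj) ⟨_, hG u⟩
    have : (y : MultStalk D p q v) = z :=
      hunit.smul_left_cancel.1 ((congrArg Subtype.val hy).trans h.symm)
    rw [← this]
    exact y.2
  exact ⟨K, fun k hk z => hmono hk (hall z)⟩

theorem finite_multStalk_of_exists {k : ℕ}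
    (h : ∀ z : MultStalk D p q v, ∃ u ∈ homVec m k, stalkMap D p q v u = z) :
    FiniteDimensional ℂ (MultStalk D p q v) :=
  Module.Finite.of_surjective (stalkLin D p q v ∘ₗ (homVec m k).subtype) fun z => by
    obtain ⟨u, hu, hz⟩ := h z
    exact ⟨⟨u, hu⟩, hz⟩

/-- The descending powers of the germ times the stalk stabilize by finite dimension, and by Nakayama
the stable value is zero. -/
theorem exists_germ_pow_smul_eq_zero (hv : eval v (curvePoly D) = 0)
    [FiniteDimensional ℂ (MultStalk D p q v)] {e : Poly3} (he : eval v e = 0) :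
    ∃ J, ∀ j, J ≤ j → ∀ z : MultStalk D p q v, germ (curvePoly D) v e ^ j • z = 0 := by
  have := curveLocalRing_isLocalRing hv
  have : IsArtinian (CurveLocalRing (curvePoly D) v) (MultStalk D p q v) :=
    isArtinian_of_tower ℂ inferInstance
  have : Module.Finite (CurveLocalRing (curvePoly D) v) (MultStalk D p q v) := inferInstance
  let I : Ideal (CurveLocalRing (curvePoly D) v) := Ideal.span {germ (curvePoly D) v e}
  let f : ℕ →o (Submodule (CurveLocalRing (curvePoly D) v) (MultStalk D p q v))ᵒᵈ :=
    ⟨fun j => OrderDual.toDual (I ^ j • ⊤), fun i j hij =>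
      Submodule.smul_mono_left (Ideal.pow_le_pow_right hij)⟩
  obtain ⟨J, hJ⟩ := IsArtinian.monotone_stabilizes f
  have h0 : I ^ J • (⊤ : Submodule (CurveLocalRing (curvePoly D) v) (MultStalk D p q v)) = ⊥ := by
    refine Submodule.eq_bot_of_le_smul_of_le_jacobson_bot I _ (IsNoetherian.noetherian _) ?_ ?_
    · rw [← mul_smul, ← pow_succ']
      exact (congrArg OrderDual.ofDual (hJ (J + 1) (Nat.le_succ J))).le
    · rw [IsLocalRing.jacobson_eq_maximalIdeal _ bot_ne_top, Ideal.span_singleton_le_iff_mem]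
      exact (germ_mem_maximalIdeal hv).2 he
  refine ⟨J, fun j hj z => ?_⟩
  have h1 : germ (curvePoly D) v e ^ j • z ∈
      I ^ J • (⊤ : Submodule (CurveLocalRing (curvePoly D) v) (MultStalk D p q v)) :=
    Submodule.smul_mem_smul (Ideal.pow_le_pow_right hj
      (Ideal.pow_mem_pow (Ideal.mem_span_singleton_self _) j)) trivial
  rwa [h0, Submodule.mem_bot] at h1

/-- Vectors of forms of large degree with prescribed germs at finitely many points. -/
theorem exists_homVec_forall_stalkMap_eq (T : Finset (ℙ ℂ (Fin 3 → ℂ)))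
    (hT : ∀ x ∈ T, eval x.rep (curvePoly D) = 0) {d k₀ : ℕ}
    (hd : ∀ k, k₀ ≤ k → gradedDim (pencil D) p q k ≤ d) :
    ∃ K, ∀ k, K ≤ k → ∀ z : ∀ x : ℙ ℂ (Fin 3 → ℂ), MultStalk D p q x.rep,
      ∃ u ∈ homVec m k, ∀ x ∈ T, stalkMap D p q x.rep u = z x := by
  classical
  choose K hK using fun x : ℙ ℂ (Fin 3 → ℂ) => exists_homVec_stalkMap_eq x.rep_nonzero hd
  have hfd : ∀ x : ℙ ℂ (Fin 3 → ℂ), FiniteDimensional ℂ (MultStalk D p q x.rep) :=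
    fun x => finite_multStalk_of_exists (hK x _ le_rfl)
  have he : ∀ x, ∃ e : Poly3, x ∈ T → e.IsHomogeneous (T.card - 1) ∧ eval x.rep e ≠ 0 ∧
      ∀ y ∈ T, x ≠ y → eval y.rep e = 0 := by
    intro x
    by_cases hx : x ∈ T
    · obtain ⟨e, he⟩ := exists_separating_form T x hx
      exact ⟨e, fun _ => he⟩
    · exact ⟨0, fun h => absurd h hx⟩
  choose e he using he
  have hJ : ∀ x y : ℙ ℂ (Fin 3 → ℂ), ∃ J, x ∈ T → y ∈ T → x ≠ y → ∀ j, J ≤ j →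
      ∀ z : MultStalk D p q y.rep, germ (curvePoly D) y.rep (e x) ^ j • z = 0 := by
    intro x y
    by_cases h : x ∈ T ∧ y ∈ T ∧ x ≠ y
    · obtain ⟨J, hJ⟩ := exists_germ_pow_smul_eq_zero (p := p) (q := q) (hT y h.2.1)
        ((he x h.1).2.2 y h.2.1 h.2.2)
      exact ⟨J, fun _ _ _ => hJ⟩
    · exact ⟨0, fun h1 h2 h3 => absurd ⟨h1, h2, h3⟩ h⟩
  choose J hJ using hJ
  let N := T.sup fun x => T.sup fun y => J x y
  have hN : ∀ x ∈ T, ∀ y ∈ T, J x y ≤ N := fun x hx y hy =>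
    (Finset.le_sup (f := fun y => J x y) hy).trans
      (Finset.le_sup (f := fun x => T.sup fun y => J x y) hx)
  refine ⟨(T.card - 1) * N + T.sup K, fun k hk z => ?_⟩
  have hu : ∀ x, ∃ u ∈ homVec m (k - (T.card - 1) * N), x ∈ T →
      stalkMap D p q x.rep (e x ^ N • u) = z x := by
    intro x
    by_cases hx : x ∈ T
    · have hunit : IsUnit (germ (curvePoly D) x.rep (e x) ^ N) := (isUnit_germ (he x hx).2.1).pow N
      obtain ⟨a, ha⟩ := hunit.exists_right_inv
      have : K x ≤ T.sup K := Finset.le_sup hx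
      obtain ⟨u, hu, hu'⟩ := hK x (k - (T.card - 1) * N) (by omega) (a • z x)
      refine ⟨u, hu, fun _ => ?_⟩
      rw [LinearMap.map_smulₛₗ, map_pow, hu', smul_smul, ha, one_smul]
    · exact ⟨0, Submodule.zero_mem _, fun h => absurd h hx⟩
  choose u hu hu' using hu
  -- The power of `e x` is a unit at `x`, which was compensated in the choice of `u x`, and it
  -- annihilates the stalks at the other points.
  refine ⟨∑ x ∈ T, e x ^ N • u x, Submodule.sum_mem _ fun x hx => ?_, fun y hy => ?_⟩
  · have := smul_mem_homVec ((he x hx).1.pow N) (hu x)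
    rwa [Nat.add_sub_cancel' (by omega)] at this
  · rw [map_sum, Finset.sum_eq_single_of_mem y hy, hu' y hy]
    intro x hx hxy
    rw [LinearMap.map_smulₛₗ, map_pow]
    exact hJ x y hx hy hxy _ (hN x hx y hy) _

end stalkLin

theorem LinearMap.finrank_range_eq_sum_of_surjective {K H M₀ ι : Type*} [Field K] [Fintype ι]
    [AddCommGroup H] [Module K H] [FiniteDimensional K H] [AddCommGroup M₀] [Module K M₀]
    {M : ι → Type*} [∀ i, AddCommGroup (M i)] [∀ i, Module K (M i)]
    [∀ i, FiniteDimensional K (M i)] (g : H →ₗ[K] M₀) (f : ∀ i, H →ₗ[K] M i)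
    (hf : ∀ z : ∀ i, M i, ∃ u, ∀ i, f i u = z i) (hg : ∀ u, g u = 0 ↔ ∀ i, f i u = 0) :
    Module.finrank K (LinearMap.range g) = ∑ i, Module.finrank K (M i) := by
  have hker : LinearMap.ker g = LinearMap.ker (LinearMap.pi f) := by
    ext u
    rw [LinearMap.mem_ker, hg, LinearMap.mem_ker, funext_iff]
    rfl
  have hsurj : LinearMap.range (LinearMap.pi f) = ⊤ := by
    rw [LinearMap.range_eq_top]
    intro z
    obtain ⟨u, hu⟩ := hf z
    exact ⟨u, funext hu⟩
  rw [LinearMap.finrank_range_eq_of_ker_eq _ _ hker, hsurj, finrank_top,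
    Module.finrank_pi_fintype]

/-! ### Vectors of forms with vanishing germs, and the sum over the common zeros -/

section injectivity

variable {m : ℕ} {D : Fin 3 → Matrix (Fin m) (Fin m) ℂ} {n : ℕ} {p q : Poly3}
  (hp : p.IsHomogeneous n) (hq : q.IsHomogeneous n)

theorem compVec_smul_of_mem_homVec {k : ℕ} {u : Fin m → Poly3} (hu : u ∈ homVec m k) (t : ℕ)
    (s : Poly3) : compVec m t (s • u) = shiftComp k t s • u := by
  funext i
  have h := homogeneousComponent_mul_eq (mem_homVec.1 hu i) t s
  simp only [compVec, LinearMap.compLeft_apply, Function.comp_apply, Pi.smul_apply, smul_eq_mul]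
  rw [mul_comm, h, mul_comm]

-- Let h be the chart form and su - (h - 1)d a relation. Its component of degree t is s_(t-k) u - h
-- d_(t-1) + d_t. Multiplying these by powers of h and adding them telescopes to gu + d_(k+j), where
-- g is the sum of the h^(j-i) s_i; this is a homogenization of s, and d_(k+j) is zero for large j.
include hp hq in
theorem exists_homogeneous_smul_mem_relations {v : Fin 3 → ℂ} (hv : v ≠ 0) {k : ℕ}
    {u : Fin m → Poly3} (hu : u ∈ homVec m k) (h : stalkMap D p q v u = 0) :
    ∃ (j : ℕ) (g : Poly3), g.IsHomogeneous j ∧ eval v g ≠ 0 ∧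
      g • u ∈ relations (pencil D) p q := by
  obtain ⟨s, d', hs, hd'⟩ := exists_of_stalkMap_eq_zero h
  obtain ⟨d, hd⟩ : ∃ d, s • u - (chartForm v - 1) • d ∈ relations (pencil D) p q := by
    refine ⟨(C (∑ j, star (v j) * v j) : Poly3) • d', ?_⟩
    rwa [smul_smul, mul_comm, ← chartEq_eq hv]
  have hcomp : ∀ t, shiftComp k t s • u - chartForm v • shiftVec m 1 t d + compVec m t d ∈
      relations (pencil D) p q := by
    intro t
    have := compVec_mem_relations (pencil_isHomogeneous D) hp hq t hd
    rwa [sub_smul, one_smul, map_sub, map_sub, compVec_smul (chartForm_isHomogeneous v),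
      compVec_smul_of_mem_homVec hu, ← sub_add] at this
  have hshift : ∀ t, shiftVec m 1 (t + 1) d = compVec m t d := by
    intro t
    rw [shiftVec_eq_compVec _ _ _ (by omega), Nat.add_sub_cancel]
  have hlow : ∀ t, t < k → compVec m t d ∈ relations (pencil D) p q := by
    intro t
    induction t with
    | zero =>
      intro ht
      have := hcomp 0
      rwa [shiftComp, if_neg (by omega), LinearMap.zero_apply, zero_smul,
        shiftVec_eq_zero _ _ _ one_pos, LinearMap.zero_apply, smul_zero, sub_zero, zero_add] at this
    | succ t ih =>
      intro ht
      have := hcomp (t + 1)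
      rw [shiftComp, if_neg (by omega), LinearMap.zero_apply, zero_smul, hshift, zero_sub] at this
      simpa using add_mem this (Submodule.smul_mem _ (chartForm v) (ih (by omega)))
  have hlow' : shiftVec m 1 k d ∈ relations (pencil D) p q := by
    cases k with
    | zero =>
      rw [shiftVec_eq_zero _ _ _ one_pos]
      exact Submodule.zero_mem _
    | succ k =>
      rw [hshift]
      exact hlow k (Nat.lt_succ_self k)
  have key : ∀ j, ∃ g : Poly3, g.IsHomogeneous j ∧
      eval v g = ∑ i ∈ Finset.range (j + 1), eval v (homogeneousComponent i s) ∧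
      g • u + compVec m (k + j) d ∈ relations (pencil D) p q := by
    intro j
    induction j with
    | zero =>
      refine ⟨homogeneousComponent 0 s, homogeneousComponent_isHomogeneous 0 s, by simp, ?_⟩
      have := hcomp k
      rw [shiftComp, if_pos le_rfl, Nat.sub_self] at this
      have h2 := add_mem this (Submodule.smul_mem _ (chartForm v) hlow')
      rw [add_zero]
      convert h2 using 1
      abel
    | succ j ih =>
      obtain ⟨g, hg, hgv, hgu⟩ := ih
      refine ⟨chartForm v * g + homogeneousComponent (j + 1) s, ?_, ?_, ?_⟩
      · have := (chartForm_isHomogeneous v).mul hg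
        rw [add_comm 1 j] at this
        exact this.add (homogeneousComponent_isHomogeneous _ _)
      · rw [map_add, map_mul, eval_chartForm hv, one_mul, hgv, ← Finset.sum_range_succ]
      · have := hcomp (k + (j + 1))
        rw [shiftComp, if_pos (by omega), Nat.add_sub_cancel_left, ← add_assoc, hshift] at this
        have h2 := add_mem this (Submodule.smul_mem _ (chartForm v) hgu)
        convert h2 using 1
        rw [← add_assoc]
        module
  obtain ⟨N, hN, -⟩ := exists_sum_compVec m d
  -- The degree is large enough for the component of `d` to vanish and for all components of `s` to
  -- occur, so that g(v) = s(v) because h(v) = 1.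
  obtain ⟨g, hg, hgv, hgu⟩ := key (N + s.totalDegree)
  refine ⟨_, g, hg, ?_, ?_⟩
  · have h1 : ∑ i ∈ Finset.range (N + s.totalDegree + 1), homogeneousComponent i s = s := by
      conv_rhs => rw [← sum_homogeneousComponent s]
      refine (Finset.sum_subset (Finset.range_mono (by omega)) fun i _ hi => ?_).symm
      exact homogeneousComponent_eq_zero _ _ (by rw [Finset.mem_range] at hi; omega)
    rw [hgv, ← map_sum, h1]
    exact hs
  · rwa [hN _ (by omega), add_zero] at hgu

variable (hprime : Prime (pencil D).det) {c : Fin 3 → ℂ}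
  (hreg : ∀ u, linForm c • u ∈ relations (pencil D) p 0 → u ∈ relations (pencil D) p 0)
  (hn : 1 ≤ n) (hpd : ¬ (pencil D).det ∣ p)

include hp hq hprime hreg hn hpd

/-- The ideal of multipliers taking u into the relations contains Δ, p, q and, for every common
zero, a form that is nonzero there. Its zero locus is at most the origin, so it contains a power of
ℓ, and in degrees at least 2n - 1 the factors ℓ can be removed one by one. -/
theorem mem_relations_of_forall_stalkMap {k : ℕ} (hk : n + n ≤ k + 1) {u : Fin m → Poly3}
    (hu : u ∈ homVec m k) (h : ∀ x ∈ commonZeros D p q, stalkMap D p q x.rep u = 0) :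
    u ∈ relations (pencil D) p q := by
  let I : Ideal Poly3 :=
    (relations (pencil D) p q).comap (LinearMap.toSpanSingleton Poly3 (Fin m → Poly3) u)
  have hI : ∀ f, f ∈ I ↔ f • u ∈ relations (pencil D) p q := fun f => Iff.rfl
  have hrad : linForm c ∈ I.radical := by
    refine mem_radical_of_forall_eval I _ fun x hx => ?_
    have hΔ : eval x (curvePoly D) = 0 := hx _ ((hI _).2 (det_smul_mem_relations _ _ _ _))
    have hpx : eval x p = 0 := hx _ ((hI _).2 (left_smul_mem_relations _ _ _ _))
    have hqx : eval x q = 0 := hx _ ((hI _).2 (right_smul_mem_relations _ _ _ _))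
    by_contra hne
    have hx0 : x ≠ 0 := by
      rintro rfl
      rw [eval_linForm] at hne
      simp at hne
    obtain ⟨j, g, hg, hgv, hgu⟩ := exists_homogeneous_smul_mem_relations hp hq
      (Projectivization.mk ℂ x hx0).rep_nonzero hu (h (Projectivization.mk ℂ x hx0)
        ⟨((curvePoly_isHomogeneous D).eval_rep_eq_zero_iff hx0).2 hΔ,
          (hp.eval_rep_eq_zero_iff hx0).2 hpx, (hq.eval_rep_eq_zero_iff hx0).2 hqx⟩)
    exact hgv ((hg.eval_rep_eq_zero_iff hx0).2 (hx g ((hI g).2 hgu)))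
  obtain ⟨K, hK⟩ := hrad
  rw [hI] at hK
  induction K with
  | zero => rwa [pow_zero, one_smul] at hK
  | succ K ih =>
    refine ih ?_
    rw [pow_succ', mul_smul] at hK
    refine mem_relations_of_linForm_smul_mem (pencil_isHomogeneous D) hprime hp hq hreg hn hpd
      (k := 1 * K + k) (by omega) ?_ hK
    exact smul_mem_homVec ((linForm_isHomogeneous c).pow K) hu

/-- In a sufficiently large degree the map to the product of the stalks is onto and has the
relations as its kernel. The dimension there is the one in degree `k₀`, since the Hilbert function
is already constant. -/
theorem gradedDim_eq_sum (hfin : (commonZeros D p q).Finite) {k₀ : ℕ} (hk₀ : n + n ≤ k₀ + 1) :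
    gradedDim (pencil D) p q k₀ =
      ∑ x ∈ hfin.toFinset, Module.finrank ℂ (MultStalk D p q x.rep) := by
  classical
  have hconst := gradedDim_eq_of_le (pencil_isHomogeneous D) hprime hp hq hreg hn hpd hk₀
  obtain ⟨K, hK⟩ := exists_homVec_forall_stalkMap_eq (p := p) (q := q) hfin.toFinset
    (fun x hx => (hfin.mem_toFinset.1 hx).1) (fun k hk => (hconst k hk).le)
  have hfd : ∀ x : ℙ ℂ (Fin 3 → ℂ), FiniteDimensional ℂ (MultStalk D p q x.rep) := fun x => by
    obtain ⟨K, hK⟩ := exists_homVec_stalkMap_eq (p := p) (q := q) x.rep_nonzero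
      (fun k hk => (hconst k hk).le)
    exact finite_multStalk_of_exists (hK _ le_rfl)
  have key := LinearMap.finrank_range_eq_sum_of_surjective (gradedMap (pencil D) p q (max K k₀))
    (M := fun x : hfin.toFinset => MultStalk D p q x.1.rep)
    (fun x => stalkLin D p q x.1.rep ∘ₗ (homVec m (max K k₀)).subtype) ?_ ?_
  · rw [← hconst (max K k₀) (le_max_right _ _), gradedDim, key,
      Finset.sum_coe_sort hfin.toFinset fun x => Module.finrank ℂ (MultStalk D p q x.rep)]
  · intro z
    obtain ⟨u, hu, h⟩ := hK (max K k₀) (le_max_left _ _)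
      fun x => if hx : x ∈ hfin.toFinset then z ⟨x, hx⟩ else 0
    refine ⟨⟨u, hu⟩, fun x => (h x.1 x.2).trans ?_⟩
    rw [dif_pos x.2]
  · intro u
    rw [gradedMap_eq_zero]
    constructor
    · intro h x
      exact stalkMap_eq_zero_of_mem h
    · intro h
      have := le_max_right K k₀
      refine mem_relations_of_forall_stalkMap hp hq hprime hreg hn hpd (by omega) u.2 fun x hx => ?_
      exact h ⟨x, hfin.mem_toFinset.2 hx⟩

theorem gradedDim_eq_finsum (hfin : (commonZeros D p q).Finite) {k₀ : ℕ} (hk₀ : n + n ≤ k₀ + 1) :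
    (gradedDim (pencil D) p q k₀ : ℕ∞) =
      ∑ᶠ x ∈ commonZeros D p q, cokerMultiplicity D p q x.rep := by
  have hconst := gradedDim_eq_of_le (pencil_isHomogeneous D) hprime hp hq hreg hn hpd hk₀
  rw [gradedDim_eq_sum hp hq hprime hreg hn hpd hfin hk₀, finsum_mem_eq_finite_toFinset_sum _ hfin,
    Nat.cast_sum]
  refine Finset.sum_congr rfl fun x hx => ?_
  obtain ⟨K, hK⟩ := exists_homVec_stalkMap_eq (p := p) (q := q) x.rep_nonzero
    (fun k hk => (hconst k hk).le)
  have := finite_multStalk_of_exists (hK _ le_rfl)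
  rw [cokerMultiplicity, length_curveLocalRing_eq (hfin.mem_toFinset.1 hx).1,
    Module.length_eq_finrank]

end injectivity

/-! ### Homogenization, and the local rings as domains -/

/-- The homogenization in degree `T`, with respect to the linear form that is `1` on the chart
around `[v]`, of a polynomial of total degree at most `T`. -/
def homogenize (v : Fin 3 → ℂ) (T : ℕ) (f : Poly3) : Poly3 :=
  ∑ t ∈ Finset.range (T + 1), chartForm v ^ (T - t) * homogeneousComponent t f

theorem homogenize_isHomogeneous (v : Fin 3 → ℂ) (T : ℕ) (f : Poly3) :
    (homogenize v T f).IsHomogeneous T := by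
  refine IsHomogeneous.sum _ _ _ fun t ht => ?_
  have h := ((chartForm_isHomogeneous v).pow (T - t)).mul (homogeneousComponent_isHomogeneous t f)
  rwa [one_mul, Nat.sub_add_cancel (by rw [Finset.mem_range] at ht; omega)] at h

theorem sum_homogeneousComponent_of_le {f : Poly3} {T : ℕ} (hT : f.totalDegree ≤ T) :
    ∑ t ∈ Finset.range (T + 1), homogeneousComponent t f = f := by
  conv_rhs => rw [← sum_homogeneousComponent f]
  refine (Finset.sum_subset (Finset.range_mono (by omega)) fun i _ hi => ?_).symm
  exact homogeneousComponent_eq_zero _ _ (by rw [Finset.mem_range] at hi; omega)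

theorem map_homogenize {R : Type*} [CommRing R] (g : Poly3 →+* R) {v : Fin 3 → ℂ}
    (hg : g (chartForm v) = 1) {f : Poly3} {T : ℕ} (hT : f.totalDegree ≤ T) :
    g (homogenize v T f) = g f := by
  conv_rhs => rw [← sum_homogeneousComponent_of_le hT]
  rw [homogenize, map_sum, map_sum]
  refine Finset.sum_congr rfl fun t _ => ?_
  rw [map_mul, map_pow, hg, one_pow, one_mul]

theorem MvPolynomial.eval₂_mul_of_isHomogeneous {K : Type*} [CommRing K] {f : Poly3} {d : ℕ}
    (hf : f.IsHomogeneous d) (g : ℂ →+* K) (y : Fin 3 → K) (t : K) :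
    eval₂ g (fun l => t * y l) f = t ^ d * eval₂ g y f := by
  rw [eval₂_eq', eval₂_eq', Finset.mul_sum]
  refine Finset.sum_congr rfl fun i hi => ?_
  have hd : ∑ l, i l = d := by
    rw [← Finsupp.degree_eq_sum]
    by_contra h
    exact (mem_support_iff.1 hi) (hf.coeff_eq_zero h)
  simp only [mul_pow]
  rw [Finset.prod_mul_distrib, Finset.prod_pow_eq_pow_sum, hd]
  ring

/-- The dehomogenization in the chart around `[v]`, with values in the function field. -/
def dehomogenize {K : Type*} [Field K] (ι : Poly3 →+* K) (v : Fin 3 → ℂ) : Poly3 →+* K :=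
  eval₂Hom (ι.comp C) fun l => (ι (chartForm v))⁻¹ * ι (X l)

theorem dehomogenize_of_isHomogeneous {K : Type*} [Field K] (ι : Poly3 →+* K) (v : Fin 3 → ℂ)
    {f : Poly3} {k : ℕ} (hf : f.IsHomogeneous k) :
    dehomogenize ι v f = (ι (chartForm v))⁻¹ ^ k * ι f := by
  have h : eval₂ (ι.comp C) (fun l => ι (X l)) f = ι f :=
    (eval₂_comp_left ι C X f).symm.trans (congrArg ι (eval₂_eta f))
  rw [← h]
  exact eval₂_mul_of_isHomogeneous hf _ _ _

theorem exists_ringHom_field_of_prime {Δ : Poly3} (hprime : Prime Δ) :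
    ∃ (K : Type) (_ : Field K) (ι : Poly3 →+* K), ∀ g, ι g = 0 ↔ Δ ∣ g := by
  have : IsDomain (Poly3 ⧸ Ideal.span {Δ}) :=
    (Ideal.Quotient.isDomain_iff_prime _).2 ((Ideal.span_singleton_prime hprime.ne_zero).2 hprime)
  refine ⟨FractionRing (Poly3 ⧸ Ideal.span {Δ}), inferInstance,
    (algebraMap _ _).comp (Ideal.Quotient.mk (Ideal.span {Δ})), fun g => ?_⟩
  rw [RingHom.comp_apply, IsFractionRing.to_map_eq_zero_iff, Ideal.Quotient.eq_zero_iff_mem,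
    Ideal.mem_span_singleton]

section domain

variable {Δ : Poly3} {v : Fin 3 → ℂ} (hv0 : v ≠ 0) (hv : eval v Δ = 0)

include hv0 hv

theorem not_dvd_chartForm : ¬ Δ ∣ chartForm v := by
  rintro ⟨g, hg⟩
  have := congrArg (eval v) hg
  rw [eval_chartForm hv0, map_mul, hv, zero_mul] at this
  exact one_ne_zero this

variable {K : Type*} [Field K] {ι : Poly3 →+* K} (hι : ∀ g, ι g = 0 ↔ Δ ∣ g)

include hι

theorem dehomogenize_eq_zero_iff {f : Poly3} {k : ℕ} (hf : f.IsHomogeneous k) :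
    dehomogenize ι v f = 0 ↔ Δ ∣ f := by
  rw [dehomogenize_of_isHomogeneous ι v hf, mul_eq_zero, or_iff_right, hι]
  exact pow_ne_zero _ (inv_ne_zero ((hι _).not.2 (not_dvd_chartForm hv0 hv)))

theorem dehomogenize_chartForm : dehomogenize ι v (chartForm v) = 1 := by
  rw [dehomogenize_of_isHomogeneous ι v (chartForm_isHomogeneous v), pow_one]
  exact inv_mul_cancel₀ ((hι _).not.2 (not_dvd_chartForm hv0 hv))

variable {d : ℕ} (hΔ : Δ.IsHomogeneous d)

include hΔ

/-- The dehomogenization kills Δ and the chart equation, but no polynomial that is nonzero at v.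
Conversely, a polynomial has the same germ and the same dehomogenization as its homogenization, for
which vanishing means divisibility by Δ. The local ring is thereby controlled by a field. -/
theorem germ_eq_zero_iff_dehomogenize {f : Poly3} :
    germ Δ v f = 0 ↔ dehomogenize ι v f = 0 := by
  have h1 := dehomogenize_chartForm hv0 hv hι
  constructor
  · intro h
    obtain ⟨s, a, b, hs, h⟩ := germ_eq_zero_iff.1 h
    have h2 := congrArg (dehomogenize ι v) h
    rw [map_add, map_mul, map_mul, map_mul, chartEq_eq hv0, map_mul, map_sub, h1, map_one, sub_self,
      (dehomogenize_eq_zero_iff hv0 hv hι hΔ).2 dvd_rfl, mul_zero, mul_zero, mul_zero,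
      add_zero, mul_eq_zero] at h2
    refine h2.resolve_left fun h3 => hs ?_
    rw [← map_homogenize _ h1 le_rfl, dehomogenize_eq_zero_iff hv0 hv hι
      (homogenize_isHomogeneous v _ s)] at h3
    rw [← map_homogenize (eval v) (eval_chartForm hv0) (le_refl s.totalDegree)]
    obtain ⟨g, hg⟩ := h3
    rw [hg, map_mul, hv, zero_mul]
  · intro h
    rw [← map_homogenize _ h1 le_rfl, dehomogenize_eq_zero_iff hv0 hv hι
      (homogenize_isHomogeneous v _ f)] at h
    rw [← map_homogenize (germ Δ v) (germ_chartForm hv0) (le_refl f.totalDegree)]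
    obtain ⟨g, hg⟩ := h
    rw [hg, map_mul, germ_curve, zero_mul]

omit hι in
theorem germ_eq_zero_iff_dvd (hprime : Prime Δ) {f : Poly3} {k : ℕ} (hf : f.IsHomogeneous k) :
    germ Δ v f = 0 ↔ Δ ∣ f := by
  obtain ⟨K, _, ι, hι⟩ := exists_ringHom_field_of_prime hprime
  exact (germ_eq_zero_iff_dehomogenize hv0 hv hι hΔ).trans (dehomogenize_eq_zero_iff hv0 hv hι hf)

omit hι in
theorem isDomain_curveLocalRing (hprime : Prime Δ) : IsDomain (CurveLocalRing Δ v) := by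
  obtain ⟨K, _, ι, hι⟩ := exists_ringHom_field_of_prime hprime
  have := curveLocalRing_nontrivial hv
  have : NoZeroDivisors (CurveLocalRing Δ v) := by
    refine ⟨fun {z w} h => ?_⟩
    obtain ⟨s, f, hs, hf⟩ := exists_germ_mul_eq z
    obtain ⟨t, g, ht, hg⟩ := exists_germ_mul_eq w
    have h1 : germ Δ v (f * g) = 0 := by
      rw [map_mul, ← hf, ← hg]
      linear_combination (germ Δ v s * germ Δ v t) * h
    rw [germ_eq_zero_iff_dehomogenize hv0 hv hι hΔ, map_mul, mul_eq_zero,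
      ← germ_eq_zero_iff_dehomogenize hv0 hv hι hΔ,
      ← germ_eq_zero_iff_dehomogenize hv0 hv hι hΔ, ← hf, ← hg] at h1
    exact h1.imp (isUnit_germ hs).mul_right_eq_zero.1 (isUnit_germ ht).mul_right_eq_zero.1
  exact NoZeroDivisors.to_isDomain _

end domain

/-! ### Nonsingular points -/

theorem Derivation.map_prod_eq_sum {R S ι : Type*} [CommRing R] [CommRing S] [Algebra R S]
    [DecidableEq ι] (d : Derivation R S S) (s : Finset ι) (f : ι → S) :
    d (∏ i ∈ s, f i) = ∑ i ∈ s, (∏ j ∈ s.erase i, f j) * d (f i) := by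
  induction s using Finset.induction_on with
  | empty => simp
  | insert a s ha ih =>
    rw [Finset.prod_insert ha, Derivation.leibniz, ih, Finset.sum_insert ha,
      Finset.erase_insert ha, smul_eq_mul, smul_eq_mul, Finset.mul_sum, add_comm]
    refine congrArg₂ _ rfl (Finset.sum_congr rfl fun i hi => ?_)
    have hia : a ≠ i := fun h => ha (h ▸ hi)
    rw [Finset.erase_insert_of_ne hia, Finset.prod_insert fun h => ha (Finset.mem_of_mem_erase h)]
    ring

/-- The Leibniz rule differentiates one column at a time, and Cramer's rule expresses each resulting
determinant through the adjugate. -/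
theorem Derivation.map_det {R S ι : Type*} [CommRing R] [CommRing S] [Algebra R S] [Fintype ι]
    [DecidableEq ι] (d : Derivation R S S) (A : Matrix ι ι S) :
    d A.det = ∑ i, A.adjugate.mulVec (fun k => d (A k i)) i := by
  simp only [← Matrix.cramer_eq_adjugate_mulVec, Matrix.cramer_apply]
  simp only [Matrix.det_apply]
  rw [map_sum, Finset.sum_comm]
  refine Finset.sum_congr rfl fun σ _ => ?_
  rw [Units.smul_def, map_zsmul, Derivation.map_prod_eq_sum, Finset.smul_sum]
  refine Finset.sum_congr rfl fun i _ => ?_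
  rw [Units.smul_def, ← Finset.prod_erase_mul _ _ (Finset.mem_univ i), Matrix.updateCol_self]
  congr 2
  refine Finset.prod_congr rfl fun j hj => ?_
  rw [Matrix.updateCol_ne (Finset.ne_of_mem_erase hj)]

/-- If some entry of the adjugate of a singular matrix is a unit, the cokernel of the matrix is
free of rank one. -/
theorem Matrix.nonempty_coker_equiv_of_isUnit_adjugate {R ι : Type*} [CommRing R] [Fintype ι]
    [DecidableEq ι] (A : Matrix ι ι R) (hA : A.det = 0) {i j : ι} (h : IsUnit (A.adjugate i j)) :
    Nonempty (((ι → R) ⧸ LinearMap.range A.mulVecLin) ≃ₗ[R] R) := by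
  let r : (ι → R) →ₗ[R] R := LinearMap.proj i ∘ₗ A.adjugate.mulVecLin
  have hr : ∀ u, r u = A.adjugate.mulVec u i := fun u => rfl
  have hrA : ∀ u, r (A.mulVec u) = 0 := by
    intro u
    rw [hr, Matrix.mulVec_mulVec, Matrix.adjugate_mul, hA, zero_smul, Matrix.zero_mulVec]
    rfl
  have hrj : r (Pi.single j 1) = A.adjugate i j := by
    rw [hr, Matrix.mulVec_single_one]
    rfl
  have hsurj : Function.Surjective r := by
    intro z
    obtain ⟨a, ha⟩ := h.exists_right_inv
    refine ⟨(z * a) • Pi.single j 1, ?_⟩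
    rw [map_smul, hrj, smul_eq_mul]
    linear_combination z * ha
  have hker : LinearMap.range A.mulVecLin = LinearMap.ker r := by
    refine le_antisymm ?_ fun u hu => ?_
    · rintro _ ⟨u, rfl⟩
      exact hrA u
    -- By Cramer's rule the determinant of `M` is the unit entry of the adjugate, so `u` is in the
    -- image of `M`. Since `M` differs from `A` only in column `i`, this writes `u` as an element of
    -- the image of `A` plus a multiple of a unit vector; `r u = 0` removes the multiple.
    · let M := A.updateCol i (Pi.single j 1)
      have hM : IsUnit M.det := by
        rw [← Matrix.cramer_apply, Matrix.cramer_eq_adjugate_mulVec]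
        change IsUnit (r (Pi.single j 1))
        rwa [hrj]
      obtain ⟨w, rfl⟩ : ∃ w, M.mulVec w = u :=
        ⟨M⁻¹.mulVec u, by rw [Matrix.mulVec_mulVec, Matrix.mul_nonsing_inv _ hM, Matrix.one_mulVec]⟩
      have hw : M.mulVec w = A.mulVec (Function.update w i 0) + w i • Pi.single j 1 := by
        funext k
        simp only [Matrix.mulVec, dotProduct, Pi.add_apply, Pi.smul_apply, smul_eq_mul]
        rw [← Finset.sum_erase_add _ _ (Finset.mem_univ i),
          ← Finset.sum_erase_add _ (fun x => A k x * Function.update w i 0 x) (Finset.mem_univ i)]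
        simp only [M, Matrix.updateCol_self, Function.update_self, mul_zero, add_zero]
        rw [mul_comm (w i)]
        refine congrArg (· + _) (Finset.sum_congr rfl fun x hx => ?_)
        rw [Matrix.updateCol_ne (Finset.ne_of_mem_erase hx),
          Function.update_of_ne (Finset.ne_of_mem_erase hx)]
      have hwi : w i = 0 := by
        rw [LinearMap.mem_ker, hw, map_add, hrA, zero_add, map_smul, hrj, smul_eq_mul] at hu
        exact h.mul_left_eq_zero.1 hu
      rw [hw, hwi, zero_smul, add_zero]
      exact ⟨_, rfl⟩
  exact ⟨(Submodule.quotEquivOfEq _ _ hker).trans (r.quotKerEquivOfSurjective hsurj)⟩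

theorem sub_sum_pderiv_mem (v : Fin 3 → ℂ) (f : Poly3) :
    f - C (eval v f) - ∑ l, C (eval v (pderiv l f)) * (X l - C (v l)) ∈ pointIdeal v ^ 2 := by
  induction f using MvPolynomial.induction_on with
  | C a => simp
  | add f g hf hg =>
    convert add_mem hf hg using 1
    simp only [map_add, add_mul, Finset.sum_add_distrib]
    ring
  | mul_X f i hf =>
    have h1 : (f - C (eval v f)) * (X i - C (v i)) ∈ pointIdeal v ^ 2 := by
      rw [pow_two]
      exact Ideal.mul_mem_mul (mem_pointIdeal.2 (by simp)) (mem_pointIdeal.2 (by simp))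
    convert add_mem (Ideal.mul_mem_left _ (C (v i)) hf) h1 using 1
    have h2 : ∀ l, C (eval v (pderiv l (f * X i))) * (X l - C (v l)) =
        C (v i) * (C (eval v (pderiv l f)) * (X l - C (v l))) +
          (if l = i then C (eval v f) * (X i - C (v i)) else 0 : Poly3) := by
      intro l
      rw [pderiv_mul, pderiv_X, map_add, map_mul, map_mul, eval_X, map_add, map_mul]
      by_cases h : l = i
      · subst h
        simp
        ring
      · rw [Pi.single_eq_of_ne (Ne.symm h)]
        simp [h]
        ring
    simp only [h2, Finset.sum_add_distrib, ← Finset.mul_sum, Finset.sum_ite_eq', Finset.mem_univ,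
      if_true, map_mul, eval_X]
    ring

/-- Pairing with v shows that a and b are independent, so one more vector completes them to a basis.
In the application a is the differential of the chart equation and b the gradient of Δ, orthogonal
to v by Euler's formula. -/
theorem exists_forall_eq_add_of_dotProduct {v a b : Fin 3 → ℂ} (ha : a ⬝ᵥ v ≠ 0) (hb : b ≠ 0)
    (hbv : b ⬝ᵥ v = 0) : ∃ c : Fin 3 → ℂ, ∀ w, ∃ r s t : ℂ, w = r • c + s • a + t • b := by
  have hli : LinearIndependent ℂ ![b, a] := by
    refine (LinearIndependent.pair_iff' hb).2 fun t ht => ha ?_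
    rw [← ht, smul_dotProduct, hbv, smul_zero]
  have h1 := finrank_span_eq_card hli
  have h2 := Submodule.finrank_quotient_add_finrank (Submodule.span ℂ (Set.range ![b, a]))
  rw [h1, Module.finrank_fin_fun, Fintype.card_fin] at h2
  obtain ⟨c, hc⟩ := finrank_le_one_iff.1 (show Module.finrank ℂ
    ((Fin 3 → ℂ) ⧸ Submodule.span ℂ (Set.range ![b, a])) ≤ 1 by omega)
  obtain ⟨c, rfl⟩ := Submodule.Quotient.mk_surjective _ c
  refine ⟨c, fun w => ?_⟩
  obtain ⟨r, hr⟩ := hc (Submodule.Quotient.mk w)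
  rw [← Submodule.Quotient.mk_smul, eq_comm, Submodule.Quotient.eq, Matrix.range_cons,
    Matrix.range_cons, Matrix.range_empty, Set.union_empty, Set.singleton_union,
    Submodule.mem_span_pair] at hr
  obtain ⟨t, s, h⟩ := hr
  refine ⟨r, s, t, ?_⟩
  rw [add_assoc, add_comm (s • a), h]
  abel

section nonsingular

variable {Δ : Poly3} {v : Fin 3 → ℂ} (hv0 : v ≠ 0) (hv : eval v Δ = 0)

-- Modulo the square of the maximal ideal a germ is its linear Taylor part. The chart equation and
-- the nonzero gradient of Δ give two independent relations among the three coordinate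
-- differentials, so one element generates the maximal ideal modulo its square; Nakayama finishes.
include hv0 hv in
theorem maximalIdeal_isPrincipal [IsLocalRing (CurveLocalRing Δ v)] {d : ℕ}
    (hΔ : Δ.IsHomogeneous d) (hns : ¬ IsSingularAt Δ v) :
    (IsLocalRing.maximalIdeal (CurveLocalRing Δ v)).IsPrincipal := by
  let M := IsLocalRing.maximalIdeal (CurveLocalRing Δ v)
  let τ : (Fin 3 → ℂ) →ₗ[ℂ] CurveLocalRing Δ v :=
    ∑ l, (LinearMap.proj l).smulRight (germ Δ v (X l - C (v l)))
  have hτ : ∀ a, τ a = germ Δ v (∑ l, C (a l) * (X l - C (v l))) := by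
    intro a
    simp only [τ, LinearMap.sum_apply, LinearMap.smulRight_apply, LinearMap.proj_apply, map_sum]
    refine Finset.sum_congr rfl fun l _ => ?_
    rw [← germ_smul, smul_eq_C_mul]
  have hsq : ∀ f ∈ pointIdeal v ^ 2, germ Δ v f ∈ M ^ 2 := by
    intro f hf
    have h1 : (pointIdeal v).map (germ Δ v) ≤ M :=
      Ideal.map_le_iff_le_comap.2 fun g hg => (germ_mem_maximalIdeal hv).2 hg
    have h2 := Ideal.mem_map_of_mem (germ Δ v) hf
    rw [Ideal.map_pow] at h2
    exact Ideal.pow_right_mono h1 2 h2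
  have htaylor : ∀ f, eval v f = 0 → germ Δ v f - τ (fun l => eval v (pderiv l f)) ∈ M ^ 2 := by
    intro f hf
    have := hsq _ (sub_sum_pderiv_mem v f)
    rwa [hf, map_zero, sub_zero, map_sub, ← hτ] at this
  have hstar : τ (fun l => star (v l)) = 0 := by
    rw [hτ]
    exact germ_chartEq
  have hgrad : τ (fun l => eval v (pderiv l Δ)) ∈ M ^ 2 := by
    have := htaylor Δ hv
    rwa [germ_curve, zero_sub, neg_mem_iff] at this
  obtain ⟨c, hc⟩ := exists_forall_eq_add_of_dotProduct (v := v) (a := fun l => star (v l))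
    (b := fun l => eval v (pderiv l Δ)) (sum_star_mul_self_ne_zero hv0)
    (fun h => hns fun l => congrFun h l) (by
      have h := congrArg (eval v) hΔ.sum_X_mul_pderiv
      rw [map_sum, map_nsmul, hv, smul_zero] at h
      rw [← h]
      exact Finset.sum_congr rfl fun l _ => by rw [map_mul, eval_X, mul_comm])
  have hmem : ∀ z ∈ M, z ∈ Ideal.span {τ c} ⊔ M ^ 2 := by
    intro z hz
    obtain ⟨s, f, hs, hf⟩ := exists_germ_mul_eq z
    rw [← Ideal.unit_mul_mem_iff_mem _ (isUnit_germ hs), hf]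
    have hfv : eval v f = 0 := by
      rw [← germ_mem_maximalIdeal hv, ← hf]
      exact Ideal.mul_mem_left _ _ hz
    obtain ⟨r, s, t, hrst⟩ := hc fun l => eval v (pderiv l f)
    have h1 := htaylor f hfv
    rw [hrst, map_add, map_add, map_smul, map_smul, map_smul, hstar, smul_zero, add_zero] at h1
    rw [Submodule.mem_sup]
    refine ⟨r • τ c, ?_, germ Δ v f - r • τ c, ?_, add_sub_cancel _ _⟩
    · rw [Algebra.smul_def]
      exact Ideal.mul_mem_left _ _ (Ideal.mem_span_singleton_self _)
    · have h2 := (M ^ 2).mul_mem_left (algebraMap ℂ _ t) hgrad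
      rw [← Algebra.smul_def] at h2
      convert add_mem h1 h2 using 1
      abel
  have hle : M ≤ Ideal.span {τ c} := by
    refine Submodule.le_of_le_smul_of_le_jacobson_bot (I := M) (IsNoetherian.noetherian M) ?_ ?_
    · exact (IsLocalRing.jacobson_eq_maximalIdeal _ bot_ne_top).ge
    · rw [smul_eq_mul, ← pow_two]
      exact hmem
  have hge : Ideal.span {τ c} ≤ M := by
    rw [Ideal.span_singleton_le_iff_mem, hτ]
    exact (germ_mem_maximalIdeal hv).2 (by simp)
  exact ⟨⟨τ c, le_antisymm hle hge⟩⟩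

include hv0 hv in
theorem isIntegrallyClosed_curveLocalRing [IsDomain (CurveLocalRing Δ v)] {d : ℕ}
    (hΔ : Δ.IsHomogeneous d) (hns : ¬ IsSingularAt Δ v) :
    IsIntegrallyClosed (CurveLocalRing Δ v) := by
  have := curveLocalRing_isLocalRing hv
  have h := ((tfae_of_isNoetherianRing_of_isLocalRing_of_isDomain (CurveLocalRing Δ v)).out 4 3).1
    (maximalIdeal_isPrincipal hv0 hv hΔ hns)
  exact h.1

end nonsingular

/-- By the formula for the derivative of a determinant, some entry of the adjugate is nonzero at v,
since otherwise all partial derivatives of Δ would vanish. So the stalk is free of rank one, and the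
local ring is its own normalization. -/
theorem isDirectImageAt_of_not_isSingularAt {m : ℕ} {D : Fin 3 → Matrix (Fin m) (Fin m) ℂ}
    (hprime : Prime (curvePoly D)) {v : Fin 3 → ℂ} (hv0 : v ≠ 0) (hv : eval v (curvePoly D) = 0)
    (hns : ¬ IsSingularAt (curvePoly D) v) : IsDirectImageAt D v := by
  have hΔ := curvePoly_isHomogeneous D
  have := isDomain_curveLocalRing hv0 hv hΔ hprime
  have := isIntegrallyClosed_curveLocalRing hv0 hv hΔ hns
  have hdet : ((pencil D).map (germ (curvePoly D) v)).det = 0 :=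
    ((germ (curvePoly D) v).map_det (pencil D)).symm.trans germ_curve
  obtain ⟨i, j, hij⟩ : ∃ i j, eval v ((pencil D).adjugate i j) ≠ 0 := by
    by_contra! h
    refine hns fun l => ?_
    rw [curvePoly, Derivation.map_det, map_sum]
    refine Finset.sum_eq_zero fun i _ => ?_
    rw [Matrix.mulVec, dotProduct, map_sum]
    exact Finset.sum_eq_zero fun k _ => by rw [map_mul, h, zero_mul]
  have hunit : IsUnit (((pencil D).map (germ (curvePoly D) v)).adjugate i j) := by
    have h := (germ (curvePoly D) v).map_adjugate (pencil D)
    rw [RingHom.mapMatrix_apply, RingHom.mapMatrix_apply] at h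
    rw [← h]
    exact isUnit_germ hij
  obtain ⟨e⟩ := Matrix.nonempty_coker_equiv_of_isUnit_adjugate _ hdet hunit
  let f := Algebra.linearMap (CurveLocalRing (curvePoly D) v)
    (NormalizedLocalRing (curvePoly D) v)
  have hf : Function.Bijective f := by
    constructor
    · exact FaithfulSMul.algebraMap_injective _ _
    · rintro ⟨y, hy⟩
      rw [mem_integralClosure_iff] at hy
      obtain ⟨z, hz⟩ := IsIntegrallyClosed.isIntegral_iff.1 hy
      exact ⟨z, Subtype.ext hz⟩
  exact ⟨e.trans (LinearEquiv.ofBijective f hf)⟩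

/-! ### Lengths over Dedekind domains -/

section dedekind

open UniqueFactorizationMonoid

variable {R : Type*} [CommRing R] [IsDedekindDomain R]

/-- For a in J but not in PJ the ideal (a) + PJ is J, because nothing lies strictly between PJ and
J. Multiplication by a then identifies R/P with the kernel J/PJ of R/PJ → R/J. -/
theorem Ideal.length_quotient_mul_of_prime (O : Type*) [CommRing O] [Algebra O R] {P J : Ideal R}
    (hP : Prime P) (hJ : J ≠ ⊥) :
    Module.length O (R ⧸ P * J) = Module.length O (R ⧸ P) + Module.length O (R ⧸ J) := by
  have hPmax : P.IsMaximal := (Ideal.isPrime_of_prime hP).isMaximal hP.ne_zero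
  obtain ⟨a, haJ, ha⟩ : ∃ a ∈ J, a ∉ P * J := by
    by_contra! h
    have h1 : P * J = 1 * J := by
      rw [one_mul]
      exact le_antisymm Ideal.mul_le_right h
    exact hP.not_isUnit ((mul_right_cancel₀ hJ h1) ▸ isUnit_one)
  have hsup : Ideal.span {a} ⊔ P * J = J := by
    obtain ⟨Q, hQ⟩ : J ∣ Ideal.span {a} ⊔ P * J := by
      rw [Ideal.dvd_iff_le, sup_le_iff, Ideal.span_singleton_le_iff_mem]
      exact ⟨haJ, Ideal.mul_le_right⟩
    have hPQ : P ≤ Q := by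
      rw [← Ideal.dvd_iff_le, ← mul_dvd_mul_iff_left hJ, ← hQ, Ideal.dvd_iff_le, mul_comm J]
      exact le_sup_right
    by_cases hQtop : Q = ⊤
    · rw [hQ, hQtop, Ideal.mul_top]
    · refine absurd ?_ ha
      rw [hPmax.eq_of_le hQtop hPQ, mul_comm, ← hQ]
      exact Ideal.mem_sup_left (Ideal.mem_span_singleton_self a)
  have hle : P ≤ Submodule.comap (LinearMap.toSpanSingleton R R a) (P * J) := fun r hr =>
    Ideal.mul_mem_mul hr haJ
  let f : (R ⧸ P) →ₗ[R] R ⧸ P * J := Submodule.mapQ P (P * J) (LinearMap.toSpanSingleton R R a) hle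
  let g : (R ⧸ P * J) →ₗ[R] R ⧸ J := Submodule.factor Ideal.mul_le_right
  have hf : ∀ r : R, f (Submodule.Quotient.mk r) = Submodule.Quotient.mk (r * a) := fun r => rfl
  have hg : ∀ r : R, g (Submodule.Quotient.mk r) = Submodule.Quotient.mk r := fun r => rfl
  refine Module.length_eq_add_of_exact (f.restrictScalars O) (g.restrictScalars O) ?_ ?_ ?_
  · change Function.Injective f
    have hlt : P = Submodule.comap (LinearMap.toSpanSingleton R R a) (P * J) := by
      refine hPmax.eq_of_le ?_ hle
      rw [Ne, Ideal.eq_top_iff_one]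
      exact fun h => ha ((one_smul R a) ▸ h)
    rw [injective_iff_map_eq_zero]
    intro z hz
    obtain ⟨r, rfl⟩ := Submodule.Quotient.mk_surjective _ z
    rw [hf, Submodule.Quotient.mk_eq_zero] at hz
    rw [Submodule.Quotient.mk_eq_zero, hlt]
    exact hz
  · intro z
    obtain ⟨r, rfl⟩ := Submodule.Quotient.mk_surjective _ z
    exact ⟨Submodule.Quotient.mk r, rfl⟩
  · intro z
    obtain ⟨r, rfl⟩ := Submodule.Quotient.mk_surjective _ z
    change g _ = 0 ↔ ∃ y, f y = _
    rw [hg, Submodule.Quotient.mk_eq_zero]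
    constructor
    · intro hr
      rw [← hsup, Submodule.mem_sup] at hr
      obtain ⟨y, hy, w, hw, rfl⟩ := hr
      obtain ⟨t, rfl⟩ := Ideal.mem_span_singleton'.1 hy
      refine ⟨Submodule.Quotient.mk t, ?_⟩
      rw [hf, eq_comm, Submodule.Quotient.eq, add_sub_cancel_left]
      exact hw
    · rintro ⟨y, hy⟩
      obtain ⟨t, rfl⟩ := Submodule.Quotient.mk_surjective _ y
      rw [hf, Submodule.Quotient.eq] at hy
      have h1 := Ideal.mul_le_right hy
      rw [← sub_sub_cancel (t * a) r]
      exact sub_mem (Ideal.mul_mem_left _ _ haJ) h1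

theorem Ideal.length_quotient_eq_card_normalizedFactors (O : Type*) [CommRing O] [Algebra O R]
    (h : ∀ P : Ideal R, P.IsPrime → P ≠ ⊥ → Module.length O (R ⧸ P) = 1) (J : Ideal R)
    (hJ : J ≠ ⊥) : Module.length O (R ⧸ J) = (normalizedFactors J).card := by
  induction J using UniqueFactorizationMonoid.induction_on_prime with
  | h₁ => exact absurd rfl hJ
  | h₂ J hJ' =>
    rw [Ideal.isUnit_iff] at hJ'
    subst hJ'
    have : Subsingleton (R ⧸ (⊤ : Ideal R)) := Ideal.Quotient.subsingleton_iff.2 rfl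
    rw [Module.length_eq_zero, ← Ideal.one_eq_top, normalizedFactors_one]
    simp
  | h₃ J P hJ' hP ih =>
    rw [Ideal.length_quotient_mul_of_prime O hP hJ', ih hJ',
      h P (Ideal.isPrime_of_prime hP) hP.ne_zero, normalizedFactors_mul hP.ne_zero hJ',
      normalizedFactors_irreducible hP.irreducible, Multiset.card_add, Multiset.card_singleton,
      Nat.cast_add, Nat.cast_one]

theorem Ideal.finsum_emultiplicity_eq_card_normalizedFactors {J : Ideal R} (hJ : J ≠ ⊥) :
    ∑ᶠ P : MaximalSpectrum R, emultiplicity P.asIdeal J = (normalizedFactors J).card := by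
  classical
  have hinj : Function.Injective (MaximalSpectrum.asIdeal : MaximalSpectrum R → Ideal R) :=
    fun P Q h => MaximalSpectrum.ext h
  rw [← finsum_mem_range (f := fun I => emultiplicity I J) hinj,
    finsum_mem_eq_sum_of_inter_support_eq (t := (normalizedFactors J).toFinset),
    ← Multiset.toFinset_sum_count_eq, Nat.cast_sum]
  · refine Finset.sum_congr rfl fun I hI => ?_
    rw [Multiset.mem_toFinset] at hI
    rw [emultiplicity_eq_count_normalizedFactors (irreducible_of_normalized_factor I hI) hJ,
      normalize_eq]
  · ext I
    simp only [Set.mem_inter_iff, Function.mem_support, and_congr_left_iff, Finset.mem_coe,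
      Multiset.mem_toFinset]
    intro hI
    have hdvd : I ∣ J := by
      by_contra h
      exact hI (emultiplicity_eq_zero.2 h)
    constructor
    · rintro ⟨P, rfl⟩
      exact (Ideal.mem_normalizedFactors_iff hJ).2
        ⟨P.isMaximal.isPrime, Ideal.dvd_iff_le.1 hdvd⟩
    · intro hI
      have hp := prime_of_normalized_factor I hI
      exact ⟨⟨I, (Ideal.isPrime_of_prime hp).isMaximal hp.ne_zero⟩, rfl⟩

/-- Divisibility by a power of P is containment in it, and a sum is contained exactly when both
summands are. -/
theorem Ideal.emultiplicity_sup (P A B : Ideal R) :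
    emultiplicity P (A ⊔ B) = min (emultiplicity P A) (emultiplicity P B) := by
  refine ENat.eq_of_forall_natCast_le_iff fun k => ?_
  rw [le_min_iff, ← pow_dvd_iff_le_emultiplicity, ← pow_dvd_iff_le_emultiplicity,
    ← pow_dvd_iff_le_emultiplicity, Ideal.dvd_iff_le, Ideal.dvd_iff_le, Ideal.dvd_iff_le, sup_le_iff]

end dedekind

/-! ### Direct images from the desingularization -/

section normalization

/-- The residue field ℂ of the local ring is algebraically closed, so the integral extension of
residue fields is trivial. -/
theorem Ideal.length_quotient_eq_one_of_isIntegral {Δ : Poly3} {v : Fin 3 → ℂ}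
    (hv : eval v Δ = 0) {R : Type*} [CommRing R] [Algebra (CurveLocalRing Δ v) R]
    [Algebra.IsIntegral (CurveLocalRing Δ v) R] (P : Ideal R) (hP : P.IsMaximal) :
    Module.length (CurveLocalRing Δ v) (R ⧸ P) = 1 := by
  have hloc := curveLocalRing_isLocalRing hv
  let M := IsLocalRing.maximalIdeal (CurveLocalRing Δ v)
  have hPM : P.under (CurveLocalRing Δ v) = M :=
    IsLocalRing.eq_maximalIdeal (Ideal.isMaximal_comap_of_isIntegral_of_isMaximal P)
  have : P.LiesOver M := ⟨hPM.symm⟩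
  let _ : Field (CurveLocalRing Δ v ⧸ M) := Ideal.Quotient.field M
  have hbij : Function.Bijective (algebraMap ℂ (CurveLocalRing Δ v ⧸ M)) := by
    refine ⟨(algebraMap ℂ (CurveLocalRing Δ v ⧸ M)).injective, fun z => ?_⟩
    obtain ⟨y, rfl⟩ := Ideal.Quotient.mk_surjective z
    obtain ⟨c, hc⟩ := exists_sub_algebraMap_mem hv y
    exact ⟨c, (Ideal.Quotient.eq.2 hc).symm⟩
  have : IsAlgClosed (CurveLocalRing Δ v ⧸ M) :=
    IsAlgClosed.of_ringEquiv ℂ _ (RingEquiv.ofBijective _ hbij)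
  have : Algebra.IsIntegral (CurveLocalRing Δ v) (R ⧸ P) := inferInstance
  have : Algebra.IsIntegral (CurveLocalRing Δ v ⧸ M) (R ⧸ P) :=
    Algebra.IsIntegral.tower_top (CurveLocalRing Δ v)
  have hsurj : Function.Surjective (algebraMap (CurveLocalRing Δ v) (R ⧸ P)) := by
    rw [IsScalarTower.algebraMap_eq (CurveLocalRing Δ v) (CurveLocalRing Δ v ⧸ M) (R ⧸ P)]
    exact (IsAlgClosed.algebraMap_bijective_of_isIntegral
      (k := CurveLocalRing Δ v ⧸ M)).2.comp Ideal.Quotient.mk_surjective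
  rw [Module.length_eq_of_surjective (M := R ⧸ P) hsurj]
  let _ : Field (R ⧸ P) := Ideal.Quotient.field P
  exact Module.length_eq_one (R := R ⧸ P) (M := R ⧸ P)

/-- The isomorphism of quotients by an ideal of the base ring induced by an isomorphism of a module
with an algebra. -/
def LinearEquiv.quotientSMulTop {O R E : Type*} [CommRing O] [CommRing R] [Algebra O R]
    [AddCommGroup E] [Module O E] (e : E ≃ₗ[O] R) (I : Ideal O) :
    (E ⧸ (I • ⊤ : Submodule O E)) ≃ₗ[O] R ⧸ I.map (algebraMap O R) :=
  (Submodule.Quotient.equiv (I • ⊤) (I • ⊤) e (by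
    rw [Submodule.map_smul'', Submodule.map_top]
    exact congrArg (I • ·) (LinearEquiv.range e))).trans
  ((Submodule.quotEquivOfEq _ _ (Ideal.smul_top_eq_map I)).trans
    (Submodule.Quotient.restrictScalarsEquiv O (I.map (algebraMap O R))))

variable {m : ℕ} {D : Fin 3 → Matrix (Fin m) (Fin m) ℂ} {v : Fin 3 → ℂ}
  (hprime : Prime (curvePoly D)) (hv0 : v ≠ 0) (hv : eval v (curvePoly D) = 0)

include hprime hv0 in
theorem finite_multStalk_single {d : ℕ} {f : Poly3} (hf : f.IsHomogeneous d)
    (hfd : ¬ curvePoly D ∣ f) : FiniteDimensional ℂ (MultStalk D f 0 v) := by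
  obtain ⟨K, hK⟩ := exists_homVec_stalkMap_eq (D := D) (p := f) (q := 0) hv0 (d := m * d) (k₀ := d)
    fun k hk => (gradedDim_single (pencil_isHomogeneous D) hprime hf hfd (by omega)).le
  exact finite_multStalk_of_exists (hK K le_rfl)

include hprime hv0 hv

/-- The isomorphism with the finitely generated stalk makes the normalization finite over the local
ring, hence noetherian. A nonzero prime Q contains the germ of a form f not divisible by Δ, and the
quotient by Q is an image of the finite-dimensional stalk of E/fE, so it is an artinian domain, that
is, a field. -/
theorem isDedekindDomain_normalizedLocalRing (h : IsDirectImageAt D v) :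
    IsDedekindDomain (NormalizedLocalRing (curvePoly D) v) := by
  have hΔ := curvePoly_isHomogeneous D
  have := isDomain_curveLocalRing hv0 hv hΔ hprime
  obtain ⟨e⟩ := h
  have hfin : Module.Finite (CurveLocalRing (curvePoly D) v)
      (NormalizedLocalRing (curvePoly D) v) := Module.Finite.equiv e
  have : IsNoetherianRing (NormalizedLocalRing (curvePoly D) v) :=
    IsNoetherianRing.of_finite (CurveLocalRing (curvePoly D) v) _
  have hclosed : IsIntegrallyClosed (NormalizedLocalRing (curvePoly D) v) :=
    integralClosure.isIntegrallyClosedOfFiniteExtension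
      (FractionRing (CurveLocalRing (curvePoly D) v))
  have hdim : ∀ {Q : Ideal (NormalizedLocalRing (curvePoly D) v)}, Q ≠ ⊥ → Q.IsPrime →
      Q.IsMaximal := by
    intro Q hQ hQp
    obtain ⟨y, hy, hy0⟩ := Submodule.exists_mem_ne_zero_of_ne_bot hQ
    have hcomap : Q.comap (algebraMap (CurveLocalRing (curvePoly D) v) _) ≠ ⊥ :=
      Ideal.comap_ne_bot_of_integral_mem hy0 hy (Algebra.IsIntegral.isIntegral y)
    obtain ⟨z, hz, hz0⟩ := Submodule.exists_mem_ne_zero_of_ne_bot hcomap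
    obtain ⟨s, g, hs, hg⟩ := exists_germ_mul_eq z
    -- The Hilbert function argument needs a homogeneous polynomial; homogenizing with the chart
    -- form leaves the germ unchanged.
    have hg' := map_homogenize (germ (curvePoly D) v) (germ_chartForm hv0) (le_refl g.totalDegree)
    have hghom := homogenize_isHomogeneous v g.totalDegree g
    generalize homogenize v g.totalDegree g = f at hg' hghom
    have hfQ : germ (curvePoly D) v f ∈ Q.comap (algebraMap (CurveLocalRing (curvePoly D) v) _) := by
      rw [hg', ← hg]
      exact Ideal.mul_mem_left _ _ hz
    have hfd : ¬ curvePoly D ∣ f := by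
      rw [← germ_eq_zero_iff_dvd hv0 hv hΔ hprime hghom, hg', ← hg]
      exact mul_ne_zero (isUnit_germ hs).ne_zero hz0
    have := finite_multStalk_single hprime hv0 hghom hfd
    have hart : IsArtinian (CurveLocalRing (curvePoly D) v) (MultStalk D f 0 v) :=
      isArtinian_of_tower ℂ inferInstance
    have hle : (Ideal.span {germ (curvePoly D) v f, germ (curvePoly D) v 0}).map
        (algebraMap (CurveLocalRing (curvePoly D) v) (NormalizedLocalRing (curvePoly D) v)) ≤ Q := by
      rw [Ideal.map_le_iff_le_comap, Ideal.span_le, map_zero]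
      rintro _ (rfl | rfl)
      · exact hfQ
      · exact Ideal.zero_mem _
    let π : MultStalk D f 0 v →ₗ[CurveLocalRing (curvePoly D) v]
        NormalizedLocalRing (curvePoly D) v ⧸ Q :=
      (Submodule.factor hle).restrictScalars (CurveLocalRing (curvePoly D) v) ∘ₗ
        (e.quotientSMulTop _).toLinearMap
    have hπ : Function.Surjective π :=
      (Submodule.factor_surjective hle).comp (e.quotientSMulTop _).surjective
    have : IsArtinian (CurveLocalRing (curvePoly D) v) (NormalizedLocalRing (curvePoly D) v ⧸ Q) :=
      isArtinian_of_surjective _ π hπ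
    have : IsArtinianRing (NormalizedLocalRing (curvePoly D) v ⧸ Q) :=
      isArtinian_of_tower (CurveLocalRing (curvePoly D) v) inferInstance
    exact Ideal.Quotient.maximal_of_isField Q
      (IsArtinianRing.isField_of_isDomain (NormalizedLocalRing (curvePoly D) v ⧸ Q))
  exact { hclosed with maximalOfPrime := hdim }

/-- The stalk modulo p and q becomes the normalization modulo J = (p) + (q). The minimum of the two
orders at P is the exponent of P in J, and the length of the quotient by J counts its prime factors.
-/
theorem finsum_ord_eq_cokerMultiplicity (h : IsDirectImageAt D v) {n : ℕ} {p q : Poly3}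
    (hp : p.IsHomogeneous n) (hpd : ¬ curvePoly D ∣ p) :
    ∑ᶠ P : PointOver (curvePoly D) v, min (P.ord p) (P.ord q) = cokerMultiplicity D p q v := by
  have hΔ := curvePoly_isHomogeneous D
  have := isDomain_curveLocalRing hv0 hv hΔ hprime
  have := isDedekindDomain_normalizedLocalRing hprime hv0 hv h
  obtain ⟨e⟩ := h
  let N := NormalizedLocalRing (curvePoly D) v
  let J : Ideal N := (Ideal.span {germ (curvePoly D) v p, germ (curvePoly D) v q}).map
    (algebraMap (CurveLocalRing (curvePoly D) v) N)
  have hJ : J = Ideal.span {algebraMap _ N (germ (curvePoly D) v p)} ⊔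
      Ideal.span {algebraMap _ N (germ (curvePoly D) v q)} := by
    rw [← Ideal.span_insert]
    simp only [J]
    rw [Ideal.map_span, Set.image_pair]
  have hJ0 : J ≠ ⊥ := by
    intro h0
    have hmem : algebraMap _ N (germ (curvePoly D) v p) ∈ J := by
      rw [hJ]
      exact Ideal.mem_sup_left (Ideal.mem_span_singleton_self _)
    rw [h0, Ideal.mem_bot, map_eq_zero_iff _ (FaithfulSMul.algebraMap_injective _ _),
      germ_eq_zero_iff_dvd hv0 hv hΔ hprime hp] at hmem
    exact hpd hmem
  have h1 : ∀ P : PointOver (curvePoly D) v, min (P.ord p) (P.ord q) =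
      emultiplicity P.asIdeal J := by
    intro P
    rw [hJ, Ideal.emultiplicity_sup]
    rfl
  rw [finsum_congr h1, Ideal.finsum_emultiplicity_eq_card_normalizedFactors hJ0, cokerMultiplicity,
    (e.quotientSMulTop _).length_eq]
  exact (Ideal.length_quotient_eq_card_normalizedFactors (CurveLocalRing (curvePoly D) v)
    (fun P hP hP0 => Ideal.length_quotient_eq_one_of_isIntegral hv P (hP.isMaximal hP0)) J hJ0).symm

end normalization

/-! ### Kernel vectors at common zeros -/

/-- The functional `u ↦ r · u(v)`. -/
def pointDual {m : ℕ} (r : Fin m → ℂ) (v : Fin 3 → ℂ) : Module.Dual ℂ (Fin m → Poly3) where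
  toFun u := r ⬝ᵥ fun s => eval v (u s)
  map_add' u w := by simp [dotProduct, mul_add, Finset.sum_add_distrib]
  map_smul' c u := by simp [dotProduct, Finset.mul_sum, mul_left_comm]

theorem actDual_pointDual {m : ℕ} (r : Fin m → ℂ) (v : Fin 3 → ℂ) (f : Poly3) :
    actDual f (pointDual r v) = eval v f • pointDual r v := by
  refine LinearMap.ext fun u => ?_
  simp [pointDual, dotProduct, Finset.mul_sum, mul_left_comm]

theorem restrictDual_pointDual_ne_zero {m : ℕ} {r : Fin m → ℂ} {v : Fin 3 → ℂ} (hr : r ≠ 0)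
    (hv : v ≠ 0) (k : ℕ) : restrictDual k (pointDual r v) ≠ 0 := by
  obtain ⟨s, hs⟩ := Function.ne_iff.1 hr
  obtain ⟨a, ha⟩ := Function.ne_iff.1 hv
  intro h
  have h1 := congrFun (congrArg WithLp.ofLp h)
    (Expo.mk' (Finsupp.single a k) (Finsupp.degree_single a k), s)
  change pointDual r v (Pi.single s (monomial (Finsupp.single a k) 1)) = 0 at h1
  have h2 : pointDual r v (Pi.single s (monomial (Finsupp.single a k) 1)) = r s * v a ^ k := by
    change ∑ i, r i * eval v ((Pi.single s (monomial (Finsupp.single a k) 1) : Fin m → Poly3) i) = _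
    rw [Finset.sum_eq_single s]
    · simp [eval_monomial]
    · intro i _ hi
      simp [Pi.single_eq_of_ne hi]
    · simp
  rw [h2] at h1
  exact mul_ne_zero hs (pow_ne_zero k ha) h1

theorem exists_eq_C_of_eq_mul {Δ ℓ g : Poly3} (hΔ : ¬ IsUnit Δ) (hΔ0 : Δ ≠ 0)
    (hℓ : ℓ.IsHomogeneous 1) (h : ℓ = Δ * g) : ∃ t, g = C t := by
  by_cases hg : g = 0
  · exact ⟨0, by rw [hg, C_0]⟩
  have h1 := hℓ.totalDegree_le
  rw [h, totalDegree_mul_of_isDomain hΔ0 hg] at h1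
  have h2 : Δ.totalDegree ≠ 0 := by
    intro h0
    rw [totalDegree_eq_zero_iff_eq_C] at h0
    refine hΔ ?_
    rw [h0]
    refine (isUnit_iff_ne_zero.2 fun hc => hΔ0 ?_).map C
    rw [h0, hc, C_0]
  exact ⟨_, totalDegree_eq_zero_iff_eq_C.1 (by omega)⟩

/-- Not every linear form that vanishes at a point is divisible by an irreducible polynomial. -/
theorem exists_linForm_not_dvd {Δ : Poly3} (hprime : Prime Δ) {v : Fin 3 → ℂ} (hv : v ≠ 0) :
    ∃ c, eval v (linForm c) = 0 ∧ ¬ Δ ∣ linForm c := by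
  obtain ⟨a, ha⟩ := Function.ne_iff.1 hv
  have hindex : ∀ a : Fin 3, ∃ b c : Fin 3, b ≠ a ∧ c ≠ a ∧ b ≠ c := by decide
  obtain ⟨b, c, hba, hca, hbc⟩ := hindex a
  -- The forms v_a x_b - v_b x_a vanish at v. If Δ divided two of them, both would be scalar
  -- multiples of Δ by degree, although they are independent.
  let ℓ : Fin 3 → Fin 3 → ℂ := fun b => Pi.single b (v a) - Pi.single a (v b)
  have hℓ : ∀ b x, eval x (linForm (ℓ b)) = v a * x b - v b * x a := by
    intro b x
    simp [eval_linForm, ℓ, sub_mul, Finset.sum_sub_distrib, Pi.single_apply]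
  have hℓv : ∀ b, eval v (linForm (ℓ b)) = 0 := fun b => by rw [hℓ]; ring
  by_contra! h
  obtain ⟨g, hg⟩ := h _ (hℓv b)
  obtain ⟨g', hg'⟩ := h _ (hℓv c)
  obtain ⟨s, rfl⟩ := exists_eq_C_of_eq_mul hprime.not_isUnit hprime.ne_zero
    (linForm_isHomogeneous _) hg
  obtain ⟨t, rfl⟩ := exists_eq_C_of_eq_mul hprime.not_isUnit hprime.ne_zero
    (linForm_isHomogeneous _) hg'
  have key : ∀ x, t * eval x (linForm (ℓ b)) = s * eval x (linForm (ℓ c)) := by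
    intro x
    rw [hg, hg', map_mul, map_mul, eval_C, eval_C]
    ring
  have h1 := key (Pi.single b 1)
  rw [hℓ, hℓ, Pi.single_eq_same, Pi.single_eq_of_ne hba.symm, Pi.single_eq_of_ne hbc.symm] at h1
  simp only [mul_one, mul_zero, sub_zero, mul_eq_zero] at h1
  have ht := h1.resolve_right ha
  rw [ht, C_0, mul_zero] at hg'
  have h2 := hℓ c (Pi.single c 1)
  rw [hg', map_zero, Pi.single_eq_same, Pi.single_eq_of_ne hca.symm] at h2
  exact ha (by simpa using h2.symm)

/-- Take Φ(u) = r · u(v) with r in the kernel of the pencil at v. Polynomials act on Φ by their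
values at v, so the exchange identity for a linear form ℓ with ℓ(v) = 0 and one with value 1 at v
reduces to ℓ b(Φ) = 0 in E. Cancelling ℓ gives the kernel vector, whether or not p and q vanish on
the curve. -/
theorem exists_ne_zero_alongCurve_eq_zero {m : ℕ} {D : Fin 3 → Matrix (Fin m) (Fin m) ℂ}
    (hD : ∀ l, (D l).IsHermitian) (hprime : Prime (pencil D).det) {k : ℕ} {p q : Poly3}
    (b : BezoutCoeffs k p q) {v : Fin 3 → ℂ} (hv : v ≠ 0) (hΔ : eval v (pencil D).det = 0)
    (hp : eval v p = 0) (hq : eval v q = 0) : ∃ w, w ≠ 0 ∧ b.alongCurve D w = 0 := by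
  obtain ⟨r, hr, hr'⟩ := exists_fibre_functional (pencil D).transpose v
    (by rwa [Matrix.det_transpose])
  have hdual : IsDualVector D (pointDual r v) := fun u =>
    hr' 0 0 (map_zero _) (map_zero _) _ (mulVec_mem_relations _ 0 0 u)
  obtain ⟨c, hc, hcd⟩ := exists_linForm_not_dvd hprime hv
  obtain ⟨b'⟩ := bezoutCoeffs_nonempty (k := 0) (linForm_isHomogeneous c)
    (chartForm_isHomogeneous v)
  have h := bezoutApply_exchange D b.isBezoutian b'.isBezoutian hdual
  simp only [actDual_pointDual, hp, hq, hc, eval_chartForm hv, zero_smul, one_smul,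
    bezoutApply_zero, smul_zero, sub_zero] at h
  refine ⟨⟨_, restrictDual_mem D hdual k⟩, fun h0 => ?_, ?_⟩
  · exact restrictDual_pointDual_ne_zero hr hv k (congrArg Subtype.val h0)
  · rw [b.alongCurve_eq_zero hD, ← b.bezoutApply_toPoly]
    exact mem_relations_zero_of_smul hprime hcd h

/-! ### The kernel of the generalized Bezout matrix -/

section kernel

variable {m : ℕ} {D : Fin 3 → Matrix (Fin m) (Fin m) ℂ}

theorem commonZeros_comm (p q : Poly3) : commonZeros D p q = commonZeros D q p :=
  Set.ext fun _ => and_congr_right fun _ => and_comm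

theorem cokerMultiplicity_comm (p q : Poly3) (v : Fin 3 → ℂ) :
    cokerMultiplicity D p q v = cokerMultiplicity D q p v := by
  rw [cokerMultiplicity, cokerMultiplicity, Set.pair_comm]

theorem numCommonZeros_comm (p q : Poly3) : numCommonZeros D p q = numCommonZeros D q p := by
  simp only [numCommonZeros, commonZeros_comm p q, min_comm]

/-- Without projective zeros Δ would divide powers of all variables, by the Nullstellensatz, and
would be a unit. -/
theorem curvePoly_zeros_nonempty (hprime : Prime (curvePoly D)) :
    ∃ x : ℙ ℂ (Fin 3 → ℂ), eval x.rep (curvePoly D) = 0 := by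
  by_contra! h
  have h0 : ∀ l, curvePoly D ∣ X l := by
    intro l
    have hrad : (X l : Poly3) ∈ (Ideal.span {curvePoly D}).radical := by
      refine mem_radical_of_forall_eval _ _ fun x hx => ?_
      by_cases hx0 : x = 0
      · simp [hx0]
      · exact absurd (((curvePoly_isHomogeneous D).eval_rep_eq_zero_iff hx0).2
          (hx _ (Ideal.mem_span_singleton_self _))) (h _)
    obtain ⟨K, hK⟩ := hrad
    exact hprime.dvd_of_dvd_pow (Ideal.mem_span_singleton.1 hK)
  refine hprime.not_isUnit (isRelPrime_of_forall_eval (f := X 0) (g := X 1) 2 ?_ (h0 0) (h0 1))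
  intro x hx0 hx1 b hb
  rw [eval_X] at hx0 hx1
  fin_cases b
  · exact hx0
  · exact hx1
  · exact absurd rfl hb

variable (hD : ∀ l, (D l).IsHermitian) (hprime : Prime (curvePoly D)) {k : ℕ} {p q : Poly3}
  (hp : p.IsHomogeneous (k + 1)) (hq : q.IsHomogeneous (k + 1))

include hprime hp in
theorem commonZeros_finite (hpd : ¬ curvePoly D ∣ p) : (commonZeros D p q).Finite :=
  (finite_zeros (pencil_isHomogeneous D) hprime hp hpd).subset fun _ hx => ⟨hx.1, hx.2.1⟩

include hprime hp in
theorem numCommonZeros_eq_finsum (hpd : ¬ curvePoly D ∣ p)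
    (h : ∀ x ∈ commonZeros D p q, IsSingularAt (curvePoly D) x.rep → IsDirectImageAt D x.rep) :
    numCommonZeros D p q = ∑ᶠ x ∈ commonZeros D p q, cokerMultiplicity D p q x.rep := by
  refine finsum_mem_congr rfl fun x hx => ?_
  refine finsum_ord_eq_cokerMultiplicity hprime x.rep_nonzero hx.1 ?_ hp hpd
  by_cases hs : IsSingularAt (curvePoly D) x.rep
  · exact h x hx hs
  · exact isDirectImageAt_of_not_isSingularAt hprime x.rep_nonzero hx.1 hs

include hD hprime hp hq

theorem finrank_ker_eq_finsum (hpd : ¬ curvePoly D ∣ p) (b : BezoutCoeffs k p q) :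
    (Module.finrank ℂ (LinearMap.ker (b.alongCurve D)) : ℕ∞) =
      ∑ᶠ x ∈ commonZeros D p q, cokerMultiplicity D p q x.rep := by
  obtain ⟨c, hc0, hc⟩ := exists_linForm_regular (curvePoly_isHomogeneous D)
    (pencil_isHomogeneous D) hprime hp hpd
  have hreg := relations_regular_of_forall (A := pencil D) (by omega) hprime hp hc0 hc
  have hregT := relations_regular_of_forall (A := (pencil D).transpose) (by omega)
    (by rwa [Matrix.det_transpose]) hp hc0 (by rwa [Matrix.det_transpose])
  rw [finrank_ker_alongCurve hD hprime hp hq hpd hreg hregT b]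
  exact gradedDim_eq_finsum hp hq hprime hreg (by omega) hpd
    (commonZeros_finite hprime hp hpd) (by omega)

theorem finrank_ker_eq (hpq : ¬ (curvePoly D ∣ p ∧ curvePoly D ∣ q)) (b : BezoutCoeffs k p q) :
    (commonZeros D p q).Finite ∧
      ((∀ x ∈ commonZeros D p q,
          IsSingularAt (curvePoly D) x.rep → IsDirectImageAt D x.rep) →
        (Module.finrank ℂ (LinearMap.ker (b.alongCurve D)) : ℕ∞) = numCommonZeros D p q) ∧
      (Module.finrank ℂ (LinearMap.ker (b.alongCurve D)) : ℕ∞) =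
        ∑ᶠ x ∈ commonZeros D p q, cokerMultiplicity D p q x.rep := by
  by_cases hpd : curvePoly D ∣ p
  · have hqd : ¬ curvePoly D ∣ q := fun h => hpq ⟨hpd, h⟩
    have hb := finrank_ker_eq_finsum hD hprime hq hp hqd b.swap
    rw [b.swap_alongCurve, show LinearMap.ker (-b.alongCurve D) = LinearMap.ker (b.alongCurve D) by
      ext w; simp] at hb
    simp only [commonZeros_comm p q, cokerMultiplicity_comm p q, numCommonZeros_comm p q]
    exact ⟨commonZeros_finite hprime hq hqd,
      fun h => hb.trans (numCommonZeros_eq_finsum hprime hq hqd h).symm, hb⟩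
  · have hb := finrank_ker_eq_finsum hD hprime hp hq hpd b
    exact ⟨commonZeros_finite hprime hp hpd,
      fun h => hb.trans (numCommonZeros_eq_finsum hprime hp hpd h).symm, hb⟩

theorem det_alongCurve_eq_zero_iff (b : BezoutCoeffs k p q) :
    LinearMap.det (b.alongCurve D) = 0 ↔ (commonZeros D p q).Nonempty := by
  constructor
  · intro hdet
    by_cases hpq : curvePoly D ∣ p ∧ curvePoly D ∣ q
    · obtain ⟨x, hx⟩ := curvePoly_zeros_nonempty hprime
      have hdvd : ∀ f, curvePoly D ∣ f → eval x.rep f = 0 := by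
        rintro _ ⟨g, rfl⟩
        rw [map_mul, hx, zero_mul]
      exact ⟨x, hx, hdvd p hpq.1, hdvd q hpq.2⟩
    · by_contra hempty
      rw [Set.not_nonempty_iff_eq_empty] at hempty
      have h := (finrank_ker_eq hD hprime hp hq hpq b).2.2
      rw [hempty, finsum_mem_empty, Nat.cast_eq_zero, Submodule.finrank_eq_zero] at h
      exact LinearMap.det_eq_zero_iff_ker_ne_bot.1 hdet h
  · rintro ⟨x, hx, hpx, hqx⟩
    obtain ⟨w, hw0, hw⟩ := exists_ne_zero_alongCurve_eq_zero hD hprime b x.rep_nonzero hx hpx hqx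
    refine LinearMap.det_eq_zero_iff_ker_ne_bot.2 fun h => hw0 ?_
    exact LinearMap.ker_eq_bot'.1 h w hw

end kernel

end

theorem theorem2p6 {m : ℕ} (D : Fin 3 → Matrix (Fin m) (Fin m) ℂ)
    (hD : ∀ l, (D l).IsHermitian) (hirr : Irreducible (curvePoly D))
    {n : ℕ} (hn : 1 ≤ n) (p q : Poly3)
    (hp : p.IsHomogeneous n) (hq : q.IsHomogeneous n) :
    Nonempty (BezoutCoeffs (n - 1) p q) ∧
    ∀ b : BezoutCoeffs (n - 1) p q,
      -- the determinant vanishes exactly when there is a common zero on the curve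
      (LinearMap.det (b.alongCurve D) = 0 ↔ (commonZeros D p q).Nonempty) ∧
      -- the number of common zeros, when `p` and `q` do not both vanish on the whole curve
      (¬ (curvePoly D ∣ p ∧ curvePoly D ∣ q) →
        (commonZeros D p q).Finite ∧
        ((∀ x ∈ commonZeros D p q,
            IsSingularAt (curvePoly D) x.rep → IsDirectImageAt D x.rep) →
          (Module.finrank ℂ (LinearMap.ker (b.alongCurve D)) : ℕ∞) = numCommonZeros D p q) ∧
        (Module.finrank ℂ (LinearMap.ker (b.alongCurve D)) : ℕ∞) =
          ∑ᶠ x ∈ commonZeros D p q, cokerMultiplicity D p q x.rep) := by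
  obtain ⟨k, rfl⟩ : ∃ k, n = k + 1 := ⟨n - 1, by omega⟩
  exact ⟨bezoutCoeffs_nonempty hp hq, fun b =>
    ⟨det_alongCurve_eq_zero_iff hD hirr.prime hp hq b,
      fun hpq => finrank_ker_eq hD hirr.prime hp hq hpq b⟩⟩
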